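/- Let $1<\alpha<2$ and $B_\alpha=\{(x,y)\in\mathbb{R}^2:|x|^\alpha+|y|^\alpha\le 1\}$. For a compact set $D\subset\mathbb{R}^2$ with non-empty interior and an integer $n\ge 1$, let $$\lambda_n(D,\boldsymbol{x})=\Big(\sum_{k=1}^N\phi_k(\boldsymbol{x})^2\Big)^{-1}$$ be the Christoffel function, where $\{\phi_k\}_{k=1}^N$ is any orthonormal basis of the space of real polynomials of total degree at most $n$ in two variables with respect to the inner product $\langle f,g\rangle=\int_D f g$. Write $|\cdot|$ for the Euclidean norm. (i) There are constants $c_0\in(0,1)$ and $c>0$, depending only on $\alpha$, such that the following holds. Let $(x_0,y_0)\in\partial B_\alpha$ with $0\le x_0\le y_0$, let $\boldsymbol{u}$ be the outward unit normal to $B_\alpha$ at $(x_0,y_0)$, and let $\boldsymbol{v}$ be either of the two unit vectors orthogonal to $\boldsymbol{u}$. Then for $i=1,2$ the maximum $$l_i(t)=\max\{s\in\mathbb{R}:(x_0,y_0)-t\boldsymbol{u}+(-1)^is\boldsymbol{v}\in B_\alpha\}$$ exists for all $0<t<1$, and for all $0<t\le c_0$ $$c^{-1}\,t^{\frac12}\big(\max\{t,x_0^\alpha\}\big)^{\frac1\alpha-\frac12}\le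 l_i(t)\le c\,t^{\frac12}\big(\max\{t,x_0^\alpha\}\big)^{\frac1\alpha-\frac12}.$$ (ii) For every $\sigma>0$ there is a constant $c>0$, depending only on $\alpha$ and $\sigma$, such that the following holds. Let $n\ge1$ be an integer, let $(x_0,y_0)\in\partial B_\alpha$ with $0\le x_0\le y_0$, and let $\boldsymbol{x}\in B_\alpha\setminus\partial B_\alpha$ be such that $\delta:=|\boldsymbol{x}-(x_0,y_0)|=\min\{|\boldsymbol{x}-\boldsymbol{z}|:\boldsymbol{z}\in\partial B_\alpha\}$ and $\sigma n^{-2}\le\delta\le1$. Then $$c^{-1}\,n^{-2}\delta^{\frac12}\big(\max\{\delta,x_0^\alpha\}\big)^{\frac1\alpha-\frac12}\le\lambda_n(B_\alpha,\boldsymbol{x})\le c\,n^{-2}\delta^{\frac12}\big(\max\{\delta,x_0^\alpha\}\big)^{\frac1\alpha-\frac12}.$$ -/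

import Mathlib

open MeasureTheory

namespace Christoffel

/-- The space of real polynomials in `d` variables of total degree at most `n`. -/
noncomputable abbrev Poly (d n : ℕ) : Submodule ℝ (MvPolynomial (Fin d) ℝ) :=
  MvPolynomial.restrictTotalDegree (Fin d) ℝ n

/-- The value of a polynomial in `d` variables at a point of `ℝ^d`. -/
noncomputable def pval {d : ℕ} (f : MvPolynomial (Fin d) ℝ) (x : EuclideanSpace ℝ (Fin d)) : ℝ :=
  MvPolynomial.eval (fun j => x j) f

/-- The inner product `∫_D f g` of two polynomials (Lebesgue measure, uniform weight). -/
noncomputable def polyInner {d : ℕ} (D : Set (EuclideanSpace ℝ (Fin d)))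
    (f g : MvPolynomial (Fin d) ℝ) : ℝ :=
  ∫ y in D, pval f y * pval g y

/-- A basis of the polynomials of degree at most `n` that is orthonormal for `∫_D f g`. -/
def IsOrthonormalBasis {d n : ℕ} (D : Set (EuclideanSpace ℝ (Fin d)))
    (φ : Module.Basis (Fin (Module.finrank ℝ (Poly d n))) ℝ (Poly d n)) : Prop :=
  ∀ j k, polyInner D (φ j : MvPolynomial (Fin d) ℝ) (φ k : MvPolynomial (Fin d) ℝ)
    = if j = k then 1 else 0

open Classical in
/-- The Christoffel function `λ_n(D, x) = (∑ φ_k(x)²)⁻¹` (uniform weight), where `φ` is an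
orthonormal basis of the polynomials of degree at most `n`. For a compact set `D` with non-empty
interior such a basis exists (`exists_isOrthonormalBasis`) and the value does not depend on
which one is taken (`christoffel_eq`). -/
noncomputable def christoffel {d : ℕ} (n : ℕ) (D : Set (EuclideanSpace ℝ (Fin d)))
    (x : EuclideanSpace ℝ (Fin d)) : ℝ :=
  if h : ∃ φ : Module.Basis (Fin (Module.finrank ℝ (Poly d n))) ℝ (Poly d n),
      IsOrthonormalBasis D φ then
    (∑ k, pval (h.choose k : MvPolynomial (Fin d) ℝ) x ^ 2)⁻¹
  else 0

theorem continuous_pval {d : ℕ} (f : MvPolynomial (Fin d) ℝ) : Continuous (pval f) := by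
  have h := MvPolynomial.continuous_eval f
  exact h.comp (by fun_prop : Continuous fun x : EuclideanSpace ℝ (Fin d) => fun j => x j)

theorem integrableOn_pval_mul {d : ℕ} {D : Set (EuclideanSpace ℝ (Fin d))} (hD : IsCompact D)
    (f g : MvPolynomial (Fin d) ℝ) : IntegrableOn (fun y => pval f y * pval g y) D :=
  ((continuous_pval f).mul (continuous_pval g)).continuousOn.integrableOn_compact hD

theorem eq_zero_of_polyInner_self {d : ℕ} {D : Set (EuclideanSpace ℝ (Fin d))}
    (hD : IsCompact D) (hi : (interior D).Nonempty) (f : MvPolynomial (Fin d) ℝ)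
    (h : polyInner D f f = 0) : f = 0 := by
  have hint := integrableOn_pval_mul hD f f
  have hae := (integral_eq_zero_iff_of_nonneg (fun y => mul_self_nonneg (pval f y)) hint).1 h
  have hae' : (fun y => pval f y * pval f y) =ᵐ[volume.restrict (interior D)] fun _ => 0 :=
    ae_mono (Measure.restrict_mono interior_subset le_rfl) hae
  have hz := Measure.eqOn_open_of_ae_eq hae' isOpen_interior
    ((continuous_pval f).mul (continuous_pval f)).continuousOn continuousOn_const
  obtain ⟨a, ha⟩ := hi
  have ho : IsOpen ((WithLp.toLp 2 : (Fin d → ℝ) → EuclideanSpace ℝ (Fin d)) ⁻¹' interior D) :=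
    isOpen_interior.preimage (PiLp.continuous_toLp 2 _)
  obtain ⟨r, hr, hb⟩ := Metric.isOpen_iff.1 ho (WithLp.ofLp a) (by simpa using ha)
  apply MvPolynomial.funext_set (fun j => Metric.ball (WithLp.ofLp a j) r)
  · intro j
    exact infinite_of_mem_nhds (WithLp.ofLp a j) (Metric.ball_mem_nhds _ hr)
  · intro y hy
    rw [← ball_pi _ hr] at hy
    have := hz (hb hy)
    simpa [pval] using this

theorem polyInner_comm {d : ℕ} (D : Set (EuclideanSpace ℝ (Fin d)))
    (f g : MvPolynomial (Fin d) ℝ) : polyInner D f g = polyInner D g f := by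
  simp only [polyInner, mul_comm]

theorem polyInner_add_left {d : ℕ} {D : Set (EuclideanSpace ℝ (Fin d))} (hD : IsCompact D)
    (f g h : MvPolynomial (Fin d) ℝ) :
    polyInner D (f + g) h = polyInner D f h + polyInner D g h := by
  unfold polyInner
  rw [← integral_add (integrableOn_pval_mul hD f h) (integrableOn_pval_mul hD g h)]
  simp only [pval, map_add, add_mul]

theorem polyInner_smul_left {d : ℕ} (D : Set (EuclideanSpace ℝ (Fin d))) (c : ℝ)
    (f g : MvPolynomial (Fin d) ℝ) : polyInner D (c • f) g = c * polyInner D f g := by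
  unfold polyInner
  rw [← integral_const_mul]
  simp only [pval, MvPolynomial.smul_eval, mul_assoc]

theorem polyInner_sum_left {d : ℕ} {D : Set (EuclideanSpace ℝ (Fin d))} (hD : IsCompact D)
    {ι : Type*} (s : Finset ι) (c : ι → ℝ) (f : ι → MvPolynomial (Fin d) ℝ)
    (g : MvPolynomial (Fin d) ℝ) :
    polyInner D (∑ k ∈ s, c k • f k) g = ∑ k ∈ s, c k * polyInner D (f k) g := by
  classical
  induction s using Finset.induction_on with
  | empty => simp [polyInner, pval]
  | insert a s ha ih =>
    rw [Finset.sum_insert ha, Finset.sum_insert ha, polyInner_add_left hD,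
      polyInner_smul_left, ih]

theorem exists_isOrthonormalBasis {d : ℕ} (n : ℕ) {D : Set (EuclideanSpace ℝ (Fin d))}
    (hD : IsCompact D) (hi : (interior D).Nonempty) :
    ∃ φ : Module.Basis (Fin (Module.finrank ℝ (Poly d n))) ℝ (Poly d n),
      IsOrthonormalBasis D φ := by
  let core : InnerProductSpace.Core ℝ (Poly d n) :=
    { inner := fun f g => polyInner D f g
      conj_inner_symm := fun f g => by
        simpa using polyInner_comm D g f
      re_inner_nonneg := fun f => by
        exact integral_nonneg (fun y => mul_self_nonneg (pval (f : MvPolynomial _ ℝ) y))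
      add_left := fun f g h => polyInner_add_left hD f g h
      smul_left := fun f g c => by
        simpa using polyInner_smul_left D c f g
      definite := fun f hf => Subtype.ext (eq_zero_of_polyInner_self hD hi f hf) }
  let _ : NormedAddCommGroup (Poly d n) := core.toNormedAddCommGroup
  let _ : InnerProductSpace ℝ (Poly d n) := InnerProductSpace.ofCore core.toCore
  let b := stdOrthonormalBasis ℝ (Poly d n)
  refine ⟨b.toBasis, fun j k => ?_⟩
  have := orthonormal_iff_ite.1 b.orthonormal j k
  rw [OrthonormalBasis.coe_toBasis]
  exact this

/-- The reproducing property of an orthonormal basis. -/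
theorem pval_eq_polyInner_kernel {d n : ℕ} {D : Set (EuclideanSpace ℝ (Fin d))}
    (hD : IsCompact D)
    {φ : Module.Basis (Fin (Module.finrank ℝ (Poly d n))) ℝ (Poly d n)}
    (hφ : IsOrthonormalBasis D φ) (x : EuclideanSpace ℝ (Fin d)) (f : Poly d n) :
    polyInner D (∑ k, pval (φ k : MvPolynomial (Fin d) ℝ) x • (φ k : MvPolynomial (Fin d) ℝ))
      (f : MvPolynomial (Fin d) ℝ) = pval (f : MvPolynomial (Fin d) ℝ) x := by
  have hf : (f : MvPolynomial (Fin d) ℝ) = ∑ k, φ.repr f k • (φ k : MvPolynomial (Fin d) ℝ) := by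
    have h0 := congrArg (Submodule.subtype _) (φ.sum_repr f)
    rw [map_sum] at h0
    simpa only [map_smul, Submodule.subtype_apply] using h0.symm
  have h1 : ∀ k, polyInner D (φ k : MvPolynomial (Fin d) ℝ) (f : MvPolynomial (Fin d) ℝ)
      = φ.repr f k := by
    intro k
    rw [polyInner_comm, hf, polyInner_sum_left hD]
    simp [hφ _ k]
  rw [polyInner_sum_left hD]
  simp only [h1]
  rw [hf]
  simp [pval, mul_comm]

/-- The Christoffel function may be computed from any orthonormal basis. -/
theorem christoffel_eq {d n : ℕ} {D : Set (EuclideanSpace ℝ (Fin d))} (hD : IsCompact D)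
    {φ : Module.Basis (Fin (Module.finrank ℝ (Poly d n))) ℝ (Poly d n)}
    (hφ : IsOrthonormalBasis D φ) (x : EuclideanSpace ℝ (Fin d)) :
    christoffel n D x = (∑ k, pval (φ k : MvPolynomial (Fin d) ℝ) x ^ 2)⁻¹ := by
  have h : ∃ φ : Module.Basis (Fin (Module.finrank ℝ (Poly d n))) ℝ (Poly d n),
    IsOrthonormalBasis D φ := ⟨φ, hφ⟩
  rw [christoffel, dif_pos h]
  have hψ := h.choose_spec
  generalize h.choose = ψ at hψ
  congr 1
  have key : ∀ φ ψ : Module.Basis (Fin (Module.finrank ℝ (Poly d n))) ℝ (Poly d n),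
      IsOrthonormalBasis D φ → IsOrthonormalBasis D ψ →
      polyInner D (∑ k, pval (φ k : MvPolynomial (Fin d) ℝ) x • (φ k : MvPolynomial (Fin d) ℝ))
        (∑ k, pval (ψ k : MvPolynomial (Fin d) ℝ) x • (ψ k : MvPolynomial (Fin d) ℝ))
      = ∑ k, pval (ψ k : MvPolynomial (Fin d) ℝ) x ^ 2 := by
    intro φ ψ hφ _
    have := pval_eq_polyInner_kernel hD hφ x
      (∑ k, pval (ψ k : MvPolynomial (Fin d) ℝ) x • ψ k)
    simp only [Submodule.coe_sum, Submodule.coe_smul] at this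
    rw [this]
    simp [pval, pow_two]
  rw [← key φ ψ hφ hψ, polyInner_comm, key ψ φ hψ hφ]

/-- The domain `B_α = {(x, y) : |x|^α + |y|^α ≤ 1}` in the Euclidean plane. -/
def lpBall (α : ℝ) : Set (EuclideanSpace ℝ (Fin 2)) :=
  {z | |z 0| ^ α + |z 1| ^ α ≤ 1}

/-- `u` is an outward unit normal of the convex set `D` at its boundary point `p`. -/
def IsOutwardUnitNormal (D : Set (EuclideanSpace ℝ (Fin 2)))
    (p u : EuclideanSpace ℝ (Fin 2)) : Prop :=
  p ∈ frontier D ∧ ‖u‖ = 1 ∧ ∀ z ∈ D, inner ℝ u (z - p) ≤ 0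

/-- The set of all `s` with `p - t u + (-1)^i s v ∈ D`. -/
def sectionSet (D : Set (EuclideanSpace ℝ (Fin 2))) (p u v : EuclideanSpace ℝ (Fin 2))
    (i : ℕ) (t : ℝ) : Set ℝ :=
  {s | p - t • u + ((-1 : ℝ) ^ i * s) • v ∈ D}

/-- The modified section half-length `l_i(t) = max {s : p - t u + (-1)^i s v ∈ D}`. -/
noncomputable def halfLength (D : Set (EuclideanSpace ℝ (Fin 2)))
    (p u v : EuclideanSpace ℝ (Fin 2)) (i : ℕ) (t : ℝ) : ℝ :=
  sSup (sectionSet D p u v i t)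

end Christoffel

namespace Christoffel

/-! Write `M = max(t, x₀^α)` and `W = M^(1/α - 1/2)`. Both halves of the theorem measure the shape
of `B_α` near `p = (x₀, y₀)`: at depth `t` along the normal the body has tangential width of order
`√t W`, and the Christoffel function is then of order `n⁻²` times this width.

Inner geometry. Moving from `p` by `T` along the inward normal lowers `|x|^α + |y|^α` to first order
by a multiple of `T`. A tangential move `X` costs only the second-order deviation from the tangent
line, bounded by a multiple of `|s|^α` or of `s² x^(α-2)`, whichever suits the size of `x`. Hence
`X² ≤ const · T · W²` is allowed (`OnArc.abs_rpow_add_abs_rpow_le_one`). This gives long sections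
and, near each point, an inscribed ellipse with tangential semi-axis of order `W`.

Outer geometry. In the coordinates `(x^(α/2), y^(α/2))` the arc is part of the unit circle. A hop of
order `√δ` on that circle leads to a boundary point whose supporting functional has defect `O(δ)` at
`p`, while its determinant with the supporting functional at `p` is at least of order `√δ / W`
(`OnArc.exists_functional_right`, `OnArc.exists_functional_left`). Evaluating such functionals on a
section bounds its length by a multiple of `√t W`.

Lower bound for `λ_n`. By duality a bound `f(x)² ≤ C ∫ f²` for all polynomials gives `λ_n ≥ 1/C`. On
an ellipse it follows from two applications of a one-dimensional Nikolskii inequality, the second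
with a Dirichlet kernel that localises the weight (`pval_sq_mul_le_of_ellipse`). At relative depth
of order `δ` below the tip it gives `C` of order `n² / (√δ W)`.

Upper bound for `λ_n`. The competitor is a product of two Fejér-type polynomials, one in each of the
two functionals; Fubini over the circumscribed parallelogram gives `λ_n · det = O(n⁻² δ)`
(`det_mul_christoffel_le`). Dividing by `det`, which is at least of order `√δ / W`, yields the
estimate. The assumption `σ n⁻² ≤ δ` serves to absorb all terms of size `1/n` into `√δ`. -/

/-! ### Variational characterisation of the Christoffel function. -/

/-- The Christoffel function is at most the normalised energy of any competitor. -/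
theorem christoffel_mul_sq_le {d n : ℕ} {D : Set (EuclideanSpace ℝ (Fin d))}
    (hD : IsCompact D) (hi : (interior D).Nonempty) (x : EuclideanSpace ℝ (Fin d))
    {f : MvPolynomial (Fin d) ℝ} (hf : f ∈ Poly d n) :
    christoffel n D x * pval f x ^ 2 ≤ polyInner D f f := by
  obtain ⟨φ, hφ⟩ := exists_isOrthonormalBasis n hD hi
  rw [christoffel_eq hD hφ x]
  set K : MvPolynomial (Fin d) ℝ :=
    ∑ k, pval (φ k : MvPolynomial (Fin d) ℝ) x • (φ k : MvPolynomial (Fin d) ℝ) with hK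
  set S : ℝ := ∑ k, pval (φ k : MvPolynomial (Fin d) ℝ) x ^ 2 with hS
  have hKmem : K ∈ Poly d n := Submodule.sum_mem _ fun k _ => Submodule.smul_mem _ _ (φ k).2
  have hKx : pval K x = S := by simp [hK, hS, pval, pow_two]
  have hKK : polyInner D K K = S := by
    rw [← hKx]; exact pval_eq_polyInner_kernel hD hφ x ⟨K, hKmem⟩
  have hKf : polyInner D K f = pval f x := pval_eq_polyInner_kernel hD hφ x ⟨f, hf⟩
  have hS0 : 0 ≤ S := Finset.sum_nonneg fun k _ => sq_nonneg _
  rcases hS0.eq_or_lt with h0 | h0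
  · rw [← h0, inv_zero, zero_mul]
    exact integral_nonneg fun y => mul_self_nonneg (pval f y)
  -- The minimiser of the energy of `c K + f`, where `K` is the reproducing kernel at `x`:
  -- nonnegativity there is the Cauchy–Schwarz inequality for `K` and `f`.
  set c : ℝ := -(pval f x / S)
  have hge : 0 ≤ polyInner D (c • K + f) (c • K + f) :=
    integral_nonneg fun y => mul_self_nonneg _
  rw [polyInner_add_left hD, polyInner_smul_left, polyInner_comm D K, polyInner_comm D f,
    polyInner_add_left hD, polyInner_add_left hD, polyInner_smul_left, polyInner_smul_left,
    polyInner_comm D f K, hKK, hKf] at hge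
  have : c * (c * S + pval f x) + (c * pval f x + polyInner D f f)
      = polyInner D f f - S⁻¹ * pval f x ^ 2 := by
    simp only [c]; field_simp; ring
  linarith

/-- A pointwise bound for all polynomials bounds the Christoffel function from below. -/
theorem inv_le_christoffel {d n : ℕ} {D : Set (EuclideanSpace ℝ (Fin d))}
    (hD : IsCompact D) (hi : (interior D).Nonempty) (x : EuclideanSpace ℝ (Fin d))
    {C : ℝ} (hC : ∀ f ∈ Poly d n, pval f x ^ 2 ≤ C * polyInner D f f) :
    C⁻¹ ≤ christoffel n D x := by
  obtain ⟨φ, hφ⟩ := exists_isOrthonormalBasis n hD hi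
  rw [christoffel_eq hD hφ x]
  set K : MvPolynomial (Fin d) ℝ :=
    ∑ k, pval (φ k : MvPolynomial (Fin d) ℝ) x • (φ k : MvPolynomial (Fin d) ℝ) with hK
  set S : ℝ := ∑ k, pval (φ k : MvPolynomial (Fin d) ℝ) x ^ 2 with hS
  have hKmem : K ∈ Poly d n := Submodule.sum_mem _ fun k _ => Submodule.smul_mem _ _ (φ k).2
  have hKx : pval K x = S := by simp [hK, hS, pval, pow_two]
  have hKK : polyInner D K K = S := by
    rw [← hKx]; exact pval_eq_polyInner_kernel hD hφ x ⟨K, hKmem⟩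
  have h1 : (1 : MvPolynomial (Fin d) ℝ) ∈ Poly d n := by
    simp [MvPolynomial.mem_restrictTotalDegree]
  have hK1 : polyInner D K 1 = 1 := by
    have := pval_eq_polyInner_kernel hD hφ x ⟨1, h1⟩
    rw [← hK] at this
    rw [this]
    simp [pval]
  -- `K` reproduces the constant `1`, so it cannot vanish; this excludes the default value `0⁻¹ =
  -- 0`. The bound then comes from `hC` applied to `K` itself, for which `K(x)² = S²` and the energy
  -- is `S`.
  have hS0 : 0 < S := by
    rcases (Finset.sum_nonneg fun k _ => sq_nonneg _ : 0 ≤ S).eq_or_lt with h0 | h0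
    · have : K = 0 := eq_zero_of_polyInner_self hD hi K (by rw [hKK, hS, ← h0])
      rw [this] at hK1
      simp [polyInner, pval] at hK1
    · exact h0
  have := hC K hKmem
  rw [hKx, hKK, pow_two] at this
  exact inv_anti₀ hS0 (le_of_mul_le_mul_right this hS0)

/-! ### Trigonometric polynomials and a Nikolskii inequality. -/

/-- `f` is a trigonometric polynomial of degree at most `N`. -/
def IsTrigPoly (N : ℕ) (f : ℝ → ℂ) : Prop :=
  ∃ q : Polynomial ℂ, q.natDegree ≤ 2 * N ∧
    ∀ θ : ℝ, f θ * Complex.exp (θ * Complex.I) ^ N = q.eval (Complex.exp (θ * Complex.I))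

theorem IsTrigPoly.mono {M N : ℕ} {f : ℝ → ℂ} (hf : IsTrigPoly M f) (h : M ≤ N) :
    IsTrigPoly N f := by
  obtain ⟨q, hq, hfq⟩ := hf
  refine ⟨q * Polynomial.X ^ (N - M), ?_, fun θ => ?_⟩
  · refine Polynomial.natDegree_mul_le.trans ?_
    rw [Polynomial.natDegree_X_pow]
    omega
  · rw [Polynomial.eval_mul, ← hfq, Polynomial.eval_pow, Polynomial.eval_X, mul_assoc, ← pow_add]
    congr 2
    omega

theorem IsTrigPoly.mul {M N : ℕ} {f g : ℝ → ℂ} (hf : IsTrigPoly M f) (hg : IsTrigPoly N g) :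
    IsTrigPoly (M + N) fun θ => f θ * g θ := by
  obtain ⟨q, hq, hfq⟩ := hf
  obtain ⟨r, hr, hgr⟩ := hg
  refine ⟨q * r, Polynomial.natDegree_mul_le.trans (by omega), fun θ => ?_⟩
  rw [Polynomial.eval_mul, ← hfq, ← hgr]
  ring

theorem IsTrigPoly.add {N : ℕ} {f g : ℝ → ℂ} (hf : IsTrigPoly N f) (hg : IsTrigPoly N g) :
    IsTrigPoly N fun θ => f θ + g θ := by
  obtain ⟨q, hq, hfq⟩ := hf
  obtain ⟨r, hr, hgr⟩ := hg
  refine ⟨q + r, Polynomial.natDegree_add_le_of_degree_le hq hr, fun θ => ?_⟩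
  rw [Polynomial.eval_add, ← hfq, ← hgr]
  ring

theorem isTrigPoly_const (c : ℂ) : IsTrigPoly 0 fun _ => c :=
  ⟨Polynomial.C c, by simp, by simp⟩

theorem IsTrigPoly.pow {N : ℕ} {f : ℝ → ℂ} (hf : IsTrigPoly N f) (k : ℕ) :
    IsTrigPoly (k * N) fun θ => f θ ^ k := by
  induction k with
  | zero => simpa using isTrigPoly_const 1
  | succ k ih =>
    simp only [pow_succ, Nat.succ_mul]
    exact ih.mul hf

theorem IsTrigPoly.sum {N : ℕ} {ι : Type*} (s : Finset ι) {f : ι → ℝ → ℂ}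
    (hf : ∀ i ∈ s, IsTrigPoly N (f i)) : IsTrigPoly N fun θ => ∑ i ∈ s, f i θ := by
  classical
  induction s using Finset.induction_on with
  | empty => simpa using (isTrigPoly_const 0).mono (Nat.zero_le N)
  | insert a s ha ih =>
    simp only [Finset.sum_insert ha]
    exact (hf a (by simp)).add (ih fun i hi => hf i (by simp [hi]))

theorem isTrigPoly_exp (k : ℕ) (c : ℝ) :
    IsTrigPoly k fun θ => Complex.exp ((θ - c : ℝ) * Complex.I) ^ k := by
  refine ⟨Polynomial.C (Complex.exp (-c * Complex.I) ^ k) * Polynomial.X ^ (2 * k), ?_, fun θ => ?_⟩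
  · exact Polynomial.natDegree_C_mul_X_pow_le _ _
  · have : Complex.exp ((θ - c : ℝ) * Complex.I)
        = Complex.exp (-c * Complex.I) * Complex.exp (θ * Complex.I) := by
      rw [← Complex.exp_add]; push_cast; ring_nf
    simp only [this, Polynomial.eval_mul, Polynomial.eval_C, Polynomial.eval_pow, Polynomial.eval_X]
    ring

theorem isTrigPoly_cos : IsTrigPoly 1 fun θ => ((Real.cos θ : ℝ) : ℂ) := by
  refine ⟨Polynomial.C (1 / 2) * Polynomial.X ^ 2 + Polynomial.C (1 / 2), ?_, fun θ => ?_⟩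
  · compute_degree
  · have h : Complex.exp (-θ * Complex.I) * Complex.exp (θ * Complex.I) = 1 := by
      rw [← Complex.exp_add]; simp
    simp only [Complex.ofReal_cos, Complex.cos, Polynomial.eval_add, Polynomial.eval_mul,
      Polynomial.eval_C, Polynomial.eval_pow, Polynomial.eval_X]
    linear_combination (1 / 2) * h

theorem isTrigPoly_sin : IsTrigPoly 1 fun θ => ((Real.sin θ : ℝ) : ℂ) := by
  refine ⟨Polynomial.C (-Complex.I / 2) * Polynomial.X ^ 2 + Polynomial.C (Complex.I / 2), ?_,
    fun θ => ?_⟩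
  · compute_degree
  · have h : Complex.exp (-θ * Complex.I) * Complex.exp (θ * Complex.I) = 1 := by
      rw [← Complex.exp_add]; simp
    simp only [Complex.ofReal_sin, Complex.sin, Polynomial.eval_add, Polynomial.eval_mul,
      Polynomial.eval_C, Polynomial.eval_pow, Polynomial.eval_X]
    linear_combination (Complex.I / 2) * h

/-- Parseval's identity on the period interval `[-π/2, 3π/2]`. -/
theorem integral_norm_sq_eval_exp (q : Polynomial ℂ) :
    ∫ θ in (-(Real.pi / 2))..(3 * Real.pi / 2), ‖q.eval (Complex.exp (θ * Complex.I))‖ ^ 2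
      = 2 * Real.pi * ∑ i ∈ q.support, ‖q.coeff i‖ ^ 2 := by
  have hper : Function.Periodic
      (fun θ : ℝ => ‖q.eval (Complex.exp (θ * Complex.I))‖ ^ 2) (2 * Real.pi) := by
    intro θ
    have : Complex.exp ((θ + 2 * Real.pi : ℝ) * Complex.I) = Complex.exp (θ * Complex.I) := by
      push_cast
      rw [add_mul, Complex.exp_add, Complex.exp_two_pi_mul_I, mul_one]
    simp only [this]
  have h := hper.intervalIntegral_add_eq (-(Real.pi / 2)) 0
  rw [show -(Real.pi / 2) + 2 * Real.pi = 3 * Real.pi / 2 by ring, zero_add] at h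
  rw [h, Polynomial.sum_sq_norm_coeff_eq_circleAverage, Real.circleAverage_def]
  simp only [circleMap, zero_add, Complex.ofReal_one, one_mul, smul_eq_mul]
  rw [mul_inv_cancel_left₀ (by positivity)]

/-- A Nikolskii inequality for trigonometric polynomials. -/
theorem IsTrigPoly.norm_sq_le {N : ℕ} {f : ℝ → ℂ} (hf : IsTrigPoly N f) (θ₀ : ℝ) :
    2 * Real.pi * ‖f θ₀‖ ^ 2
      ≤ (2 * N + 1) * ∫ θ in (-(Real.pi / 2))..(3 * Real.pi / 2), ‖f θ‖ ^ 2 := by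
  obtain ⟨q, hq, hfq⟩ := hf
  have hn : ∀ θ : ℝ, ‖f θ‖ = ‖q.eval (Complex.exp (θ * Complex.I))‖ := by
    intro θ
    rw [← hfq, norm_mul, norm_pow, Complex.norm_exp_ofReal_mul_I, one_pow, mul_one]
  simp only [hn]
  rw [integral_norm_sq_eval_exp]
  -- Cauchy–Schwarz over the at most `2N + 1` coefficients, against Parseval.
  have h1 : ‖q.eval (Complex.exp (θ₀ * Complex.I))‖ ≤ ∑ i ∈ q.support, ‖q.coeff i‖ := by
    rw [Polynomial.eval_eq_sum, Polynomial.sum]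
    refine (norm_sum_le _ _).trans (Finset.sum_le_sum fun i _ => ?_)
    rw [norm_mul, norm_pow, Complex.norm_exp_ofReal_mul_I, one_pow, mul_one]
  have h2 : (∑ i ∈ q.support, ‖q.coeff i‖) ^ 2
      ≤ q.support.card * ∑ i ∈ q.support, ‖q.coeff i‖ ^ 2 := sq_sum_le_card_mul_sum_sq
  have h3 : (q.support.card : ℝ) ≤ 2 * N + 1 := by
    have := Polynomial.card_supp_le_succ_natDegree q
    exact_mod_cast this.trans (by omega)
  have h4 : ‖q.eval (Complex.exp (θ₀ * Complex.I))‖ ^ 2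
      ≤ (2 * N + 1) * ∑ i ∈ q.support, ‖q.coeff i‖ ^ 2 :=
    (pow_le_pow_left₀ (norm_nonneg _) h1 2).trans <| h2.trans <|
      mul_le_mul_of_nonneg_right h3 (Finset.sum_nonneg fun i _ => sq_nonneg _)
  nlinarith [Real.pi_pos]

/-! ### The Dirichlet kernel as a localiser. -/

/-- The one-sided Dirichlet kernel, normalised to be `1` at the origin. -/
noncomputable def dirichlet (m : ℕ) (t : ℝ) : ℂ :=
  ((m : ℂ) + 1)⁻¹ * ∑ k ∈ Finset.range (m + 1), Complex.exp (t * Complex.I) ^ k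

theorem dirichlet_zero (m : ℕ) : dirichlet m 0 = 1 := by
  have : (m : ℂ) + 1 ≠ 0 := by exact_mod_cast Nat.succ_ne_zero m
  simp [dirichlet, this]

theorem isTrigPoly_dirichlet (m : ℕ) (c : ℝ) : IsTrigPoly m fun θ => dirichlet m (θ - c) := by
  have h := (isTrigPoly_const ((m : ℂ) + 1)⁻¹).mul
    (IsTrigPoly.sum (N := m) (Finset.range (m + 1)) fun k hk =>
      (isTrigPoly_exp k c).mono (Nat.lt_succ_iff.1 (Finset.mem_range.1 hk)))
  rw [zero_add] at h
  exact h

theorem norm_natCast_add_one_inv (m : ℕ) : ‖((m : ℂ) + 1)⁻¹‖ = ((m : ℝ) + 1)⁻¹ := by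
  rw [norm_inv, ← Nat.cast_succ, Complex.norm_natCast, Nat.cast_succ]

theorem norm_dirichlet_le_one (m : ℕ) (t : ℝ) : ‖dirichlet m t‖ ≤ 1 := by
  have h : ‖∑ k ∈ Finset.range (m + 1), Complex.exp (t * Complex.I) ^ k‖ ≤ m + 1 := by
    refine (norm_sum_le _ _).trans ?_
    simp [Complex.norm_exp_ofReal_mul_I]
  rw [dirichlet, norm_mul, norm_natCast_add_one_inv, inv_mul_le_iff₀ (by positivity)]
  simpa using h

/-- Summing the geometric series gives decay in the chordal distance to the peak. -/
theorem norm_dirichlet_mul_le (m : ℕ) (t : ℝ) :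
    ‖dirichlet m t‖ * ‖Complex.exp (t * Complex.I) - 1‖ ≤ 2 / (m + 1) := by
  rw [dirichlet, norm_mul, mul_assoc, ← norm_mul, geom_sum_mul, norm_natCast_add_one_inv,
    inv_mul_eq_div]
  gcongr
  refine (norm_sub_le _ _).trans ?_
  rw [norm_pow, Complex.norm_exp_ofReal_mul_I, one_pow, norm_one]
  norm_num

theorem integral_norm_dirichlet_sq (m : ℕ) (c : ℝ) :
    ∫ θ in (-(Real.pi / 2))..(3 * Real.pi / 2), ‖dirichlet m (θ - c)‖ ^ 2
      = 2 * Real.pi / (m + 1) := by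
  set w : ℂ := Complex.exp (-c * Complex.I) with hw
  have hwn : ‖w‖ = 1 := by
    rw [hw, ← Complex.ofReal_neg, Complex.norm_exp_ofReal_mul_I]
  set q : Polynomial ℂ := ∑ k ∈ Finset.range (m + 1),
    Polynomial.monomial k (((m : ℂ) + 1)⁻¹ * w ^ k) with hq
  have hcoeff : ∀ i, q.coeff i = if i < m + 1 then ((m : ℂ) + 1)⁻¹ * w ^ i else 0 := by
    intro i
    simp [hq, Polynomial.finsetSum_coeff, Polynomial.coeff_monomial]
  have hev : ∀ θ : ℝ, dirichlet m (θ - c) = q.eval (Complex.exp (θ * Complex.I)) := by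
    intro θ
    have : Complex.exp ((θ - c : ℝ) * Complex.I) = w * Complex.exp (θ * Complex.I) := by
      rw [hw, ← Complex.exp_add]; push_cast; ring_nf
    rw [dirichlet, this, hq, Polynomial.eval_finsetSum, Finset.mul_sum]
    refine Finset.sum_congr rfl fun k _ => ?_
    rw [Polynomial.eval_monomial]; ring
  simp only [hev]
  rw [integral_norm_sq_eval_exp, Finset.sum_subset (s₂ := Finset.range (m + 1))]
  · rw [Finset.sum_congr rfl (g := fun _ => (((m : ℝ) + 1)⁻¹) ^ 2)]
    · simp; field_simp
    · intro i hi
      rw [hcoeff, if_pos (Finset.mem_range.1 hi), norm_mul, norm_pow, hwn,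
        norm_natCast_add_one_inv, one_pow, mul_one]
  · intro i hi
    by_contra h
    rw [Polynomial.mem_support_iff, hcoeff, if_neg (by simpa using h)] at hi
    exact hi rfl
  · intro i _ hi
    simp [Polynomial.notMem_support_iff.1 hi]

theorem continuous_dirichlet (m : ℕ) : Continuous (dirichlet m) := by
  unfold dirichlet
  fun_prop

theorem norm_exp_sub_exp (s t : ℝ) :
    ‖Complex.exp (s * Complex.I) - Complex.exp (t * Complex.I)‖
      = ‖Complex.exp ((s - t : ℝ) * Complex.I) - 1‖ := by
  have : Complex.exp (s * Complex.I) - Complex.exp (t * Complex.I)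
      = Complex.exp (t * Complex.I) * (Complex.exp ((s - t : ℝ) * Complex.I) - 1) := by
    rw [mul_sub, ← Complex.exp_add]; push_cast; ring_nf
  rw [this, norm_mul, Complex.norm_exp_ofReal_mul_I, one_mul]

theorem abs_cos_sub_cos_le_norm (s t : ℝ) :
    |Real.cos s - Real.cos t| ≤ ‖Complex.exp ((s - t : ℝ) * Complex.I) - 1‖ := by
  rw [← norm_exp_sub_exp]
  simpa [Complex.exp_ofReal_mul_I_re] using
    Complex.abs_re_le_norm (Complex.exp (s * Complex.I) - Complex.exp (t * Complex.I))

/-- Under the squared kernel the weight at `s` may be replaced by its value at the peak `t`, up to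
`O(1/m)`: the variation of the cosine is at most the chord, and one of the two kernel factors
absorbs the chord. -/
theorem norm_dirichlet_sq_mul_abs_cos_le (m : ℕ) (s t : ℝ) :
    ‖dirichlet m (s - t)‖ ^ 2 * |Real.cos s| ≤ |Real.cos t| + 2 / (m + 1) := by
  have h1 := norm_dirichlet_le_one m (s - t)
  have h2 := norm_dirichlet_mul_le m (s - t)
  have h3 := abs_cos_sub_cos_le_norm s t
  have h4 : |Real.cos s| ≤ |Real.cos t| + |Real.cos s - Real.cos t| := by
    linarith [abs_sub_abs_le_abs_sub (Real.cos s) (Real.cos t)]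
  have h0 := norm_nonneg (dirichlet m (s - t))
  have hsq : ‖dirichlet m (s - t)‖ ^ 2 ≤ 1 := pow_le_one₀ h0 h1
  calc ‖dirichlet m (s - t)‖ ^ 2 * |Real.cos s|
      ≤ ‖dirichlet m (s - t)‖ ^ 2
        * (|Real.cos t| + ‖Complex.exp ((s - t : ℝ) * Complex.I) - 1‖) := by gcongr; linarith
    _ = ‖dirichlet m (s - t)‖ ^ 2 * |Real.cos t| + ‖dirichlet m (s - t)‖
        * (‖dirichlet m (s - t)‖ * ‖Complex.exp ((s - t : ℝ) * Complex.I) - 1‖) := by ring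
    _ ≤ 1 * |Real.cos t| + 1 * (2 / (m + 1)) := by gcongr
    _ = _ := by ring

theorem norm_dirichlet_sq_mul_abs_sin_le (m : ℕ) (s t : ℝ) :
    ‖dirichlet m (s - t)‖ ^ 2 * |Real.sin s| ≤ |Real.sin t| + 2 / (m + 1) := by
  have h := norm_dirichlet_sq_mul_abs_cos_le m (s - Real.pi / 2) (t - Real.pi / 2)
  rwa [Real.cos_sub_pi_div_two, Real.cos_sub_pi_div_two, sub_sub_sub_cancel_right] at h

/-! ### Pointwise bounds for polynomials from an inscribed ellipse. -/

theorem IsTrigPoly.pval {n : ℕ} {f : MvPolynomial (Fin 2) ℝ} (hf : f ∈ Poly 2 n)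
    {g : ℝ → EuclideanSpace ℝ (Fin 2)} (hg : ∀ j, IsTrigPoly 1 fun θ => ((g θ j : ℝ) : ℂ)) :
    IsTrigPoly n fun θ => ((Christoffel.pval f (g θ) : ℝ) : ℂ) := by
  rw [MvPolynomial.mem_restrictTotalDegree] at hf
  have h : ∀ θ, ((Christoffel.pval f (g θ) : ℝ) : ℂ) = ∑ d ∈ f.support,
      ((f.coeff d : ℝ) : ℂ) * (((g θ 0 : ℝ) : ℂ) ^ d 0 * ((g θ 1 : ℝ) : ℂ) ^ d 1) := by
    intro θ
    rw [Christoffel.pval, MvPolynomial.eval_eq']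
    push_cast
    simp [Fin.prod_univ_two]
  simp only [h]
  refine IsTrigPoly.sum _ fun d hd => ?_
  refine ((isTrigPoly_const _).mul (((hg 0).pow (d 0)).mul ((hg 1).pow (d 1)))).mono ?_
  have := (MvPolynomial.le_totalDegree hd).trans hf
  rw [Finsupp.sum_fintype _ _ (by simp), Fin.sum_univ_two] at this
  omega

theorem measurePreserving_toLp_plane :
    MeasurePreserving (fun w : ℝ × ℝ => (!₂[w.1, w.2] : EuclideanSpace ℝ (Fin 2))) :=
  (EuclideanSpace.volume_preserving_symm_measurableEquiv_toLp (Fin 2)).symm.comp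
    (volume_preserving_finTwoArrow ℝ).symm

theorem measurableEmbedding_toLp_plane :
    MeasurableEmbedding (fun w : ℝ × ℝ => (!₂[w.1, w.2] : EuclideanSpace ℝ (Fin 2))) :=
  (MeasurableEquiv.toLp 2 (Fin 2 → ℝ)).measurableEmbedding.comp
    (MeasurableEquiv.finTwoArrow (α := ℝ)).symm.measurableEmbedding

theorem setIntegral_plane (D : Set (EuclideanSpace ℝ (Fin 2)))
    (F : EuclideanSpace ℝ (Fin 2) → ℝ) :
    ∫ z in D, F z = ∫ w in (fun w : ℝ × ℝ => (!₂[w.1, w.2] : EuclideanSpace ℝ (Fin 2))) ⁻¹' D,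
      F !₂[w.1, w.2] :=
  (measurePreserving_toLp_plane.setIntegral_preimage_emb measurableEmbedding_toLp_plane F D).symm

theorem integrableOn_plane {D : Set (EuclideanSpace ℝ (Fin 2))}
    {F : EuclideanSpace ℝ (Fin 2) → ℝ} (hF : IntegrableOn F D) :
    IntegrableOn (fun w : ℝ × ℝ => F !₂[w.1, w.2])
      ((fun w : ℝ × ℝ => (!₂[w.1, w.2] : EuclideanSpace ℝ (Fin 2))) ⁻¹' D) :=
  (measurePreserving_toLp_plane.integrableOn_comp_preimage measurableEmbedding_toLp_plane).2 hF

/-- The reflection `θ ↦ π - θ` fixes the sine and negates the cosine, so a full period folds onto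
the half where the cosine is nonnegative. -/
theorem integral_period_eq {H : ℝ → ℝ} (hH : Continuous H) :
    ∫ θ in (-(Real.pi / 2))..(3 * Real.pi / 2), H θ
      = ∫ θ in (-(Real.pi / 2))..(Real.pi / 2), (H θ + H (Real.pi - θ)) := by
  rw [← intervalIntegral.integral_add_adjacent_intervals (b := Real.pi / 2)
    (hH.intervalIntegrable _ _) (hH.intervalIntegrable _ _),
    intervalIntegral.integral_add (hH.intervalIntegrable _ _)
      ((by fun_prop : Continuous fun θ => H (Real.pi - θ)).intervalIntegrable _ _),
    intervalIntegral.integral_comp_sub_left]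
  congr 2 <;> ring

/-- The derivative at `(ψ, φ)` of the parametrisation `q + sin φ a + cos φ sin ψ b` of an
ellipse. -/
noncomputable def ellipseDeriv (a b : EuclideanSpace ℝ (Fin 2)) (w : ℝ × ℝ) :
    ℝ × ℝ →L[ℝ] ℝ × ℝ :=
  (Matrix.toLin (.finTwoProd ℝ) (.finTwoProd ℝ)
    !![Real.cos w.2 * Real.cos w.1 * b 0,
        Real.cos w.2 * a 0 - Real.sin w.2 * Real.sin w.1 * b 0;
      Real.cos w.2 * Real.cos w.1 * b 1,
        Real.cos w.2 * a 1 - Real.sin w.2 * Real.sin w.1 * b 1]).toContinuousLinearMap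

/-- The Jacobian splits as a weight `cos ψ` times `cos² φ`, which are the weights that the two
one-dimensional inequalities require. -/
theorem det_ellipseDeriv (a b : EuclideanSpace ℝ (Fin 2)) (w : ℝ × ℝ) :
    (ellipseDeriv a b w).det
      = -((a 0 * b 1 - a 1 * b 0) * (Real.cos w.1 * Real.cos w.2 ^ 2)) := by
  unfold ellipseDeriv
  simp only [LinearMap.det_toContinuousLinearMap, LinearMap.det_toLin, Matrix.det_fin_two_of]
  ring

theorem hasFDerivAt_ellipse (q a b : EuclideanSpace ℝ (Fin 2)) (w : ℝ × ℝ) :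
    HasFDerivAt (fun w : ℝ × ℝ =>
      (q 0 + Real.sin w.2 * a 0 + Real.cos w.2 * Real.sin w.1 * b 0,
        q 1 + Real.sin w.2 * a 1 + Real.cos w.2 * Real.sin w.1 * b 1))
      (ellipseDeriv a b w) w := by
  have hs : ∀ i, HasFDerivAt (fun w : ℝ × ℝ =>
      q i + Real.sin w.2 * a i + Real.cos w.2 * Real.sin w.1 * b i)
      ((Real.cos w.2 * Real.cos w.1 * b i) • ContinuousLinearMap.fst ℝ ℝ ℝ
        + (Real.cos w.2 * a i - Real.sin w.2 * Real.sin w.1 * b i)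
          • ContinuousLinearMap.snd ℝ ℝ ℝ) w := by
    intro i
    have h1 := (Real.hasDerivAt_sin w.1).comp_hasFDerivAt w
      (hasFDerivAt_fst (𝕜 := ℝ) (E := ℝ) (F := ℝ) (p := w))
    have h2 := (Real.hasDerivAt_sin w.2).comp_hasFDerivAt w
      (hasFDerivAt_snd (𝕜 := ℝ) (E := ℝ) (F := ℝ) (p := w))
    have h3 := (Real.hasDerivAt_cos w.2).comp_hasFDerivAt w
      (hasFDerivAt_snd (𝕜 := ℝ) (E := ℝ) (F := ℝ) (p := w))
    refine (((h2.mul_const (a i)).const_add (q i)).add ((h3.mul h1).mul_const (b i))).congr_fderiv ?_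
    ext <;> simp <;> ring
  unfold ellipseDeriv
  rw [Matrix.toLin_finTwoProd_toContinuousLinearMap]
  exact (hs 0).prodMk (hs 1)

theorem injOn_ellipse (q a b : EuclideanSpace ℝ (Fin 2)) (hdet : a 0 * b 1 - a 1 * b 0 ≠ 0) :
    Set.InjOn (fun w : ℝ × ℝ =>
      (q 0 + Real.sin w.2 * a 0 + Real.cos w.2 * Real.sin w.1 * b 0,
        q 1 + Real.sin w.2 * a 1 + Real.cos w.2 * Real.sin w.1 * b 1))
      (Set.Ioo (-(Real.pi / 2)) (Real.pi / 2) ×ˢ Set.Ioo (-(Real.pi / 2)) (Real.pi / 2)) := by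
  rintro ⟨s, t⟩ ⟨hs, ht⟩ ⟨s', t'⟩ ⟨hs', ht'⟩ h
  simp only [Prod.mk.injEq] at h hs ht hs' ht'
  obtain ⟨h0, h1⟩ := h
  have e1 : Real.sin t = Real.sin t' := by
    have : (Real.sin t - Real.sin t') * (a 0 * b 1 - a 1 * b 0) = 0 := by
      linear_combination b 1 * h0 - b 0 * h1
    rcases mul_eq_zero.1 this with h | h
    · linarith
    · exact absurd h hdet
  have e2 : Real.cos t * Real.sin s = Real.cos t' * Real.sin s' := by
    have : (Real.cos t * Real.sin s - Real.cos t' * Real.sin s')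
        * (a 0 * b 1 - a 1 * b 0) = 0 := by
      linear_combination a 0 * h1 - a 1 * h0
    rcases mul_eq_zero.1 this with h | h
    · linarith
    · exact absurd h hdet
  have et : t = t' := Real.injOn_sin ⟨ht.1.le, ht.2.le⟩ ⟨ht'.1.le, ht'.2.le⟩ e1
  subst et
  have e3 : Real.sin s = Real.sin s' :=
    mul_left_cancel₀ (Real.cos_pos_of_mem_Ioo ht).ne' e2
  rw [Real.injOn_sin ⟨hs.1.le, hs.2.le⟩ ⟨hs'.1.le, hs'.2.le⟩ e3]

/-- Integration in the coordinates `q + sin φ a + cos φ sin ψ b` of an ellipse inside `D`. -/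
theorem integral_ellipse_le {D : Set (EuclideanSpace ℝ (Fin 2))} (hD : IsCompact D)
    {F : EuclideanSpace ℝ (Fin 2) → ℝ} (hF : Continuous F) (hF0 : ∀ z, 0 ≤ F z)
    {q a b : EuclideanSpace ℝ (Fin 2)}
    (hE : ∀ r s : ℝ, r ^ 2 + s ^ 2 ≤ 1 → q + r • a + s • b ∈ D) :
    |a 0 * b 1 - a 1 * b 0| * ∫ ψ in (-(Real.pi / 2))..(Real.pi / 2), Real.cos ψ *
      ∫ φ in (-(Real.pi / 2))..(Real.pi / 2), Real.cos φ ^ 2 *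
        F (q + Real.sin φ • a + (Real.cos φ * Real.sin ψ) • b) ≤ ∫ z in D, F z := by
  have hπ : -(Real.pi / 2) ≤ Real.pi / 2 := by linarith [Real.pi_pos]
  rcases eq_or_ne (a 0 * b 1 - a 1 * b 0) 0 with hdet | hdet
  · rw [hdet, abs_zero, zero_mul]
    exact integral_nonneg hF0
  set I : Set ℝ := Set.Ioo (-(Real.pi / 2)) (Real.pi / 2) with hI
  set Φ : ℝ × ℝ → ℝ × ℝ := fun w : ℝ × ℝ =>
      (q 0 + Real.sin w.2 * a 0 + Real.cos w.2 * Real.sin w.1 * b 0,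
        q 1 + Real.sin w.2 * a 1 + Real.cos w.2 * Real.sin w.1 * b 1) with hΦ
  have hpt : ∀ w : ℝ × ℝ, (!₂[(Φ w).1, (Φ w).2] : EuclideanSpace ℝ (Fin 2))
      = q + Real.sin w.2 • a + (Real.cos w.2 * Real.sin w.1) • b := by
    intro w
    ext i
    fin_cases i <;> simp [hΦ]
  have hmeas : MeasurableSet (I ×ˢ I) := measurableSet_Ioo.prod measurableSet_Ioo
  have hcv := integral_image_eq_integral_abs_det_fderiv_smul volume hmeas
    (fun w _ => (hasFDerivAt_ellipse q a b w).hasFDerivWithinAt) (injOn_ellipse q a b hdet)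
    (fun w : ℝ × ℝ => F !₂[w.1, w.2])
  have hsub : Φ '' (I ×ˢ I)
      ⊆ (fun w : ℝ × ℝ => (!₂[w.1, w.2] : EuclideanSpace ℝ (Fin 2))) ⁻¹' D := by
    rintro _ ⟨w, -, rfl⟩
    rw [Set.mem_preimage, hpt]
    refine hE _ _ ?_
    nlinarith [Real.sin_sq_add_cos_sq w.1, Real.sin_sq_add_cos_sq w.2, sq_nonneg (Real.cos w.1),
      mul_nonneg (sq_nonneg (Real.cos w.2)) (sq_nonneg (Real.cos w.1))]
  have hle : ∫ w in Φ '' (I ×ˢ I), F !₂[w.1, w.2] ≤ ∫ z in D, F z := by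
    rw [setIntegral_plane D F]
    refine setIntegral_mono_set (integrableOn_plane (hF.continuousOn.integrableOn_compact hD))
      (Filter.Eventually.of_forall fun w => hF0 _) (Filter.Eventually.of_forall hsub)
  refine le_trans (le_of_eq ?_) hle
  rw [hcv]
  set c : ℝ := |a 0 * b 1 - a 1 * b 0| with hc
  have hcont : Continuous fun w : ℝ × ℝ => c * (Real.cos w.1 * (Real.cos w.2 ^ 2 *
      F (q + Real.sin w.2 • a + (Real.cos w.2 * Real.sin w.1) • b))) := by fun_prop
  have hcongr : ∫ w in I ×ˢ I, |(ellipseDeriv a b w).det| • F !₂[(Φ w).1, (Φ w).2]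
      = ∫ w in I ×ˢ I, c * (Real.cos w.1 * (Real.cos w.2 ^ 2 *
      F (q + Real.sin w.2 • a + (Real.cos w.2 * Real.sin w.1) • b))) := by
    refine setIntegral_congr_fun hmeas fun w hw => ?_
    have h1 : 0 ≤ Real.cos w.1 := (Real.cos_pos_of_mem_Ioo hw.1).le
    simp only [hpt, det_ellipseDeriv, abs_neg, abs_mul, smul_eq_mul, ← hc, abs_of_nonneg h1,
      abs_of_nonneg (sq_nonneg (Real.cos w.2))]
    ring
  rw [hcongr, Measure.volume_eq_prod, setIntegral_prod]
  · rw [intervalIntegral.integral_of_le hπ, integral_Ioc_eq_integral_Ioo, ← integral_const_mul]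
    refine integral_congr_ae (Filter.Eventually.of_forall fun ψ => ?_)
    simp only
    rw [intervalIntegral.integral_of_le hπ, integral_Ioc_eq_integral_Ioo, integral_const_mul,
      integral_const_mul]
  · refine (hcont.continuousOn.integrableOn_compact (isCompact_Icc.prod isCompact_Icc)).mono_set
      (Set.prod_mono Set.Ioo_subset_Icc_self Set.Ioo_subset_Icc_self)

theorem isTrigPoly_pval_arc {n : ℕ} {f : MvPolynomial (Fin 2) ℝ} (hf : f ∈ Poly 2 n)
    (q a b : EuclideanSpace ℝ (Fin 2)) :
    IsTrigPoly n fun θ => ((pval f (q + Real.sin θ • a + Real.cos θ • b) : ℝ) : ℂ) := by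
  refine IsTrigPoly.pval hf fun j => ?_
  have h := (((isTrigPoly_const (q j)).mono zero_le_one).add
    (isTrigPoly_sin.mul (isTrigPoly_const (a j)))).add
    (isTrigPoly_cos.mul (isTrigPoly_const (b j)))
  simpa using h

/-- Pointwise bound for polynomials at a point of an ellipse contained in `D`. -/
theorem pval_sq_mul_le_of_ellipse {n : ℕ} {D : Set (EuclideanSpace ℝ (Fin 2))}
    (hD : IsCompact D) {f : MvPolynomial (Fin 2) ℝ} (hf : f ∈ Poly 2 n)
    {q a b : EuclideanSpace ℝ (Fin 2)}
    (hE : ∀ r s : ℝ, r ^ 2 + s ^ 2 ≤ 1 → q + r • a + s • b ∈ D) (t : ℝ) :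
    Real.cos t ^ 2 * pval f (q + Real.sin t • b) ^ 2 * |a 0 * b 1 - a 1 * b 0|
      ≤ (4 * n + 3) ^ 2 * (|Real.cos t| + 2 / (n + 1)) * polyInner D f f := by
  have hπ := Real.pi_pos
  have hπ2 : -(Real.pi / 2) ≤ Real.pi / 2 := by linarith
  have hfc := continuous_pval f
  set F : ℝ → ℝ → ℝ := fun r s => pval f (q + r • a + s • b) ^ 2 with hF
  set G : ℝ → ℝ := fun s => ∫ φ in (-(Real.pi / 2))..(Real.pi / 2),
    Real.cos φ ^ 2 * F (Real.sin φ) (Real.cos φ * s) with hG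
  have hGc : Continuous G := by
    have h : Continuous fun w : ℝ × ℝ =>
        Real.cos w.2 ^ 2 * F (Real.sin w.2) (Real.cos w.2 * w.1) := by
      simp only [hF]; fun_prop
    exact intervalIntegral.continuous_parametric_intervalIntegral_of_continuous'
      (f := fun s φ => Real.cos φ ^ 2 * F (Real.sin φ) (Real.cos φ * s)) h _ _
  have hF0 : ∀ r s, 0 ≤ F r s := fun r s => sq_nonneg _
  -- Nikolskii at `φ = 0` along the ellipse `q + sin φ a + s cos φ b`. The extra factor `cos φ` is
  -- `1` there and its square supplies the Jacobian weight. Folding the period pairs the halves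
  -- belonging to `s` and `-s`; the constant `2(n+1)+1` is relaxed to `4n+3`.
  have hsec : ∀ s, 2 * Real.pi * F 0 s ≤ (4 * n + 3) * (G s + G (-s)) := by
    intro s
    have htrig : IsTrigPoly (n + 1) fun φ => ((pval f (q + Real.sin φ • a
        + (Real.cos φ * s) • b) : ℝ) : ℂ) * ((Real.cos φ : ℝ) : ℂ) := by
      have h := (isTrigPoly_pval_arc hf q a (s • b)).mul isTrigPoly_cos
      simpa only [smul_smul] using h
    have h := htrig.norm_sq_le 0
    have hrw : ∀ φ, ‖((pval f (q + Real.sin φ • a + (Real.cos φ * s) • b) : ℝ) : ℂ)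
        * ((Real.cos φ : ℝ) : ℂ)‖ ^ 2
        = Real.cos φ ^ 2 * F (Real.sin φ) (Real.cos φ * s) := by
      intro φ
      rw [norm_mul, Complex.norm_real, Complex.norm_real, mul_pow, Real.norm_eq_abs,
        Real.norm_eq_abs, sq_abs, sq_abs, mul_comm]
    simp only [hrw] at h
    have hc : ∀ u : ℝ, Continuous fun φ => Real.cos φ ^ 2 * F (Real.sin φ) (Real.cos φ * u) :=
      fun u => by simp only [hF]; fun_prop
    rw [integral_period_eq (hc s)] at h
    simp only [Real.cos_pi_sub, Real.sin_pi_sub, neg_sq, Real.cos_zero, Real.sin_zero, one_pow,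
      one_mul, neg_mul] at h
    rw [intervalIntegral.integral_add ((hc s).intervalIntegrable _ _)] at h
    · have e : (∫ φ in (-(Real.pi / 2))..(Real.pi / 2),
          Real.cos φ ^ 2 * F (Real.sin φ) (-(Real.cos φ * s))) = G (-s) := by
        simp only [hG, mul_neg]
      rw [e] at h
      refine h.trans ?_
      have hG0 : ∀ u, 0 ≤ G u := fun u => intervalIntegral.integral_nonneg hπ2
        fun φ _ => mul_nonneg (sq_nonneg _) (hF0 _ _)
      refine mul_le_mul_of_nonneg_right ?_ (add_nonneg (hG0 s) (hG0 (-s)))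
      push_cast
      linarith [(Nat.cast_nonneg n : (0 : ℝ) ≤ n)]
    · have := (hc (-s)).intervalIntegrable (μ := volume) (-(Real.pi / 2)) (Real.pi / 2)
      simpa only [mul_neg] using this
  -- Second use of Nikolskii, at `ψ = t` along the axis `b`. Without the kernel the right side would
  -- carry `cos² ψ`; with it, one factor `|cos ψ|` becomes `|cos t| + 2/(n+1)` and the other is the
  -- Jacobian weight.
  have htrig : IsTrigPoly (n + 1 + n) fun ψ => ((pval f (q + Real.sin ψ • b) : ℝ) : ℂ)
      * ((Real.cos ψ : ℝ) : ℂ) * dirichlet n (ψ - t) := by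
    have h := ((isTrigPoly_pval_arc hf q b 0).mul isTrigPoly_cos).mul (isTrigPoly_dirichlet n t)
    simpa only [smul_zero, add_zero, Nat.add_right_comm n 1 n] using h
  have h := htrig.norm_sq_le t
  have hF1 : ∀ s, pval f (q + s • b) ^ 2 = F 0 s := by intro s; simp [hF]
  have hrw : ∀ ψ, ‖((pval f (q + Real.sin ψ • b) : ℝ) : ℂ) * ((Real.cos ψ : ℝ) : ℂ)
      * dirichlet n (ψ - t)‖ ^ 2
      = F 0 (Real.sin ψ) * Real.cos ψ ^ 2 * ‖dirichlet n (ψ - t)‖ ^ 2 := by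
    intro ψ
    rw [norm_mul, norm_mul, Complex.norm_real, Complex.norm_real, mul_pow, mul_pow,
      Real.norm_eq_abs, Real.norm_eq_abs, sq_abs, sq_abs, hF1]
  simp only [hrw] at h
  rw [sub_self, dirichlet_zero, norm_one, one_pow, mul_one] at h
  set K : ℝ := |Real.cos t| + 2 / (n + 1) with hK
  have hF0c : Continuous fun ψ => F 0 (Real.sin ψ) := by
    simp only [hF]; fun_prop
  have hdc := continuous_dirichlet n
  have hmaj : ∫ ψ in (-(Real.pi / 2))..(3 * Real.pi / 2),
      F 0 (Real.sin ψ) * Real.cos ψ ^ 2 * ‖dirichlet n (ψ - t)‖ ^ 2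
      ≤ ∫ ψ in (-(Real.pi / 2))..(3 * Real.pi / 2), K * (F 0 (Real.sin ψ) * |Real.cos ψ|) := by
    refine intervalIntegral.integral_mono (by linarith) ?_ ?_ fun ψ => ?_
    · exact Continuous.intervalIntegrable (by fun_prop) _ _
    · exact Continuous.intervalIntegrable (by fun_prop) _ _
    · have h1 := norm_dirichlet_sq_mul_abs_cos_le n ψ t
      have h2 := mul_le_mul_of_nonneg_left h1
        (mul_nonneg (hF0 0 (Real.sin ψ)) (abs_nonneg (Real.cos ψ)))
      calc _ = F 0 (Real.sin ψ) * |Real.cos ψ| * (‖dirichlet n (ψ - t)‖ ^ 2 * |Real.cos ψ|) := by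
            rw [← sq_abs (Real.cos ψ)]; ring
        _ ≤ _ := by rw [← hK] at h2; linarith
  rw [intervalIntegral.integral_const_mul,
    integral_period_eq (H := fun ψ => F 0 (Real.sin ψ) * |Real.cos ψ|) (by fun_prop)] at hmaj
  simp only [Real.sin_pi_sub, Real.cos_pi_sub, abs_neg] at hmaj
  have hcosint : ∫ ψ in (-(Real.pi / 2))..(Real.pi / 2),
      (F 0 (Real.sin ψ) * |Real.cos ψ| + F 0 (Real.sin ψ) * |Real.cos ψ|)
      ≤ ∫ ψ in (-(Real.pi / 2))..(Real.pi / 2), (4 * n + 3) / Real.pi *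
        (Real.cos ψ * G (Real.sin ψ) + Real.cos (-ψ) * G (Real.sin (-ψ))) := by
    refine intervalIntegral.integral_mono_on hπ2 ?_ ?_ fun ψ hψ => ?_
    · exact Continuous.intervalIntegrable (by fun_prop) _ _
    · exact Continuous.intervalIntegrable (by fun_prop) _ _
    · have h1 : 0 ≤ Real.cos ψ := Real.cos_nonneg_of_mem_Icc hψ
      have h2 := mul_le_mul_of_nonneg_left (hsec (Real.sin ψ)) h1
      rw [Real.cos_neg, Real.sin_neg, abs_of_nonneg h1, div_mul_eq_mul_div, le_div_iff₀ hπ]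
      linarith
  have hsymm : ∫ ψ in (-(Real.pi / 2))..(Real.pi / 2), (4 * n + 3) / Real.pi *
        (Real.cos ψ * G (Real.sin ψ) + Real.cos (-ψ) * G (Real.sin (-ψ)))
      = (4 * n + 3) / Real.pi * (2 * ∫ ψ in (-(Real.pi / 2))..(Real.pi / 2),
        Real.cos ψ * G (Real.sin ψ)) := by
    have hc : Continuous fun ψ => Real.cos ψ * G (Real.sin ψ) := by fun_prop
    rw [intervalIntegral.integral_const_mul, intervalIntegral.integral_add
      (hc.intervalIntegrable _ _) ((by fun_prop : Continuous fun ψ =>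
        Real.cos (-ψ) * G (Real.sin (-ψ))).intervalIntegrable _ _),
      intervalIntegral.integral_comp_neg (fun ψ => Real.cos ψ * G (Real.sin ψ)), neg_neg, two_mul]
  have hmain := integral_ellipse_le hD (F := fun z => pval f z * pval f z) (by fun_prop)
    (fun z => mul_self_nonneg _) hE
  have hGeq : ∫ ψ in (-(Real.pi / 2))..(Real.pi / 2), Real.cos ψ *
      ∫ φ in (-(Real.pi / 2))..(Real.pi / 2), Real.cos φ ^ 2 *
        (pval f (q + Real.sin φ • a + (Real.cos φ * Real.sin ψ) • b)
          * pval f (q + Real.sin φ • a + (Real.cos φ * Real.sin ψ) • b))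
      = ∫ ψ in (-(Real.pi / 2))..(Real.pi / 2), Real.cos ψ * G (Real.sin ψ) := by
    simp only [hG, hF, pow_two]
  rw [hGeq] at hmain
  set Y : ℝ := ∫ ψ in (-(Real.pi / 2))..(Real.pi / 2), Real.cos ψ * G (Real.sin ψ)
  set d : ℝ := |a 0 * b 1 - a 1 * b 0| with hd
  have hd0 : 0 ≤ d := abs_nonneg _
  have hK0 : 0 ≤ K := by positivity
  have hn0 : (0 : ℝ) ≤ n := Nat.cast_nonneg n
  rw [hF1]
  have hfin : 2 * Real.pi * (F 0 (Real.sin t) * Real.cos t ^ 2)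
      ≤ (4 * n + 3) * (K * ((4 * n + 3) / Real.pi * (2 * Y))) := by
    have e : F 0 (Real.sin t) * Real.cos t ^ 2 = ‖((pval f (q + Real.sin t • b) : ℝ) : ℂ)
        * ((Real.cos t : ℝ) : ℂ)‖ ^ 2 := by
      rw [norm_mul, Complex.norm_real, Complex.norm_real, mul_pow, Real.norm_eq_abs,
        Real.norm_eq_abs, sq_abs, sq_abs, hF1]
    have e' : (2 * ((n + 1 + n : ℕ) : ℝ) + 1) = 4 * n + 3 := by push_cast; ring
    rw [e'] at h
    refine le_trans (le_trans (le_of_eq ?_) h)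
      (mul_le_mul_of_nonneg_left (hmaj.trans (mul_le_mul_of_nonneg_left
        (hcosint.trans hsymm.le) hK0)) (by positivity))
    ring
  have hdY := mul_le_mul_of_nonneg_left hmain
    (by positivity : 0 ≤ (4 * (n : ℝ) + 3) * (K * ((4 * n + 3) / Real.pi * 2)))
  have h2 := mul_le_mul_of_nonneg_right hfin hd0
  have hP : 0 ≤ polyInner D f f := integral_nonneg fun z => mul_self_nonneg _
  change (4 * (n : ℝ) + 3) * (K * ((4 * n + 3) / Real.pi * 2)) * (d * Y)
    ≤ (4 * (n : ℝ) + 3) * (K * ((4 * n + 3) / Real.pi * 2)) * polyInner D f f at hdY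
  have h3 : 2 * Real.pi * (Real.cos t ^ 2 * F 0 (Real.sin t) * d)
      ≤ (4 * (n : ℝ) + 3) * (K * ((4 * n + 3) / Real.pi * 2)) * polyInner D f f := by
    linarith
  have h4 : (4 * (n : ℝ) + 3) * (K * ((4 * n + 3) / Real.pi * 2)) * polyInner D f f
      = 2 / Real.pi * ((4 * n + 3) ^ 2 * K * polyInner D f f) := by ring
  have h5 : 0 ≤ (4 * (n : ℝ) + 3) ^ 2 * K * polyInner D f f := by positivity
  have h6 : 2 / Real.pi ≤ 2 * Real.pi := by
    rw [div_le_iff₀ hπ]; nlinarith [Real.pi_gt_three]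
  rw [h4] at h3
  exact le_of_mul_le_mul_left (h3.trans (mul_le_mul_of_nonneg_right h6 h5)) (by positivity)

/-! ### Peaking polynomials on `[0, 2]`. -/

theorem norm_dirichlet_sq (m : ℕ) (s : ℝ) :
    ‖dirichlet m s‖ ^ 2 = (((m : ℝ) + 1) ^ 2)⁻¹ * ∑ j ∈ Finset.range (m + 1),
      ∑ k ∈ Finset.range (m + 1), Real.cos (((j : ℤ) - (k : ℤ) : ℤ) * s) := by
  have hre : ∀ k : ℕ, Complex.exp (s * Complex.I) ^ k
      = Complex.exp ((k * s : ℝ) * Complex.I) := by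
    intro k; rw [← Complex.exp_nat_mul]; push_cast; ring_nf
  rw [dirichlet, norm_mul, mul_pow, norm_natCast_add_one_inv, inv_pow, Complex.sq_norm,
    Complex.normSq_apply, Complex.re_sum, Complex.im_sum]
  simp only [hre, Complex.exp_ofReal_mul_I_re, Complex.exp_ofReal_mul_I_im]
  rw [Finset.sum_mul_sum, Finset.sum_mul_sum, ← Finset.sum_add_distrib]
  congr 1
  refine Finset.sum_congr rfl fun j _ => ?_
  rw [← Finset.sum_add_distrib]
  refine Finset.sum_congr rfl fun k _ => ?_
  push_cast
  rw [sub_mul, Real.cos_sub]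

/-- A polynomial whose pull-back under the cosine is a symmetrised Fejér kernel. -/
theorem exists_polynomial_eval_cos (m : ℕ) (θ₀ : ℝ) :
    ∃ R : Polynomial ℝ, R.natDegree ≤ m ∧ ∀ θ : ℝ,
      R.eval (Real.cos θ) = ‖dirichlet m (θ - θ₀)‖ ^ 2 + ‖dirichlet m (θ - -θ₀)‖ ^ 2 := by
  -- Adding the kernels peaked at `θ₀` and `-θ₀` cancels the sine terms; each frequency `j - k`
  -- leaves `2 cos((j-k)θ₀)` times the Chebyshev polynomial of that index.
  refine ⟨∑ j ∈ Finset.range (m + 1), ∑ k ∈ Finset.range (m + 1),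
    Polynomial.C ((((m : ℝ) + 1) ^ 2)⁻¹ * (2 * Real.cos (((j : ℤ) - (k : ℤ) : ℤ) * θ₀)))
      * Polynomial.Chebyshev.T ℝ ((j : ℤ) - (k : ℤ)), ?_, fun θ => ?_⟩
  · refine Polynomial.natDegree_sum_le_of_forall_le _ _ fun j hj =>
      Polynomial.natDegree_sum_le_of_forall_le _ _ fun k hk => ?_
    refine (Polynomial.natDegree_C_mul_le _ _).trans ?_
    rw [Polynomial.Chebyshev.natDegree_T]
    have := Finset.mem_range.1 hj
    have := Finset.mem_range.1 hk
    omega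
  · simp only [Polynomial.eval_finsetSum, Polynomial.eval_mul, Polynomial.eval_C,
      Polynomial.Chebyshev.T_real_cos]
    rw [norm_dirichlet_sq, norm_dirichlet_sq, ← mul_add, ← Finset.sum_add_distrib, Finset.mul_sum]
    refine Finset.sum_congr rfl fun j _ => ?_
    rw [← Finset.sum_add_distrib, Finset.mul_sum]
    refine Finset.sum_congr rfl fun k _ => ?_
    rw [sub_neg_eq_add, mul_sub _ θ θ₀, mul_add _ θ θ₀, Real.cos_sub, Real.cos_add]
    ring

/-- Polynomials on `[0, 2]` with small `L²` norm and large value at a given point. -/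
theorem exists_polynomial_integral_sq_le (m : ℕ) {d : ℝ} (hd : 0 ≤ d) (hd2 : d ≤ 2) :
    ∃ P : Polynomial ℝ, P.natDegree ≤ m ∧ 1 ≤ P.eval d ∧
      ∫ t in (0 : ℝ)..2, P.eval t ^ 2
        ≤ 8 * Real.pi / (m + 1) * (Real.sqrt (2 * d) + 2 / (m + 1)) := by
  have hπ := Real.pi_pos
  -- The substitution `t = 1 - cos θ` puts the peak at `t = d`, where `sin² θ₀ = 2d - d²`.
  set θ₀ := Real.arccos (1 - d)
  have hcos : Real.cos θ₀ = 1 - d := Real.cos_arccos (by linarith) (by linarith)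
  have hsin : |Real.sin θ₀| ≤ Real.sqrt (2 * d) := by
    rw [Real.sin_arccos, abs_of_nonneg (Real.sqrt_nonneg _)]
    exact Real.sqrt_le_sqrt (by nlinarith)
  obtain ⟨R, hR, hRe⟩ := exists_polynomial_eval_cos m θ₀
  refine ⟨R.comp (1 - Polynomial.X), ?_, ?_, ?_⟩
  · refine (Polynomial.natDegree_comp_le).trans ?_
    have : (1 - Polynomial.X : Polynomial ℝ).natDegree ≤ 1 := by
      compute_degree
    nlinarith
  · have h := hRe θ₀
    rw [hcos, sub_self, dirichlet_zero, norm_one] at h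
    simp only [Polynomial.eval_comp, Polynomial.eval_sub, Polynomial.eval_one, Polynomial.eval_X]
    rw [h]
    nlinarith [sq_nonneg ‖dirichlet m (θ₀ - -θ₀)‖]
  · have hdc := continuous_dirichlet m
    have hsub : ∫ t in (0 : ℝ)..2, (R.comp (1 - Polynomial.X)).eval t ^ 2
        = ∫ θ in (0 : ℝ)..Real.pi, R.eval (Real.cos θ) ^ 2 * Real.sin θ := by
      have h := intervalIntegral.integral_comp_mul_deriv (a := 0) (b := Real.pi)
        (f := fun θ => 1 - Real.cos θ) (f' := Real.sin)
        (g := fun t => (R.comp (1 - Polynomial.X)).eval t ^ 2)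
        (fun x _ => by simpa using (Real.hasDerivAt_cos x).const_sub 1)
        Real.continuous_sin.continuousOn (by fun_prop)
      norm_num [Function.comp_def] at h
      simp only [Polynomial.eval_comp, Polynomial.eval_sub, Polynomial.eval_one,
        Polynomial.eval_X]
      rw [← h]
    -- With `A`, `A'` the two squared kernels, `(A + A')² sin θ ≤ 2(A² + A'²) sin θ`; localisation
    -- trades `A sin θ` and `A' sin θ` for the value at the peak.
    set H : ℝ → ℝ := fun θ => 2 * (|Real.sin θ₀| + 2 / (m + 1)) *
      (‖dirichlet m (θ - θ₀)‖ ^ 2 + ‖dirichlet m (θ - -θ₀)‖ ^ 2) with hH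
    have hHc : Continuous H := by fun_prop
    have hH0 : ∀ θ, 0 ≤ H θ := fun θ => by positivity
    have hpt : ∀ θ ∈ Set.Icc 0 Real.pi, R.eval (Real.cos θ) ^ 2 * Real.sin θ ≤ H θ := by
      intro θ hθ
      have hs := Real.sin_nonneg_of_mem_Icc hθ
      have h1 := norm_dirichlet_sq_mul_abs_sin_le m θ θ₀
      have h2 := norm_dirichlet_sq_mul_abs_sin_le m θ (-θ₀)
      rw [Real.sin_neg, abs_neg] at h2
      rw [abs_of_nonneg hs] at h1 h2
      rw [hRe, hH]
      set A := ‖dirichlet m (θ - θ₀)‖ ^ 2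
      set A' := ‖dirichlet m (θ - -θ₀)‖ ^ 2
      have hA : 0 ≤ A := sq_nonneg _
      have hA' : 0 ≤ A' := sq_nonneg _
      nlinarith [mul_le_mul_of_nonneg_left h1 hA, mul_le_mul_of_nonneg_left h2 hA',
        mul_nonneg (sq_nonneg (A - A')) hs]
    have hint : ∫ θ in (0 : ℝ)..Real.pi, R.eval (Real.cos θ) ^ 2 * Real.sin θ
        ≤ ∫ θ in (-(Real.pi / 2))..(3 * Real.pi / 2), H θ := by
      refine (intervalIntegral.integral_mono_on hπ.le
        (Continuous.intervalIntegrable (by fun_prop) _ _)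
        (hHc.intervalIntegrable _ _) hpt).trans ?_
      exact intervalIntegral.integral_mono_interval (by linarith) hπ.le (by linarith)
        (Filter.Eventually.of_forall hH0) (hHc.intervalIntegrable _ _)
    have hHint : ∫ θ in (-(Real.pi / 2))..(3 * Real.pi / 2), H θ
        = 8 * Real.pi / (m + 1) * (|Real.sin θ₀| + 2 / (m + 1)) := by
      simp only [hH]
      rw [intervalIntegral.integral_const_mul, intervalIntegral.integral_add
        (Continuous.intervalIntegrable (by fun_prop) _ _)
        (Continuous.intervalIntegrable (by fun_prop) _ _), integral_norm_dirichlet_sq,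
        integral_norm_dirichlet_sq]
      ring
    rw [hsub]
    refine (hint.trans hHint.le).trans ?_
    gcongr

/-! ### Upper bounds from a circumscribed parallelogram. -/

theorem christoffel_nonneg {d : ℕ} (n : ℕ) (D : Set (EuclideanSpace ℝ (Fin d)))
    (x : EuclideanSpace ℝ (Fin d)) : 0 ≤ christoffel n D x := by
  unfold christoffel
  split_ifs
  · exact inv_nonneg.2 (Finset.sum_nonneg fun k _ => sq_nonneg _)
  · exact le_rfl

theorem totalDegree_aeval_le (P : Polynomial ℝ) (q : MvPolynomial (Fin 2) ℝ)
    (hq : q.totalDegree ≤ 1) : (Polynomial.aeval q P).totalDegree ≤ P.natDegree := by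
  rw [Polynomial.aeval_eq_sum_range]
  refine MvPolynomial.totalDegree_finsetSum_le fun i hi => ?_
  refine (MvPolynomial.totalDegree_smul_le _ _).trans ((MvPolynomial.totalDegree_pow _ _).trans ?_)
  have := Finset.mem_range.1 hi
  nlinarith

/-- Fubini's theorem in the coordinates `1 - ⟨a, z⟩`, `1 - ⟨b, z⟩`. -/
theorem integral_parallelogram_le {D : Set (EuclideanSpace ℝ (Fin 2))} (hD : IsCompact D)
    (a b : EuclideanSpace ℝ (Fin 2))
    (ha : ∀ z ∈ D, |a 0 * z 0 + a 1 * z 1| ≤ 1) (hb : ∀ z ∈ D, |b 0 * z 0 + b 1 * z 1| ≤ 1)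
    {F G : ℝ → ℝ} (hF : Continuous F) (hG : Continuous G) (hF0 : ∀ t, 0 ≤ F t)
    (hG0 : ∀ t, 0 ≤ G t) :
    |a 0 * b 1 - a 1 * b 0| *
      ∫ z in D, F (1 - (a 0 * z 0 + a 1 * z 1)) * G (1 - (b 0 * z 0 + b 1 * z 1))
      ≤ (∫ t in (0 : ℝ)..2, F t) * ∫ t in (0 : ℝ)..2, G t := by
  have hFi : 0 ≤ ∫ t in (0 : ℝ)..2, F t :=
    intervalIntegral.integral_nonneg (by norm_num) fun t _ => hF0 t
  have hGi : 0 ≤ ∫ t in (0 : ℝ)..2, G t :=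
    intervalIntegral.integral_nonneg (by norm_num) fun t _ => hG0 t
  rcases eq_or_ne (a 0 * b 1 - a 1 * b 0) 0 with hdet | hdet
  · rw [hdet, abs_zero, zero_mul]
    exact mul_nonneg hFi hGi
  rw [setIntegral_plane]
  set D' := (fun w : ℝ × ℝ => (!₂[w.1, w.2] : EuclideanSpace ℝ (Fin 2))) ⁻¹' D with hD'
  have hmeas : MeasurableSet D' :=
    measurableEmbedding_toLp_plane.measurable hD.measurableSet
  set Φ : ℝ × ℝ → ℝ × ℝ := fun w =>
    (1 - (a 0 * w.1 + a 1 * w.2), 1 - (b 0 * w.1 + b 1 * w.2)) with hΦ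
  set A : ℝ × ℝ →L[ℝ] ℝ × ℝ := (Matrix.toLin (.finTwoProd ℝ) (.finTwoProd ℝ)
    !![-a 0, -a 1; -b 0, -b 1]).toContinuousLinearMap with hA
  have hAdet : A.det = a 0 * b 1 - a 1 * b 0 := by
    simp only [hA, LinearMap.det_toContinuousLinearMap, LinearMap.det_toLin,
      Matrix.det_fin_two_of]
    ring
  have hder : ∀ w ∈ D', HasFDerivWithinAt Φ A D' w := by
    intro w _
    have hs : ∀ c : EuclideanSpace ℝ (Fin 2), HasFDerivAt
        (fun w : ℝ × ℝ => 1 - (c 0 * w.1 + c 1 * w.2))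
        ((-c 0) • ContinuousLinearMap.fst ℝ ℝ ℝ + (-c 1) • ContinuousLinearMap.snd ℝ ℝ ℝ) w := by
      intro c
      refine ((((hasFDerivAt_fst (𝕜 := ℝ) (E := ℝ) (F := ℝ) (p := w)).const_mul (c 0)).add
        ((hasFDerivAt_snd (𝕜 := ℝ) (E := ℝ) (F := ℝ) (p := w)).const_mul (c 1))).const_sub
          1).congr_fderiv ?_
      ext <;> simp
    rw [hA, Matrix.toLin_finTwoProd_toContinuousLinearMap]
    exact ((hs a).prodMk (hs b)).hasFDerivWithinAt
  have hinj : Set.InjOn Φ D' := by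
    rintro ⟨x, y⟩ - ⟨x', y'⟩ - h
    simp only [hΦ, Prod.mk.injEq] at h
    obtain ⟨h0, h1⟩ := h
    have e1 : (x - x') * (a 0 * b 1 - a 1 * b 0) = 0 := by
      linear_combination -b 1 * h0 + a 1 * h1
    have e2 : (y - y') * (a 0 * b 1 - a 1 * b 0) = 0 := by
      linear_combination b 0 * h0 - a 0 * h1
    have e1' := (mul_eq_zero.1 e1).resolve_right hdet
    have e2' := (mul_eq_zero.1 e2).resolve_right hdet
    rw [sub_eq_zero.1 e1', sub_eq_zero.1 e2']
  have hcv := integral_image_eq_integral_abs_det_fderiv_smul volume hmeas hder hinj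
    (fun w => F w.1 * G w.2)
  rw [hAdet] at hcv
  simp only [smul_eq_mul, hΦ] at hcv
  rw [integral_const_mul] at hcv
  have hleft : |a 0 * b 1 - a 1 * b 0| * ∫ w in D',
      F (1 - (a 0 * (!₂[w.1, w.2] : EuclideanSpace ℝ (Fin 2)) 0
        + a 1 * (!₂[w.1, w.2] : EuclideanSpace ℝ (Fin 2)) 1))
      * G (1 - (b 0 * (!₂[w.1, w.2] : EuclideanSpace ℝ (Fin 2)) 0
        + b 1 * (!₂[w.1, w.2] : EuclideanSpace ℝ (Fin 2)) 1))
      = ∫ w in Φ '' D', F w.1 * G w.2 := by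
    rw [hcv]
    simp
  rw [hleft]
  have hsub : Φ '' D' ⊆ Set.Icc 0 2 ×ˢ Set.Icc 0 2 := by
    rintro _ ⟨w, hw, rfl⟩
    have h1 := abs_le.1 (ha _ hw)
    have h2 := abs_le.1 (hb _ hw)
    simp only [Matrix.cons_val_zero, Matrix.cons_val_one] at h1 h2
    simp only [hΦ, Set.mem_prod, Set.mem_Icc]
    refine ⟨⟨?_, ?_⟩, ?_, ?_⟩ <;> linarith [h1.1, h1.2, h2.1, h2.2]
  have hint : IntegrableOn (fun w : ℝ × ℝ => F w.1 * G w.2) (Set.Icc 0 2 ×ˢ Set.Icc 0 2) :=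
    Continuous.continuousOn (by fun_prop) |>.integrableOn_compact (isCompact_Icc.prod isCompact_Icc)
  refine (setIntegral_mono_set hint (Filter.Eventually.of_forall fun w =>
    mul_nonneg (hF0 _) (hG0 _)) (Filter.Eventually.of_forall hsub)).trans (le_of_eq ?_)
  rw [Measure.volume_eq_prod, setIntegral_prod_mul, intervalIntegral.integral_of_le (by norm_num),
    intervalIntegral.integral_of_le (by norm_num), integral_Icc_eq_integral_Ioc,
    integral_Icc_eq_integral_Ioc]

/-- Upper bound for the Christoffel function of a domain inside a parallelogram. -/
theorem det_mul_christoffel_le {D : Set (EuclideanSpace ℝ (Fin 2))} (hD : IsCompact D)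
    (hi : (interior D).Nonempty) (a b : EuclideanSpace ℝ (Fin 2))
    (ha : ∀ z ∈ D, |a 0 * z 0 + a 1 * z 1| ≤ 1) (hb : ∀ z ∈ D, |b 0 * z 0 + b 1 * z 1| ≤ 1)
    {x : EuclideanSpace ℝ (Fin 2)} (hx : x ∈ D) {n m : ℕ} (hm : 2 * m ≤ n) :
    |a 0 * b 1 - a 1 * b 0| * christoffel n D x
      ≤ (8 * Real.pi / (m + 1) *
          (Real.sqrt (2 * (1 - (a 0 * x 0 + a 1 * x 1))) + 2 / (m + 1)))
        * (8 * Real.pi / (m + 1) *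
          (Real.sqrt (2 * (1 - (b 0 * x 0 + b 1 * x 1))) + 2 / (m + 1))) := by
  have h1 := abs_le.1 (ha x hx)
  have h2 := abs_le.1 (hb x hx)
  obtain ⟨P, hP, hPx, hPi⟩ := exists_polynomial_integral_sq_le m
    (d := 1 - (a 0 * x 0 + a 1 * x 1)) (by linarith [h1.2]) (by linarith [h1.1])
  obtain ⟨Q, hQ, hQx, hQi⟩ := exists_polynomial_integral_sq_le m
    (d := 1 - (b 0 * x 0 + b 1 * x 1)) (by linarith [h2.2]) (by linarith [h2.1])
  set l : EuclideanSpace ℝ (Fin 2) → MvPolynomial (Fin 2) ℝ := fun c =>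
    MvPolynomial.C 1 - (MvPolynomial.C (c 0) * MvPolynomial.X 0
      + MvPolynomial.C (c 1) * MvPolynomial.X 1) with hl
  have hl1 : ∀ c, (l c).totalDegree ≤ 1 := by
    intro c
    refine (MvPolynomial.totalDegree_sub _ _).trans (max_le (by simp) ?_)
    refine (MvPolynomial.totalDegree_add _ _).trans (max_le ?_ ?_) <;>
    · refine (MvPolynomial.totalDegree_mul _ _).trans ?_
      simp
  -- The competitor: a product of two ridge polynomials, each peaking on the line through `x`
  -- parallel to a side of the parallelogram.
  set f := Polynomial.aeval (l a) P * Polynomial.aeval (l b) Q with hf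
  have hfmem : f ∈ Poly 2 n := by
    rw [MvPolynomial.mem_restrictTotalDegree]
    refine (MvPolynomial.totalDegree_mul _ _).trans ?_
    have := totalDegree_aeval_le P (l a) (hl1 a)
    have := totalDegree_aeval_le Q (l b) (hl1 b)
    omega
  have hev : ∀ (c z : EuclideanSpace ℝ (Fin 2)) (S : Polynomial ℝ),
      MvPolynomial.eval (fun j => z j) (Polynomial.aeval (l c) S)
        = S.eval (1 - (c 0 * z 0 + c 1 * z 1)) := by
    intro c z S
    have hlc : MvPolynomial.eval (fun j => z j) (l c) = 1 - (c 0 * z 0 + c 1 * z 1) := by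
      simp [hl]
    rw [← hlc, Polynomial.aeval_def, Polynomial.hom_eval₂]
    rw [Polynomial.eval, Polynomial.eval₂_eq_sum, Polynomial.eval₂_eq_sum]
    simp
  have hpf : ∀ z : EuclideanSpace ℝ (Fin 2), pval f z = P.eval (1 - (a 0 * z 0 + a 1 * z 1))
      * Q.eval (1 - (b 0 * z 0 + b 1 * z 1)) := by
    intro z
    rw [pval, hf, map_mul, hev, hev]
  have hchr := christoffel_mul_sq_le hD hi x hfmem
  have hfx : 1 ≤ pval f x ^ 2 := by
    rw [hpf]
    exact one_le_pow₀ (one_le_mul_of_one_le_of_one_le hPx hQx)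
  have hc0 : 0 ≤ christoffel n D x := christoffel_nonneg n D x
  have hc1 : christoffel n D x ≤ polyInner D f f := by nlinarith
  have hpar := integral_parallelogram_le hD a b ha hb (F := fun t => P.eval t ^ 2)
    (G := fun t => Q.eval t ^ 2) (by fun_prop) (by fun_prop) (fun _ => sq_nonneg _)
    (fun _ => sq_nonneg _)
  have hpe : polyInner D f f = ∫ z in D, P.eval (1 - (a 0 * z 0 + a 1 * z 1)) ^ 2
      * Q.eval (1 - (b 0 * z 0 + b 1 * z 1)) ^ 2 := by
    refine integral_congr_ae (Filter.Eventually.of_forall fun z => ?_)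
    simp only [hpf]
    ring
  rw [← hpe] at hpar
  refine (mul_le_mul_of_nonneg_left hc1 (abs_nonneg _)).trans (hpar.trans ?_)
  exact mul_le_mul hPi hQi (intervalIntegral.integral_nonneg (by norm_num) fun t _ => sq_nonneg _)
    (by positivity)

/-! ### Convexity estimates for `|·|^α` and its polar duality. -/

section Scalar

variable {α : ℝ}

theorem rpow_sub_one_mul_self {y : ℝ} (hy : 0 ≤ y) (hα : 0 < α) : y ^ (α - 1) * y = y ^ α := by
  rcases hy.eq_or_lt with rfl | hy
  · rw [mul_zero, Real.zero_rpow hα.ne']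
  · rw [← Real.rpow_add_one hy.ne']; ring_nf

/-- The tangent line of `|·| ^ α` at a non-negative point lies below the graph. -/
theorem tangent_le_abs_rpow (hα : 1 < α) {y : ℝ} (hy : 0 ≤ y) (s : ℝ) :
    y ^ α + α * y ^ (α - 1) * s ≤ |y + s| ^ α := by
  rcases hy.eq_or_lt with rfl | hy
  · rw [Real.zero_rpow (by linarith), Real.zero_rpow (by linarith), mul_zero, zero_mul, add_zero]
    positivity
  · have hyα : y ^ α = y ^ (α - 1) * y := (rpow_sub_one_mul_self hy.le (by linarith)).symm
    have hpos : 0 < y ^ (α - 1) := Real.rpow_pos_of_pos hy _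
    rcases le_or_gt 0 (y + s) with h | h
    · have h1 : -1 ≤ s / y := by rw [le_div_iff₀ hy]; linarith
      have h2 := one_add_mul_self_le_rpow_one_add h1 hα.le
      have h3 : y + s = y * (1 + s / y) := by field_simp
      rw [abs_of_nonneg h, h3, Real.mul_rpow hy.le (by linarith)]
      refine le_trans (le_of_eq ?_) (mul_le_mul_of_nonneg_left h2 (Real.rpow_nonneg hy.le α))
      rw [hyα]
      field_simp
    · have h1 : y ^ α + α * y ^ (α - 1) * s = y ^ (α - 1) * (y + α * s) := by rw [hyα]; ring
      rw [h1]
      have h2 : y + α * s ≤ 0 := by nlinarith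
      exact (mul_nonpos_of_nonneg_of_nonpos hpos.le h2).trans (by positivity)

/-- Subadditivity of the power `α - 1`, which lies in `(0, 1)`: Hölder continuity of the derivative
of `|·|^α`. -/
theorem abs_rpow_sub_rpow_le (hα₁ : 1 < α) (hα₂ : α < 2) {y z : ℝ} (hy : 0 ≤ y) (hz : 0 ≤ z) :
    |z ^ (α - 1) - y ^ (α - 1)| ≤ |z - y| ^ (α - 1) := by
  have key : ∀ a b : ℝ, 0 ≤ a → a ≤ b → b ^ (α - 1) - a ^ (α - 1) ≤ (b - a) ^ (α - 1) := by
    intro a b ha hab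
    have h := Real.rpow_add_le_add_rpow ha (sub_nonneg.2 hab) (by linarith : 0 ≤ α - 1)
      (by linarith)
    rw [add_sub_cancel] at h
    linarith
  have hα0 : 0 ≤ α - 1 := by linarith
  rcases le_total y z with h | h
  · rw [abs_of_nonneg (sub_nonneg.2 h),
      abs_of_nonneg (sub_nonneg.2 (Real.rpow_le_rpow hy h hα0))]
    exact key y z hy h
  · rw [abs_sub_comm, abs_sub_comm z, abs_of_nonneg (sub_nonneg.2 h),
      abs_of_nonneg (sub_nonneg.2 (Real.rpow_le_rpow hz h hα0))]
    exact key z y hz h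

/-- The deviation of `|·| ^ α` from its tangent is at most of order `|s| ^ α`. -/
theorem abs_rpow_le_tangent_add_rpow (hα₁ : 1 < α) (hα₂ : α < 2) {y : ℝ} (hy : 0 ≤ y) (s : ℝ) :
    |y + s| ^ α ≤ y ^ α + α * y ^ (α - 1) * s + 4 * |s| ^ α := by
  have hs : |s| ^ α = |s| ^ (α - 1) * |s| :=
    (rpow_sub_one_mul_self (abs_nonneg s) (by linarith)).symm
  have hs0 : 0 ≤ |s| ^ (α - 1) := by positivity
  have hα0 : 0 ≤ α - 1 := by linarith
  rcases le_or_gt 0 (y + s) with h | h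
  -- The tangent at the far end `y + s`, read back at `y`, bounds the deviation by `α s` times the
  -- increment of the power `α - 1`.
  · have h1 := tangent_le_abs_rpow hα₁ h (-s)
    rw [add_neg_cancel_right, abs_of_nonneg hy] at h1
    have h2 := abs_rpow_sub_rpow_le hα₁ hα₂ hy h
    rw [add_sub_cancel_left] at h2
    have h3 : s * ((y + s) ^ (α - 1) - y ^ (α - 1)) ≤ |s| * |s| ^ (α - 1) :=
      (le_abs_self _).trans (by rw [abs_mul]; gcongr)
    rw [abs_of_nonneg h, hs]
    nlinarith [mul_nonneg (abs_nonneg s) hs0]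
  · have hs1 : s < 0 := by linarith
    -- Here `y + s < 0`, so the tangent at `|y + s|` moved by `s` arrives at `-y`; both `y` and `|y
    -- + s|` are at most `|s|`.
    have h1 := tangent_le_abs_rpow hα₁ (abs_nonneg (y + s)) s
    have h2 : |(|y + s| + s)| = y := by
      rw [abs_of_neg h]; ring_nf; rw [abs_neg, abs_of_nonneg hy]
    rw [h2] at h1
    have h3 : |y + s| ^ (α - 1) ≤ |s| ^ (α - 1) := by
      refine Real.rpow_le_rpow (abs_nonneg _) ?_ hα0
      rw [abs_of_neg h, abs_of_neg hs1]; linarith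
    have h4 : y ^ (α - 1) ≤ |s| ^ (α - 1) := by
      refine Real.rpow_le_rpow hy ?_ hα0
      rw [abs_of_neg hs1]; linarith
    have h5 : |s| = -s := abs_of_neg hs1
    have h6 : α * (|y + s| ^ (α - 1) + y ^ (α - 1)) ≤ 4 * |s| ^ (α - 1) := by
      nlinarith
    rw [hs]
    have h7 := mul_le_mul_of_nonneg_right h6 (abs_nonneg s)
    rw [h5] at h7 ⊢
    linarith

/-- The deviation of `|·| ^ α` from its tangent at a positive point is quadratic. -/
theorem abs_rpow_le_tangent_add_sq (hα₁ : 1 < α) (hα₂ : α < 2) {y : ℝ} (hy : 0 < y) (s : ℝ) :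
    |y + s| ^ α ≤ y ^ α + α * y ^ (α - 1) * s + 4 * (s ^ 2 * y ^ (α - 2)) := by
  have hy1 : y ^ (α - 1) = y ^ (α - 2) * y := by
    rw [← Real.rpow_add_one hy.ne']; ring_nf
  have hy2 : 0 < y ^ (α - 2) := Real.rpow_pos_of_pos hy _
  rcases le_or_gt 0 (y + s) with h | h
  · have h1 := tangent_le_abs_rpow hα₁ h (-s)
    rw [add_neg_cancel_right, abs_of_nonneg hy.le] at h1
    have e : y + s = y * (1 + s / y) := by field_simp
    have hsy : 0 ≤ 1 + s / y := by
      have := div_nonneg h hy.le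
      rwa [add_div, div_self hy.ne'] at this
    have e1 : (y + s) ^ (α - 1) = y ^ (α - 1) * (1 + s / y) ^ (α - 1) := by
      rw [e, Real.mul_rpow hy.le hsy]
    have h3 : s * ((y + s) ^ (α - 1) - y ^ (α - 1)) ≤ s ^ 2 * y ^ (α - 2) := by
      rcases le_or_gt 0 s with hs | hs
      · have h2 := rpow_one_add_le_one_add_mul_self (s := s / y) (by linarith)
          (by linarith : 0 ≤ α - 1) (by linarith)
        have h4 : (y + s) ^ (α - 1) - y ^ (α - 1) ≤ y ^ (α - 2) * s := by
          have h5 : (1 + s / y) ^ (α - 1) - 1 ≤ s / y := by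
            have : 0 ≤ s / y := div_nonneg hs hy.le
            nlinarith
          calc (y + s) ^ (α - 1) - y ^ (α - 1) = y ^ (α - 1) * ((1 + s / y) ^ (α - 1) - 1) := by
                rw [e1]; ring
            _ ≤ y ^ (α - 1) * (s / y) := by gcongr
            _ = y ^ (α - 2) * s := by rw [hy1]; field_simp
        nlinarith
      · have h2 : 1 + s / y ≤ (1 + s / y) ^ (α - 1) := by
          have := Real.rpow_le_rpow_of_exponent_ge' hsy
            (by have := div_neg_of_neg_of_pos hs hy; linarith) (by linarith : 0 ≤ α - 1)
            (by linarith : α - 1 ≤ 1)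
          rwa [Real.rpow_one] at this
        have h4 : y ^ (α - 2) * s ≤ (y + s) ^ (α - 1) - y ^ (α - 1) := by
          calc y ^ (α - 2) * s = y ^ (α - 1) * (s / y) := by rw [hy1]; field_simp
            _ ≤ y ^ (α - 1) * ((1 + s / y) ^ (α - 1) - 1) := by gcongr; linarith
            _ = (y + s) ^ (α - 1) - y ^ (α - 1) := by rw [e1]; ring
        nlinarith
    rw [abs_of_nonneg h]
    nlinarith [mul_nonneg (sq_nonneg s) hy2.le]
  -- Past the origin `|s| ≥ y`, and since `α - 2 < 0` this gives `|s|^α ≤ s² y^(α-2)`.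
  · refine (abs_rpow_le_tangent_add_rpow hα₁ hα₂ hy.le s).trans ?_
    have hs1 : y ≤ |s| := by rw [abs_of_neg (by linarith)]; linarith
    have hs0 : 0 < |s| := hy.trans_le hs1
    have h1 : |s| ^ α = s ^ 2 * |s| ^ (α - 2) := by
      rw [← sq_abs s, ← Real.rpow_natCast, ← Real.rpow_add hs0]
      norm_num
    have h2 : |s| ^ (α - 2) ≤ y ^ (α - 2) :=
      Real.rpow_le_rpow_of_nonpos hy hs1 (by linarith)
    rw [h1]
    gcongr

/-- Vectors `(± a ^ (α - 1), ± b ^ (α - 1))` with `a ^ α + b ^ α = 1` lie in the polar body. -/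
theorem abs_dual_pairing_le_one (hα : 1 < α) {a b c d x y : ℝ} (ha : 0 ≤ a) (hb : 0 ≤ b)
    (hab : a ^ α + b ^ α = 1) (hc : |c| = a ^ (α - 1)) (hd : |d| = b ^ (α - 1))
    (hxy : |x| ^ α + |y| ^ α ≤ 1) : |c * x + d * y| ≤ 1 := by
  have hα0 : 0 < α := by linarith
  -- Young's inequality, read off the tangent at `u`; the two coordinates sum to `1 + (α - 1) = α`.
  have key : ∀ u v : ℝ, 0 ≤ u → α * (u ^ (α - 1) * |v|) ≤ |v| ^ α + (α - 1) * u ^ α := by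
    intro u v hu
    have h := tangent_le_abs_rpow hα hu (|v| - u)
    rw [add_sub_cancel, abs_abs] at h
    have := rpow_sub_one_mul_self hu hα0
    nlinarith
  have h1 := key a x ha
  have h2 := key b y hb
  refine (abs_add_le _ _).trans ?_
  rw [abs_mul, abs_mul, hc, hd]
  have : α * (a ^ (α - 1) * |x| + b ^ (α - 1) * |y|) ≤ α * 1 := by nlinarith
  exact le_of_mul_le_mul_left this hα0

end Scalar

/-! ### The boundary arc and an inner neighbourhood of its points. -/

/-- `(x, y)` lies on the part `0 ≤ x ≤ y` of the curve `x ^ α + y ^ α = 1`. -/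
structure OnArc (α x y : ℝ) : Prop where
  one_lt : 1 < α
  lt_two : α < 2
  nonneg : 0 ≤ x
  le : x ≤ y
  eq_one : x ^ α + y ^ α = 1

namespace OnArc

variable {α x y : ℝ}

theorem nonneg_right (h : OnArc α x y) : 0 ≤ y := h.nonneg.trans h.le

theorem rpow_le_half (h : OnArc α x y) : x ^ α ≤ 1 / 2 := by
  have h1 := Real.rpow_le_rpow h.nonneg h.le (by linarith [h.one_lt] : 0 ≤ α)
  linarith [h.eq_one]

theorem half_le_rpow (h : OnArc α x y) : 1 / 2 ≤ y ^ α := by linarith [h.rpow_le_half, h.eq_one]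

theorem le_one_right (h : OnArc α x y) : y ≤ 1 := by
  by_contra hy
  have := Real.one_lt_rpow (not_le.1 hy) (by linarith [h.one_lt] : 0 < α)
  linarith [h.eq_one, Real.rpow_nonneg h.nonneg α]

theorem le_one (h : OnArc α x y) : x ≤ 1 := h.le.trans h.le_one_right

theorem half_le (h : OnArc α x y) : 1 / 2 ≤ y := by
  have := Real.rpow_le_rpow_of_exponent_ge' h.nonneg_right h.le_one_right zero_le_one h.one_lt.le
  rw [Real.rpow_one] at this
  linarith [h.half_le_rpow]

theorem half_le_rpow_sub_one (h : OnArc α x y) : 1 / 2 ≤ y ^ (α - 1) := by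
  have := Real.rpow_le_rpow_of_exponent_ge' h.nonneg_right h.le_one_right
    (by linarith [h.one_lt] : 0 ≤ α - 1) (by linarith [h.lt_two] : α - 1 ≤ 1)
  rw [Real.rpow_one] at this
  linarith [h.half_le]

theorem rpow_sub_two_le (h : OnArc α x y) : y ^ (α - 2) ≤ 2 := by
  have h0 : 0 < y := by linarith [h.half_le]
  have := Real.rpow_le_rpow_of_exponent_ge h0 h.le_one_right
    (by linarith [h.one_lt] : -1 ≤ α - 2)
  rw [Real.rpow_neg_one] at this
  refine this.trans ?_
  rw [inv_le_comm₀ h0 (by norm_num)]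
  linarith [h.half_le]

theorem rpow_sub_one_le (h : OnArc α x y) : x ^ (α - 1) ≤ 1 :=
  Real.rpow_le_one h.nonneg h.le_one (by linarith [h.one_lt])

theorem rpow_sub_one_le_right (h : OnArc α x y) : y ^ (α - 1) ≤ 1 :=
  Real.rpow_le_one h.nonneg_right h.le_one_right (by linarith [h.one_lt])

theorem pairing_self (h : OnArc α x y) : x ^ (α - 1) * x + y ^ (α - 1) * y = 1 := by
  rw [rpow_sub_one_mul_self h.nonneg (by linarith [h.one_lt]),
    rpow_sub_one_mul_self h.nonneg_right (by linarith [h.one_lt]), h.eq_one]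

/-- Splits the gradient direction `(x^(α-1), y^(α-1))` into length and unit normal. As `x ≤ y`, its
second coordinate is at least `1/2`, so passing between the supporting functional and the unit
normal costs only absolute constants. -/
theorem exists_normal (h : OnArc α x y) : ∃ ν u₀ u₁ : ℝ, 1 / 2 ≤ ν ∧ ν ≤ 2 ∧ u₀ ^ 2 + u₁ ^ 2 = 1 ∧
    x ^ (α - 1) = ν * u₀ ∧ y ^ (α - 1) = ν * u₁ := by
  have h1 := h.half_le_rpow_sub_one
  have h2 := h.rpow_sub_one_le
  have h3 := h.rpow_sub_one_le_right
  have h4 : 0 ≤ x ^ (α - 1) := Real.rpow_nonneg h.nonneg _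
  set N₀ := x ^ (α - 1)
  set N₁ := y ^ (α - 1)
  have hν : 1 / 2 ≤ Real.sqrt (N₀ ^ 2 + N₁ ^ 2) := Real.le_sqrt_of_sq_le (by nlinarith)
  have hν0 : Real.sqrt (N₀ ^ 2 + N₁ ^ 2) ≠ 0 := by linarith
  refine ⟨Real.sqrt (N₀ ^ 2 + N₁ ^ 2), N₀ / Real.sqrt (N₀ ^ 2 + N₁ ^ 2),
    N₁ / Real.sqrt (N₀ ^ 2 + N₁ ^ 2), hν, ?_, ?_, ?_, ?_⟩
  · exact Real.sqrt_le_iff.2 ⟨by norm_num, by nlinarith⟩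
  · rw [div_pow, div_pow, ← add_div, Real.sq_sqrt (by positivity), div_self]
    nlinarith
  · field_simp
  · field_simp

end OnArc

/-- Covers base points with `x^α ≤ δ`. Since `δ ≤ 2T`, the hypothesis gives `X² ≤ (2T)^(2/α) /
16384`; raising to the power `α/2 ≥ 1/2` leaves at most `2T / 128`. -/
theorem abs_rpow_le_div {α δ T X : ℝ} (hα₁ : 1 < α) (hα₂ : α < 2) (hδ : 0 < δ)
    (hδT : δ ≤ 2 * T) (hX : X ^ 2 ≤ 1 / 16384 * T * δ ^ (2 / α - 1)) : |X| ^ α ≤ T / 64 := by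
  have hα : 0 < α := by linarith
  have hT0 : 0 < T := by linarith
  have e1 : |X| ^ α = (X ^ 2) ^ (α / 2) := by
    rw [← sq_abs, ← Real.rpow_natCast, ← Real.rpow_mul (abs_nonneg X)]
    congr 1
    push_cast
    ring
  have e2 : X ^ 2 ≤ 1 / 16384 * (2 * T) ^ (2 / α) := by
    have h3 : δ ^ (2 / α - 1) ≤ (2 * T) ^ (2 / α - 1) := by
      refine Real.rpow_le_rpow hδ.le hδT ?_
      rw [sub_nonneg, le_div_iff₀ hα]
      linarith
    have h4 : (2 * T) ^ (2 / α) = (2 * T) ^ (2 / α - 1) * (2 * T) :=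
      (rpow_sub_one_mul_self (by linarith) (by positivity)).symm
    have h5 : 0 ≤ (2 * T) ^ (2 / α - 1) := by positivity
    rw [h4]
    nlinarith
  have e3 : ((1 : ℝ) / 16384) ^ (α / 2) ≤ 1 / 128 := by
    have h3 := Real.rpow_le_rpow_of_exponent_ge (x := (1 : ℝ) / 16384) (by norm_num)
      (by norm_num) (by linarith : (1 : ℝ) / 2 ≤ α / 2)
    refine h3.trans (le_of_eq ?_)
    rw [← Real.sqrt_eq_rpow, show (1 : ℝ) / 16384 = (1 / 128) ^ 2 by norm_num,
      Real.sqrt_sq (by norm_num)]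
  have e4 : ((2 * T) ^ (2 / α)) ^ (α / 2) = 2 * T := by
    rw [← Real.rpow_mul (by linarith), div_mul_div_cancel₀ hα.ne', div_self two_ne_zero,
      Real.rpow_one]
  rw [e1]
  refine (Real.rpow_le_rpow (sq_nonneg X) e2 (by positivity)).trans ?_
  rw [Real.mul_rpow (by norm_num) (by positivity), e4]
  nlinarith

namespace OnArc

variable {α x y : ℝ}

theorem max_rpow_le_one (h : OnArc α x y) {δ : ℝ} (hδ : 0 < δ) (hδ1 : δ ≤ 1) :
    (max δ (x ^ α)) ^ (2 / α - 1) ≤ 1 := by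
  have hα : 0 < α := by linarith [h.one_lt]
  refine Real.rpow_le_one (hδ.le.trans (le_max_left _ _))
    (max_le hδ1 (by linarith [h.rpow_le_half])) ?_
  rw [sub_nonneg, le_div_iff₀ hα]
  linarith [h.lt_two]

/-- A neighbourhood of a boundary point, in coordinates along the normal and the tangent, that is
contained in `B_α`. -/
theorem abs_rpow_add_abs_rpow_le_one (h : OnArc α x y) {ν u₀ u₁ δ T X : ℝ} (hν : 1 / 2 ≤ ν)
    (hu : u₀ ^ 2 + u₁ ^ 2 = 1) (hx : x ^ (α - 1) = ν * u₀) (hy : y ^ (α - 1) = ν * u₁)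
    (hδ : 0 < δ) (hδT : δ ≤ 2 * T) (hT : T ≤ 1 / 256) (hT' : T ^ (α - 1) ≤ 1 / 256)
    (hX : X ^ 2 ≤ 1 / 16384 * T * (max δ (x ^ α)) ^ (2 / α - 1)) :
    |x + (-(T * u₀) + X * u₁)| ^ α + |y + (-(T * u₁) - X * u₀)| ^ α ≤ 1 := by
  have hα₁ := h.one_lt
  have hα₂ := h.lt_two
  have hα : 0 < α := by linarith
  have hT0 : 0 < T := by linarith
  have hM1 := h.max_rpow_le_one hδ (by linarith)
  have hX1 : X ^ 2 ≤ T / 16384 := by nlinarith only [hX, hM1, hT0]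
  have hu0 : |u₀| ≤ 1 := abs_le_one_iff_mul_self_le_one.2 (by nlinarith)
  have hu1 : |u₁| ≤ 1 := abs_le_one_iff_mul_self_le_one.2 (by nlinarith)
  have hw0 : |-(T * u₀) + X * u₁| ≤ T + |X| := by
    refine (abs_add_le _ _).trans ?_
    rw [abs_neg, abs_mul, abs_mul, abs_of_pos hT0]
    nlinarith only [abs_nonneg X, hu0, hu1, hT0]
  have hw1 : (-(T * u₁) - X * u₀) ^ 2 ≤ 2 * T ^ 2 + 2 * X ^ 2 := by
    nlinarith [sq_nonneg (T * u₁ - X * u₀), sq_nonneg (T * u₀), sq_nonneg (X * u₁), hu]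
  set w₀ := -(T * u₀) + X * u₁ with hw₀
  set w₁ := -(T * u₁) - X * u₀ with hw₁
  have hy0 : 0 < y := by linarith [h.half_le]
  have hR1 := abs_rpow_le_tangent_add_sq hα₁ hα₂ hy0 w₁
  have hR1' : 4 * (w₁ ^ 2 * y ^ (α - 2)) ≤ T / 8 := by
    have h1 := h.rpow_sub_two_le
    have h2 : 0 ≤ y ^ (α - 2) := Real.rpow_nonneg hy0.le _
    have h3 : w₁ ^ 2 * y ^ (α - 2) ≤ (2 * T ^ 2 + 2 * X ^ 2) * 2 := by gcongr
    nlinarith only [h3, hX1, hT, hT0]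
  have hTα : T ^ α ≤ T / 256 := by
    rw [← rpow_sub_one_mul_self hT0.le hα]
    nlinarith only [hT', hT0]
  have h2α : (2 : ℝ) ^ α ≤ 4 := by
    have := Real.rpow_le_rpow_of_exponent_le (x := 2) (by norm_num) hα₂.le
    norm_num at this ⊢
    exact this
  have h2r : ∀ r : ℝ, 0 ≤ r → (2 * r) ^ α ≤ 4 * r ^ α := by
    intro r hr
    rw [Real.mul_rpow (by norm_num) hr]
    gcongr
  -- Three regimes: a move dominated by the normal part, where `T^α` is small against `T`; a base
  -- point so close to the axis that the `|s|^α` bound is the right one; and a base point far enough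
  -- away for the quadratic bound, where `x^(α-2)` cancels the weight `x^(2-α)`.
  have hR0 : |x + w₀| ^ α ≤ x ^ α + α * x ^ (α - 1) * w₀ + T / 4 := by
    rcases lt_or_ge |X| T with hXT | hXT
    · refine (abs_rpow_le_tangent_add_rpow hα₁ hα₂ h.nonneg w₀).trans ?_
      have h1 : |w₀| ^ α ≤ 4 * T ^ α :=
        (Real.rpow_le_rpow (abs_nonneg _) (by linarith) hα.le).trans (h2r T hT0.le)
      linarith
    · rcases le_or_gt (x ^ α) δ with hxδ | hxδ
      · refine (abs_rpow_le_tangent_add_rpow hα₁ hα₂ h.nonneg w₀).trans ?_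
        have h1 : |w₀| ^ α ≤ 4 * |X| ^ α :=
          (Real.rpow_le_rpow (abs_nonneg _) (by linarith) hα.le).trans (h2r |X| (abs_nonneg X))
        have h2 : |X| ^ α ≤ T / 64 := by
          rw [max_eq_left hxδ] at hX
          exact abs_rpow_le_div hα₁ hα₂ hδ hδT hX
        linarith
      · have hx0 : 0 < x := by
          rcases h.nonneg.eq_or_lt with h0 | h0
          · rw [← h0, Real.zero_rpow hα.ne'] at hxδ
            linarith
          · exact h0
        refine (abs_rpow_le_tangent_add_sq hα₁ hα₂ hx0 w₀).trans ?_
        rw [max_eq_right hxδ.le, ← Real.rpow_mul hx0.le] at hX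
        have e1 : α * (2 / α - 1) = 2 - α := by field_simp
        have e2 : x ^ (2 - α) * x ^ (α - 2) = 1 := by
          rw [← Real.rpow_add hx0]; norm_num
        have h0 : 0 ≤ x ^ (α - 2) := by positivity
        have h1 : w₀ ^ 2 ≤ 4 * X ^ 2 := by
          rw [← sq_abs w₀, ← sq_abs X]
          nlinarith only [abs_nonneg w₀, hw0, hXT]
        rw [e1] at hX
        have h2 : w₀ ^ 2 * x ^ (α - 2) ≤ 4 * (1 / 16384 * T * x ^ (2 - α)) * x ^ (α - 2) := by
          gcongr
          linarith
        have h3 : 4 * (1 / 16384 * T * x ^ (2 - α)) * x ^ (α - 2) = 4 * (1 / 16384) * T := by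
          linear_combination 4 * (1 / 16384) * T * e2
        linarith
  -- The tangential part drops out of the linear term, leaving a gain of at least `T/2` against
  -- remainders `T/4 + T/8`.
  have hN : α * x ^ (α - 1) * w₀ + α * y ^ (α - 1) * w₁ = -(α * ν * T) := by
    rw [hx, hy, hw₀, hw₁]
    linear_combination (-α * ν * T) * hu
  have hανT : T / 2 ≤ α * ν * T := by
    have : 1 / 2 ≤ α * ν := by nlinarith only [hα₁, hν]
    nlinarith only [this, hT0]
  linarith [h.eq_one]

end OnArc

/-! ### The circle coordinate `x^(α/2)` and nearby supporting functionals. -/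

/-- Comparison of powers of exponent in `[1, 2]`. -/
theorem sq_rpow_sub_rpow_mul_le {γ r s : ℝ} (hγ₁ : 1 < γ) (hγ₂ : γ < 2) (hr : 0 ≤ r) (hs : 0 < s)
    (hrs : r ≤ 2 * s) :
    (r ^ γ - s ^ γ) ^ 2 ≤ 16 * (s ^ (γ - 1)) ^ 2 * (r - s) ^ 2 := by
  have h1 := tangent_le_abs_rpow hγ₁ hr (s - r)
  have h2 := tangent_le_abs_rpow hγ₁ hs.le (r - s)
  rw [add_sub_cancel, abs_of_pos hs] at h1
  rw [add_sub_cancel, abs_of_nonneg hr] at h2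
  have hs1 : 0 < s ^ (γ - 1) := Real.rpow_pos_of_pos hs _
  have hr1 : r ^ (γ - 1) ≤ 2 * s ^ (γ - 1) := by
    refine (Real.rpow_le_rpow hr hrs (by linarith)).trans ?_
    rw [Real.mul_rpow (by norm_num) hs.le]
    have := Real.rpow_le_rpow_of_exponent_le (x := 2) (by norm_num) (by linarith : γ - 1 ≤ 1)
    rw [Real.rpow_one] at this
    gcongr
  have hr0 : 0 ≤ r ^ (γ - 1) := Real.rpow_nonneg hr _
  have key : |r ^ γ - s ^ γ| ≤ 4 * s ^ (γ - 1) * |r - s| := by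
    rcases le_total s r with hsr | hsr
    · have h3 : 0 ≤ r ^ γ - s ^ γ := by
        have : 0 ≤ γ * s ^ (γ - 1) * (r - s) :=
          mul_nonneg (by positivity) (sub_nonneg.2 hsr)
        linarith
      rw [abs_of_nonneg h3, abs_of_nonneg (sub_nonneg.2 hsr)]
      have h4 : γ * r ^ (γ - 1) ≤ 4 * s ^ (γ - 1) := by nlinarith
      have := mul_le_mul_of_nonneg_right h4 (sub_nonneg.2 hsr)
      linarith
    · have h3 : r ^ γ - s ^ γ ≤ 0 := by
        have : 0 ≤ γ * r ^ (γ - 1) * (s - r) :=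
          mul_nonneg (by positivity) (sub_nonneg.2 hsr)
        linarith
      rw [abs_of_nonpos h3, abs_of_nonpos (sub_nonpos.2 hsr)]
      have h4 : γ * s ^ (γ - 1) ≤ 4 * s ^ (γ - 1) := by nlinarith
      have := mul_le_mul_of_nonneg_right h4 (sub_nonneg.2 hsr)
      linarith
  rw [← sq_abs (r ^ γ - s ^ γ), ← sq_abs (r - s)]
  calc |r ^ γ - s ^ γ| ^ 2 ≤ (4 * s ^ (γ - 1) * |r - s|) ^ 2 := by gcongr
    _ = _ := by ring

/-- In the coordinate `ξ = x^(α/2)` the quadratic remainder of `|·|^α` becomes a plain square: `x =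
ξ^(2/α)` has derivative of order `ξ^(2/α-1)`, whose square at `a` cancels `a^(α-2)` exactly. -/
theorem sq_sub_mul_rpow_le {α a x : ℝ} (hα₁ : 1 < α) (hα₂ : α < 2) (ha : 0 < a) (hx : 0 ≤ x)
    (hax : x ^ (α / 2) ≤ 2 * a ^ (α / 2)) :
    (x - a) ^ 2 * a ^ (α - 2) ≤ 16 * (x ^ (α / 2) - a ^ (α / 2)) ^ 2 := by
  have hα : 0 < α := by linarith
  have hback : ∀ t : ℝ, 0 ≤ t → (t ^ (α / 2)) ^ (2 / α) = t := by
    intro t ht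
    rw [← Real.rpow_mul ht, div_mul_div_cancel₀ two_ne_zero, div_self hα.ne', Real.rpow_one]
  have h := sq_rpow_sub_rpow_mul_le (γ := 2 / α) (by rw [lt_div_iff₀ hα]; linarith)
    (by rw [div_lt_iff₀ hα]; linarith) (Real.rpow_nonneg hx (α / 2))
    (Real.rpow_pos_of_pos ha (α / 2)) hax
  rw [hback x hx, hback a ha.le] at h
  have e : ((a ^ (α / 2)) ^ (2 / α - 1)) ^ 2 * a ^ (α - 2) = 1 := by
    rw [← Real.rpow_mul ha.le, ← Real.rpow_natCast, ← Real.rpow_mul ha.le, ← Real.rpow_add ha]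
    have : α / 2 * (2 / α - 1) * ((2 : ℕ) : ℝ) + (α - 2) = 0 := by
      push_cast
      field_simp
      ring
    rw [this, Real.rpow_zero]
  have h0 : 0 ≤ a ^ (α - 2) := by positivity
  calc (x - a) ^ 2 * a ^ (α - 2)
      ≤ 16 * ((a ^ (α / 2)) ^ (2 / α - 1)) ^ 2 * (x ^ (α / 2) - a ^ (α / 2)) ^ 2 * a ^ (α - 2) := by
        gcongr
    _ = _ := by linear_combination 16 * (x ^ (α / 2) - a ^ (α / 2)) ^ 2 * e

/-- The increment of a concave power is bounded below by its derivative at the right end. -/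
theorem mul_rpow_le_rpow_sub_rpow {β r s : ℝ} (hβ₀ : 0 ≤ β) (hβ₁ : β ≤ 1) (hr : 0 ≤ r)
    (hs : 0 < s) : β * s ^ (β - 1) * (s - r) ≤ s ^ β - r ^ β := by
  have h1 : -1 ≤ r / s - 1 := by
    have := div_nonneg hr hs.le
    linarith
  have h := rpow_one_add_le_one_add_mul_self h1 hβ₀ hβ₁
  have e1 : 1 + (r / s - 1) = r / s := by ring
  rw [e1, Real.div_rpow hr hs.le] at h
  have e2 : s ^ β = s ^ (β - 1) * s := by
    rw [← Real.rpow_add_one hs.ne']; ring_nf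
  have hsβ : 0 < s ^ β := Real.rpow_pos_of_pos hs _
  rw [div_le_iff₀ hsβ] at h
  have e3 : (1 + β * (r / s - 1)) * s ^ β = s ^ β - β * s ^ (β - 1) * (s - r) := by
    rw [e2]; field_simp; ring
  linarith

namespace OnArc

variable {α x y : ℝ}

/-- The defect of the tangent functional at a nearby boundary point `(a, b)`. -/
theorem one_sub_pairing_le (h : OnArc α x y) {a b η : ℝ} (ha : 0 < a) (hb : 0 < b)
    (hab : a ^ α + b ^ α = 1) (hxa : x ^ (α / 2) ≤ 2 * a ^ (α / 2))
    (hb2 : 1 / 2 ≤ b ^ (α / 2)) (hη : |x ^ (α / 2) - a ^ (α / 2)| ≤ η) :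
    1 - (a ^ (α - 1) * x + b ^ (α - 1) * y) ≤ 1088 * η ^ 2 := by
  have hα₁ := h.one_lt
  have hα₂ := h.lt_two
  have hα : 0 < α := by linarith
  have hsq : ∀ t : ℝ, 0 ≤ t → (t ^ (α / 2)) ^ 2 = t ^ α := by
    intro t ht
    rw [← Real.rpow_natCast, ← Real.rpow_mul ht]
    congr 1
    push_cast
    ring
  have hy0 := h.nonneg_right
  have hy1 : y ^ (α / 2) ≤ 1 := Real.rpow_le_one hy0 h.le_one_right (by positivity)
  have h1 := sq_sub_mul_rpow_le hα₁ hα₂ ha h.nonneg hxa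
  have h2 := sq_sub_mul_rpow_le hα₁ hα₂ hb hy0 (by linarith)
  have r1 := abs_rpow_le_tangent_add_sq hα₁ hα₂ ha (x - a)
  have r2 := abs_rpow_le_tangent_add_sq hα₁ hα₂ hb (y - b)
  rw [add_sub_cancel, abs_of_nonneg h.nonneg] at r1
  rw [add_sub_cancel, abs_of_nonneg hy0] at r2
  have sx := hsq x h.nonneg
  have sy := hsq y hy0
  have sa := hsq a ha.le
  have sb := hsq b hb.le
  have hx0' : 0 ≤ x ^ (α / 2) := Real.rpow_nonneg h.nonneg _
  have ha0' : 0 ≤ a ^ (α / 2) := Real.rpow_nonneg ha.le _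
  have hy0' : 0 ≤ y ^ (α / 2) := Real.rpow_nonneg hy0 _
  have hxle : x ^ α ≤ 1 := by linarith [h.rpow_le_half]
  have hale : a ^ α ≤ 1 := by linarith [Real.rpow_nonneg hb.le α]
  have heq := h.eq_one
  set ξ := x ^ (α / 2)
  set ζ := y ^ (α / 2)
  set ξ' := a ^ (α / 2)
  set ζ' := b ^ (α / 2)
  have hη0 : 0 ≤ η := (abs_nonneg _).trans hη
  have hq : (ξ - ξ') ^ 2 ≤ η ^ 2 := by
    rw [← sq_abs]
    gcongr
  have hζ : (ζ - ζ') ^ 2 ≤ 16 * η ^ 2 := by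
    -- Both points `(ξ, ζ)` and `(ξ', ζ')` lie on the unit circle; as `ζ + ζ' ≥ 1/2`, the second
    -- increment is controlled by the first.
    have e : (ζ - ζ') * (ζ + ζ') = (ξ' - ξ) * (ξ' + ξ) := by
      linear_combination sy - sb - sa + sx + heq - hab
    have hξ1 : ξ ≤ 1 := (sq_le_one_iff₀ hx0').1 (sx.trans_le hxle)
    have hξ1' : ξ' ≤ 1 := (sq_le_one_iff₀ ha0').1 (sa.trans_le hale)
    have e2 : (ζ - ζ') ^ 2 * (ζ + ζ') ^ 2 = (ξ - ξ') ^ 2 * (ξ' + ξ) ^ 2 := by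
      linear_combination ((ζ - ζ') * (ζ + ζ') + (ξ' - ξ) * (ξ' + ξ)) * e
    have h3 : (ζ - ζ') ^ 2 * (1 / 4) ≤ (ζ - ζ') ^ 2 * (ζ + ζ') ^ 2 := by
      gcongr
      nlinarith only [hy0', hb2]
    have h4 : (ξ - ξ') ^ 2 * (ξ' + ξ) ^ 2 ≤ (ξ - ξ') ^ 2 * 4 := by
      gcongr
      nlinarith only [hξ1, hξ1', hx0', ha0']
    linarith
  have pa := rpow_sub_one_mul_self ha.le hα
  have pb := rpow_sub_one_mul_self hb.le hα
  -- The first-order terms at `(a, b)` are minus the sum of the two remainders, so the constant is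
  -- `4·16 + 4·16·16 = 1088`.
  have hfin : α * (1 - (a ^ (α - 1) * x + b ^ (α - 1) * y)) ≤ 1088 * η ^ 2 := by
    have e : α * (1 - (a ^ (α - 1) * x + b ^ (α - 1) * y))
        = -(α * a ^ (α - 1) * (x - a) + α * b ^ (α - 1) * (y - b)) := by
      linear_combination α * (-pa - pb - hab)
    rw [e]
    linarith
  rcases le_or_gt (1 - (a ^ (α - 1) * x + b ^ (α - 1) * y)) 0 with h0 | h0
  · exact h0.trans (by positivity)
  · nlinarith only [h0, hα₁, hfin]

end OnArc

theorem rpow_half_sq {α t : ℝ} (ht : 0 ≤ t) : (t ^ (α / 2)) ^ 2 = t ^ α := by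
  rw [← Real.rpow_natCast, ← Real.rpow_mul ht]
  congr 1
  push_cast
  ring

theorem rpow_half_rpow {α t : ℝ} (hα : 0 < α) (ht : 0 ≤ t) :
    (t ^ (α / 2)) ^ (2 - 2 / α) = t ^ (α - 1) := by
  rw [← Real.rpow_mul ht]
  congr 1
  field_simp

/-- The point of the curve `a ^ α + b ^ α = 1` with a prescribed value of `a ^ (α / 2)`. -/
theorem exists_curve_point {α s : ℝ} (hα : 0 < α) (hs : 0 < s) (hs2 : s ^ 2 ≤ 3 / 4) :
    ∃ a b : ℝ, 0 < a ∧ 0 < b ∧ a ^ α + b ^ α = 1 ∧ a ^ (α / 2) = s ∧ 1 / 2 ≤ b ^ (α / 2) := by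
  have h1 : 0 < 1 - s ^ 2 := by linarith
  have ha : (s ^ (2 / α)) ^ (α / 2) = s := by
    rw [← Real.rpow_mul hs.le, div_mul_div_cancel₀ hα.ne', div_self two_ne_zero, Real.rpow_one]
  have hb : ((1 - s ^ 2) ^ (1 / α)) ^ α = 1 - s ^ 2 := by
    rw [← Real.rpow_mul h1.le, one_div_mul_cancel hα.ne', Real.rpow_one]
  refine ⟨s ^ (2 / α), (1 - s ^ 2) ^ (1 / α), Real.rpow_pos_of_pos hs _,
    Real.rpow_pos_of_pos h1 _, ?_, ha, ?_⟩
  · rw [hb, ← rpow_half_sq (Real.rpow_nonneg hs.le _), ha]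
    ring
  · have h2 := rpow_half_sq (α := α) (Real.rpow_nonneg h1.le (1 / α))
    rw [hb] at h2
    have h3 : 0 ≤ ((1 - s ^ 2) ^ (1 / α)) ^ (α / 2) := by positivity
    nlinarith

/-- Converts a hop in `x^(α/2)` into a gap of the dual coordinate `x^(α-1) = (x^(α/2))^(2-2/α)`.
This concave power has derivative `(2-2/α) s^(1-2/α)`, and `s ≤ 2√M` makes the negative power of `s`
at least half the inverse of the weight. -/
theorem half_mul_sub_le_rpow_sub_mul {α r s M : ℝ} (hα₁ : 1 < α) (hα₂ : α < 2) (hr : 0 ≤ r)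
    (hrs : r ≤ s) (hs : 0 < s) (hM : 0 ≤ M) (hsM : s ≤ 2 * Real.sqrt M) :
    (2 - 2 / α) / 2 * (s - r)
      ≤ (s ^ (2 - 2 / α) - r ^ (2 - 2 / α)) * M ^ (1 / α - 1 / 2) := by
  have hα : 0 < α := by linarith
  have hβ0 : 0 ≤ 2 - 2 / α := by
    rw [sub_nonneg, div_le_iff₀ hα]; linarith
  have hβ1 : 2 - 2 / α ≤ 1 := by
    have : 1 ≤ 2 / α := by rw [le_div_iff₀ hα]; linarith
    linarith
  have h1 := mul_rpow_le_rpow_sub_rpow hβ0 hβ1 hr hs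
  have e : s ^ (2 - 2 / α - 1) * s ^ (2 / α - 1) = 1 := by
    rw [← Real.rpow_add hs]; ring_nf; exact Real.rpow_zero s
  have h2 : s ^ (2 / α - 1) ≤ 2 * M ^ (1 / α - 1 / 2) := by
    have h3 : s ^ (2 / α - 1) ≤ (2 * Real.sqrt M) ^ (2 / α - 1) :=
      Real.rpow_le_rpow hs.le hsM (by linarith)
    rw [Real.mul_rpow (by norm_num) (Real.sqrt_nonneg M), Real.sqrt_eq_rpow, ← Real.rpow_mul hM]
      at h3
    have h4 : (2 : ℝ) ^ (2 / α - 1) ≤ 2 := by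
      have h5 : 2 / α ≤ 2 := by rw [div_le_iff₀ hα]; linarith
      have := Real.rpow_le_rpow_of_exponent_le (x := 2) (by norm_num)
        (by linarith : 2 / α - 1 ≤ 1)
      rwa [Real.rpow_one] at this
    have e2 : 1 / 2 * (2 / α - 1) = 1 / α - 1 / 2 := by ring
    rw [e2] at h3
    exact h3.trans (mul_le_mul_of_nonneg_right h4 (Real.rpow_nonneg hM _))
  set W := M ^ (1 / α - 1 / 2)
  have hW : 0 ≤ W := Real.rpow_nonneg hM _
  have hs1 : 0 ≤ s ^ (2 - 2 / α - 1) := Real.rpow_nonneg hs.le _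
  have h3 : 1 / 2 ≤ s ^ (2 - 2 / α - 1) * W := by
    have := mul_le_mul_of_nonneg_left h2 hs1
    rw [e] at this
    linarith
  have h4 := mul_le_mul_of_nonneg_right h1 hW
  refine le_trans ?_ h4
  have h5 : 0 ≤ (2 - 2 / α) * (s - r) := mul_nonneg hβ0 (sub_nonneg.2 hrs)
  have h6 := mul_le_mul_of_nonneg_left h3 h5
  linarith

namespace OnArc

variable {α x y : ℝ}

/-- A boundary point at distance of order `√δ` (in the variable `x ^ (α / 2)`) to the right. -/
theorem exists_right_point (h : OnArc α x y) {δ : ℝ} (hδ : 0 < δ) (hδ1 : δ ≤ 1) :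
    ∃ a b : ℝ, 0 < a ∧ 0 < b ∧ a ^ α + b ^ α = 1 ∧ x ≤ a ∧ b ≤ y ∧
      1 - (a ^ (α - 1) * x + b ^ (α - 1) * y) ≤ 11 * δ ∧
      (2 - 2 / α) / 20 * Real.sqrt δ
        ≤ (a ^ (α - 1) - x ^ (α - 1)) * (max δ (x ^ α)) ^ (1 / α - 1 / 2) ∧
      (x ^ α ≤ δ → a ^ α ≤ 3 / 2 * δ) := by
  have hα₁ := h.one_lt
  have hα₂ := h.lt_two
  have hα : 0 < α := by linarith
  have hx0 : 0 ≤ x ^ (α / 2) := Real.rpow_nonneg h.nonneg _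
  have sx := rpow_half_sq (α := α) h.nonneg
  have hd0 : 0 < Real.sqrt δ := Real.sqrt_pos.2 hδ
  have hd2 := Real.sq_sqrt hδ.le
  have hd1 : Real.sqrt δ ≤ 1 := Real.sqrt_le_one.2 hδ1
  have hMx : x ^ (α / 2) ≤ Real.sqrt (max δ (x ^ α)) := by
    refine Real.le_sqrt_of_sq_le ?_
    rw [sx]
    exact le_max_right _ _
  have hMδ : Real.sqrt δ ≤ Real.sqrt (max δ (x ^ α)) := Real.sqrt_le_sqrt (le_max_left _ _)
  have hxh := h.rpow_le_half
  set ξ := x ^ (α / 2) with hξ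
  set d := Real.sqrt δ with hd
  have hξ1 : ξ ≤ 3 / 4 := by
    by_contra hc
    nlinarith only [not_le.1 hc, sx, hxh]
  -- A hop of `√δ/10` keeps the square of the coordinate below `3/4` and makes the defect at most
  -- `1088 δ/100 ≤ 11 δ`.
  obtain ⟨a, b, ha, hb, hab, hs, hb2⟩ := exists_curve_point hα
    (s := ξ + d / 10) (by linarith) (by nlinarith only [hξ1, hx0, hd0, hd1, sx, hxh])
  have sa := rpow_half_sq (α := α) ha.le
  rw [hs] at sa
  have hxa : x ≤ a := by
    rw [← Real.rpow_le_rpow_iff h.nonneg ha.le hα, ← sx, ← sa]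
    gcongr
    linarith
  refine ⟨a, b, ha, hb, hab, hxa, ?_, ?_, ?_, ?_⟩
  · rw [← Real.rpow_le_rpow_iff hb.le h.nonneg_right hα]
    have := Real.rpow_le_rpow h.nonneg hxa hα.le
    linarith [h.eq_one]
  · have h1 := h.one_sub_pairing_le ha hb hab (η := d / 10) (by rw [hs, ← hξ]; linarith) hb2
      (by rw [hs, ← hξ, abs_le]; constructor <;> linarith)
    refine h1.trans ?_
    rw [div_pow, hd2]
    linarith
  · have h1 := half_mul_sub_le_rpow_sub_mul (M := max δ (x ^ α)) hα₁ hα₂ hx0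
      (by linarith : ξ ≤ ξ + d / 10) (by linarith) (hδ.le.trans (le_max_left _ _)) (by linarith)
    rw [← hs, rpow_half_rpow hα ha.le, hs, hξ, rpow_half_rpow hα h.nonneg, ← hξ] at h1
    refine le_trans (le_of_eq ?_) h1
    ring
  · intro hxδ
    rw [← sa]
    have : ξ ≤ d := Real.le_sqrt_of_sq_le (by rw [sx]; exact hxδ)
    nlinarith only [this, hx0, hd0, hd2]

/-- The supporting functional at the point to the right of `(x, y)`. It is almost extremal at `(x,
y)`, yet transversal to the functional there: since `b ≤ y` and `y^(α-1) ≥ 1/2`, the determinant is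
at least half the gap `a^(α-1) - x^(α-1)`. -/
theorem exists_functional_right (h : OnArc α x y) {δ : ℝ} (hδ : 0 < δ) (hδ1 : δ ≤ 1) :
    ∃ c₀ c₁ : ℝ, (∀ z w : ℝ, |z| ^ α + |w| ^ α ≤ 1 → |c₀ * z + c₁ * w| ≤ 1) ∧
      |c₀| ≤ 1 ∧ |c₁| ≤ 1 ∧ 1 - (c₀ * x + c₁ * y) ≤ 14 * δ ∧
      (2 - 2 / α) / 40 * Real.sqrt δ
        ≤ (c₀ * y ^ (α - 1) - c₁ * x ^ (α - 1)) * (max δ (x ^ α)) ^ (1 / α - 1 / 2) := by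
  have hα₁ := h.one_lt
  obtain ⟨a, b, ha, hb, hab, hxa, hby, hd, hgap, -⟩ := h.exists_right_point hδ hδ1
  have ha0 : 0 ≤ a ^ (α - 1) := Real.rpow_nonneg ha.le _
  have hb0 : 0 ≤ b ^ (α - 1) := Real.rpow_nonneg hb.le _
  have hx0 : 0 ≤ x ^ (α - 1) := Real.rpow_nonneg h.nonneg _
  have hb1 : b ^ (α - 1) ≤ y ^ (α - 1) := Real.rpow_le_rpow hb.le hby (by linarith)
  have hxa1 : x ^ (α - 1) ≤ a ^ (α - 1) := Real.rpow_le_rpow h.nonneg hxa (by linarith)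
  have ha1 : a ≤ 1 := by
    by_contra hc
    have := Real.one_lt_rpow (not_le.1 hc) (by linarith : 0 < α)
    linarith [Real.rpow_nonneg hb.le α]
  refine ⟨a ^ (α - 1), b ^ (α - 1), fun z w hzw => abs_dual_pairing_le_one hα₁ ha.le hb.le hab
    (abs_of_nonneg ha0) (abs_of_nonneg hb0) hzw, ?_, ?_, by linarith, ?_⟩
  · rw [abs_of_nonneg ha0]
    exact Real.rpow_le_one ha.le ha1 (by linarith)
  · rw [abs_of_nonneg hb0]
    exact hb1.trans h.rpow_sub_one_le_right
  · have hW : 0 ≤ (max δ (x ^ α)) ^ (1 / α - 1 / 2) :=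
      Real.rpow_nonneg (hδ.le.trans (le_max_left _ _)) _
    have h1 : (a ^ (α - 1) - x ^ (α - 1)) * (1 / 2)
        ≤ a ^ (α - 1) * y ^ (α - 1) - b ^ (α - 1) * x ^ (α - 1) := by
      nlinarith only [h.half_le_rpow_sub_one, hxa1, hb1, hx0]
    have h2 := mul_le_mul_of_nonneg_right h1 hW
    linarith

/-- The same with the opposite sign of the determinant, so that moves in both tangential directions
can be controlled. -/
theorem exists_functional_left (h : OnArc α x y) {δ : ℝ} (hδ : 0 < δ) (hδ1 : δ ≤ 1) :
    ∃ c₀ c₁ : ℝ, (∀ z w : ℝ, |z| ^ α + |w| ^ α ≤ 1 → |c₀ * z + c₁ * w| ≤ 1) ∧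
      |c₀| ≤ 1 ∧ |c₁| ≤ 1 ∧ 1 - (c₀ * x + c₁ * y) ≤ 14 * δ ∧
      (2 - 2 / α) / 40 * Real.sqrt δ
        ≤ (c₁ * x ^ (α - 1) - c₀ * y ^ (α - 1)) * (max δ (x ^ α)) ^ (1 / α - 1 / 2) := by
  have hα₁ := h.one_lt
  have hα₂ := h.lt_two
  have hα : 0 < α := by linarith
  have hx0 : 0 ≤ x ^ (α - 1) := Real.rpow_nonneg h.nonneg _
  have hW : 0 ≤ (max δ (x ^ α)) ^ (1 / α - 1 / 2) :=
    Real.rpow_nonneg (hδ.le.trans (le_max_left _ _)) _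
  -- Close to the axis a hop to the left might cross it, so the functional of the right-hand point
  -- is reflected in the axis instead.
  rcases le_or_gt (x ^ α) δ with hxδ | hxδ
  · obtain ⟨a, b, ha, hb, hab, hxa, hby, hd, hgap, haδ⟩ := h.exists_right_point hδ hδ1
    have ha0 : 0 ≤ a ^ (α - 1) := Real.rpow_nonneg ha.le _
    have hb0 : 0 ≤ b ^ (α - 1) := Real.rpow_nonneg hb.le _
    have hb1 : b ^ (α - 1) ≤ y ^ (α - 1) := Real.rpow_le_rpow hb.le hby (by linarith)
    have ha1 : a ≤ 1 := by
      by_contra hc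
      have := Real.one_lt_rpow (not_le.1 hc) hα
      linarith [Real.rpow_nonneg hb.le α]
    refine ⟨-a ^ (α - 1), b ^ (α - 1), fun z w hzw => abs_dual_pairing_le_one hα₁ ha.le hb.le hab
      (by rw [abs_neg, abs_of_nonneg ha0]) (abs_of_nonneg hb0) hzw, ?_, ?_, ?_, ?_⟩
    · rw [abs_neg, abs_of_nonneg ha0]
      exact Real.rpow_le_one ha.le ha1 (by linarith)
    · rw [abs_of_nonneg hb0]
      exact hb1.trans h.rpow_sub_one_le_right
    -- Reflection raises the defect by `2 a^(α-1) x ≤ 2 a^α ≤ 3δ`, hence the total `14 δ`.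
    · have h1 := mul_le_mul_of_nonneg_left hxa ha0
      rw [rpow_sub_one_mul_self ha.le hα] at h1
      have := haδ hxδ
      linarith
    · have h1 : (a ^ (α - 1) - x ^ (α - 1)) * (1 / 2)
          ≤ b ^ (α - 1) * x ^ (α - 1) - -a ^ (α - 1) * y ^ (α - 1) := by
        nlinarith only [h.half_le_rpow_sub_one, ha0, hb0, hx0]
      have h2 := mul_le_mul_of_nonneg_right h1 hW
      linarith
  · have sx := rpow_half_sq (α := α) h.nonneg
    have hd2 := Real.sq_sqrt hδ.le
    have hd0 : 0 < Real.sqrt δ := Real.sqrt_pos.2 hδ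
    have hdξ : Real.sqrt δ < x ^ (α / 2) := by
      rw [Real.sqrt_lt' (lt_of_le_of_ne (Real.rpow_nonneg h.nonneg _) ?_), sx]
      · exact hxδ
      · intro h0
        rw [← h0] at sx
        norm_num at sx
        linarith
    have hMx : x ^ (α / 2) ≤ Real.sqrt (max δ (x ^ α)) := by
      refine Real.le_sqrt_of_sq_le ?_
      rw [sx]
      exact le_max_right _ _
    have hxh := h.rpow_le_half
    set ξ := x ^ (α / 2) with hξ
    set d := Real.sqrt δ with hd
    obtain ⟨a, b, ha, hb, hab, hs, hb2⟩ := exists_curve_point hα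
      (s := ξ - d / 10) (by linarith) (by nlinarith only [hdξ, hd0, sx, hxh])
    have sa := rpow_half_sq (α := α) ha.le
    rw [hs] at sa
    have ha0 : 0 ≤ a ^ (α - 1) := Real.rpow_nonneg ha.le _
    have hb0 : 0 ≤ b ^ (α - 1) := Real.rpow_nonneg hb.le _
    have hax : a ≤ x := by
      rw [← Real.rpow_le_rpow_iff ha.le h.nonneg hα, ← sx, ← sa]
      gcongr <;> linarith
    have hyb : y ≤ b := by
      rw [← Real.rpow_le_rpow_iff h.nonneg_right hb.le hα]
      have := Real.rpow_le_rpow ha.le hax hα.le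
      linarith [h.eq_one]
    have hb1 : y ^ (α - 1) ≤ b ^ (α - 1) :=
      Real.rpow_le_rpow h.nonneg_right hyb (by linarith)
    have hax1 : a ^ (α - 1) ≤ x ^ (α - 1) := Real.rpow_le_rpow ha.le hax (by linarith)
    have hb1' : b ≤ 1 := by
      by_contra hc
      have := Real.one_lt_rpow (not_le.1 hc) hα
      linarith [Real.rpow_nonneg ha.le α]
    refine ⟨a ^ (α - 1), b ^ (α - 1), fun z w hzw => abs_dual_pairing_le_one hα₁ ha.le hb.le hab
      (abs_of_nonneg ha0) (abs_of_nonneg hb0) hzw, ?_, ?_, ?_, ?_⟩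
    · rw [abs_of_nonneg ha0]
      exact hax1.trans h.rpow_sub_one_le
    · rw [abs_of_nonneg hb0]
      exact Real.rpow_le_one hb.le hb1' (by linarith)
    · have h1 := h.one_sub_pairing_le ha hb hab (η := d / 10) (by rw [hs, ← hξ]; linarith) hb2
        (by rw [hs, ← hξ, abs_le]; constructor <;> linarith)
      refine h1.trans ?_
      rw [div_pow, hd2]
      linarith
    · have h1 := half_mul_sub_le_rpow_sub_mul (r := ξ - d / 10) (s := ξ) (M := max δ (x ^ α))
        hα₁ hα₂ (by linarith) (by linarith) (by linarith) (hδ.le.trans (le_max_left _ _))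
        (by linarith)
      rw [← hs, rpow_half_rpow hα ha.le, hs, hξ, rpow_half_rpow hα h.nonneg, ← hξ] at h1
      have h2 : (x ^ (α - 1) - a ^ (α - 1)) * (1 / 2)
          ≤ b ^ (α - 1) * x ^ (α - 1) - a ^ (α - 1) * y ^ (α - 1) := by
        nlinarith only [h.half_le_rpow_sub_one, hax1, hb1, hx0]
      have h3 := mul_le_mul_of_nonneg_right h2 hW
      linarith

end OnArc

/-! ### Topology, normals and sections of `B_α`. -/

theorem mem_lpBall {α : ℝ} {z : EuclideanSpace ℝ (Fin 2)} :
    z ∈ lpBall α ↔ |z 0| ^ α + |z 1| ^ α ≤ 1 := Iff.rfl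

theorem continuous_abs_rpow_add {α : ℝ} (hα : 0 < α) :
    Continuous fun z : EuclideanSpace ℝ (Fin 2) => |z 0| ^ α + |z 1| ^ α :=
  ((by fun_prop : Continuous fun z : EuclideanSpace ℝ (Fin 2) => |z 0|).rpow_const
    fun _ => Or.inr hα.le).add
  ((by fun_prop : Continuous fun z : EuclideanSpace ℝ (Fin 2) => |z 1|).rpow_const
    fun _ => Or.inr hα.le)

theorem isClosed_lpBall {α : ℝ} (hα : 0 < α) : IsClosed (lpBall α) :=
  isClosed_le (continuous_abs_rpow_add hα) continuous_const

theorem isCompact_lpBall {α : ℝ} (hα : 0 < α) : IsCompact (lpBall α) := by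
  refine Metric.isCompact_of_isClosed_isBounded (isClosed_lpBall hα) ?_
  refine (Metric.isBounded_closedBall (x := (0 : EuclideanSpace ℝ (Fin 2))) (r := 2)).subset ?_
  intro z hz
  have key : ∀ r : ℝ, |r| ^ α ≤ 1 → r ^ 2 ≤ 1 := by
    intro r hr
    rw [← sq_abs]
    refine pow_le_one₀ (abs_nonneg r) ?_
    by_contra hc
    linarith [Real.one_lt_rpow (not_le.1 hc) hα]
  rw [mem_lpBall] at hz
  have h0 := key (z 0) (by linarith [Real.rpow_nonneg (abs_nonneg (z 1)) α])
  have h1 := key (z 1) (by linarith [Real.rpow_nonneg (abs_nonneg (z 0)) α])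
  rw [mem_closedBall_zero_iff, EuclideanSpace.norm_eq, Fin.sum_univ_two]
  refine Real.sqrt_le_iff.2 ⟨by norm_num, ?_⟩
  simp only [Real.norm_eq_abs, sq_abs]
  linarith

theorem interior_lpBall_nonempty {α : ℝ} (hα : 0 < α) : (interior (lpBall α)).Nonempty := by
  refine ⟨0, mem_interior.2 ⟨{z | |z 0| ^ α + |z 1| ^ α < 1}, fun z hz => mem_lpBall.2 (le_of_lt hz),
    isOpen_lt (continuous_abs_rpow_add hα) continuous_const, ?_⟩⟩
  simp [Real.zero_rpow hα.ne']

theorem onArc_of_mem_frontier {α : ℝ} (hα₁ : 1 < α) (hα₂ : α < 2)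
    {p : EuclideanSpace ℝ (Fin 2)} (hp : p ∈ frontier (lpBall α)) (h0 : 0 ≤ p 0)
    (h1 : p 0 ≤ p 1) : OnArc α (p 0) (p 1) := by
  have hα : 0 < α := by linarith
  rw [(isClosed_lpBall hα).frontier_eq] at hp
  refine ⟨hα₁, hα₂, h0, h1, ?_⟩
  have h2 := hp.1
  rw [mem_lpBall, abs_of_nonneg h0, abs_of_nonneg (h0.trans h1)] at h2
  refine le_antisymm h2 (not_lt.1 fun hc => hp.2 ?_)
  refine mem_interior.2 ⟨{z | |z 0| ^ α + |z 1| ^ α < 1}, fun z hz => mem_lpBall.2 (le_of_lt hz),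
    isOpen_lt (continuous_abs_rpow_add hα) continuous_const, ?_⟩
  simpa [abs_of_nonneg h0, abs_of_nonneg (h0.trans h1)] using hc

theorem inner_fin_two (u v : EuclideanSpace ℝ (Fin 2)) :
    inner ℝ u v = u 0 * v 0 + u 1 * v 1 := by
  simp [PiLp.inner_apply, Fin.sum_univ_two, mul_comm]

theorem norm_sq_fin_two (u : EuclideanSpace ℝ (Fin 2)) : ‖u‖ ^ 2 = u 0 ^ 2 + u 1 ^ 2 := by
  simp [EuclideanSpace.norm_sq_eq, Fin.sum_univ_two]

namespace OnArc

variable {α x y : ℝ}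

/-- A direction that strictly decreases the supporting functional enters `B_α`: the loss is linear
in the step, while the remainder is of order `t^α` with `α > 1`. -/
theorem exists_pos_step (h : OnArc α x y) {w₀ w₁ : ℝ}
    (hw : x ^ (α - 1) * w₀ + y ^ (α - 1) * w₁ < 0) :
    ∃ t : ℝ, 0 < t ∧ |x + t * w₀| ^ α + |y + t * w₁| ^ α ≤ 1 := by
  have hα₁ := h.one_lt
  have hα₂ := h.lt_two
  have hα : 0 < α := by linarith
  set c := -(α * (x ^ (α - 1) * w₀ + y ^ (α - 1) * w₁)) with hc
  have hc0 : 0 < c := by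
    rw [hc, neg_pos]; exact mul_neg_of_pos_of_neg hα hw
  set K := 4 * (|w₀| ^ α + |w₁| ^ α) with hK
  have hK0 : 0 ≤ K := by positivity
  set t := (c / (K + 1)) ^ (1 / (α - 1)) with ht
  have hcK : 0 < c / (K + 1) := by positivity
  have ht0 : 0 < t := Real.rpow_pos_of_pos hcK _
  have htα : t ^ (α - 1) = c / (K + 1) := by
    rw [ht, ← Real.rpow_mul hcK.le, one_div_mul_cancel (by linarith), Real.rpow_one]
  have htα' : t ^ α = c / (K + 1) * t := by
    rw [← htα, rpow_sub_one_mul_self ht0.le hα]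
  refine ⟨t, ht0, ?_⟩
  have h1 := abs_rpow_le_tangent_add_rpow hα₁ hα₂ h.nonneg (t * w₀)
  have h2 := abs_rpow_le_tangent_add_rpow hα₁ hα₂ h.nonneg_right (t * w₁)
  rw [abs_mul, abs_of_pos ht0, Real.mul_rpow ht0.le (abs_nonneg _)] at h1 h2
  have h3 : K * t ^ α ≤ c * t := by
    rw [htα', ← mul_assoc]
    refine mul_le_mul_of_nonneg_right ?_ ht0.le
    rw [mul_div_assoc', div_le_iff₀ (by linarith)]
    linarith
  have h4 := h.eq_one
  have h5 : 4 * (t ^ α * |w₀| ^ α) + 4 * (t ^ α * |w₁| ^ α) = K * t ^ α := by rw [hK]; ring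
  have h6 : α * x ^ (α - 1) * (t * w₀) + α * y ^ (α - 1) * (t * w₁) = -(c * t) := by rw [hc]; ring
  linarith

/-- Upper bound for the length of sections of `B_α` parallel to a tangent. -/
theorem abs_le_of_section (h : OnArc α x y) {ν u₀ u₁ t X : ℝ} (hν : 0 < ν) (hν2 : ν ≤ 2)
    (hu : u₀ ^ 2 + u₁ ^ 2 = 1) (hx : x ^ (α - 1) = ν * u₀) (hy : y ^ (α - 1) = ν * u₁)
    (ht : 0 < t) (ht1 : t ≤ 1)
    (hX : |x - t * u₀ + X * u₁| ^ α + |y - t * u₁ - X * u₀| ^ α ≤ 1) :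
    (2 - 2 / α) / 40 * |X| ≤ 32 * (Real.sqrt t * (max t (x ^ α)) ^ (1 / α - 1 / 2)) := by
  have hu0 : |u₀| ≤ 1 := abs_le_one_iff_mul_self_le_one.2 (by nlinarith)
  have hu1 : |u₁| ≤ 1 := abs_le_one_iff_mul_self_le_one.2 (by nlinarith)
  have hst := Real.sqrt_pos.2 ht
  have hst2 := Real.mul_self_sqrt ht.le
  have hW : 0 ≤ (max t (x ^ α)) ^ (1 / α - 1 / 2) :=
    Real.rpow_nonneg (ht.le.trans (le_max_left _ _)) _
  set W := (max t (x ^ α)) ^ (1 / α - 1 / 2)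
  have key : ∀ c₀ c₁ g Y : ℝ, (∀ z w : ℝ, |z| ^ α + |w| ^ α ≤ 1 → |c₀ * z + c₁ * w| ≤ 1) →
      |c₀| ≤ 1 → |c₁| ≤ 1 → 1 - (c₀ * x + c₁ * y) ≤ 14 * t → 0 ≤ Y →
      Y * g = ν * (X * (c₀ * u₁ - c₁ * u₀)) → (2 - 2 / α) / 40 * Real.sqrt t ≤ g * W →
      (2 - 2 / α) / 40 * Y ≤ 32 * (Real.sqrt t * W) := by
    intro c₀ c₁ g Y hc h0 h1 hd hY hg hgW
    have e1 := (abs_le.1 (hc _ _ hX)).2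
    have e2 : ∀ a b : ℝ, |a| ≤ 1 → |b| ≤ 1 → a * b ≤ 1 := by
      intro a b ha hb
      refine (le_abs_self _).trans ?_
      rw [abs_mul]
      exact mul_le_one₀ ha (abs_nonneg b) hb
    have e3 := e2 c₀ u₀ h0 hu0
    have e4 := e2 c₁ u₁ h1 hu1
    -- The functional is at most `1` on the section: `14 t` is its defect at `(x, y)` and `2 t` the
    -- change along the normal.
    have e5 : X * (c₀ * u₁ - c₁ * u₀) ≤ 16 * t := by nlinarith only [e1, e3, e4, hd, ht]
    have e6 : Y * g ≤ 32 * t := by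
      rw [hg]
      nlinarith only [mul_le_mul_of_nonneg_left e5 hν.le, hν2, ht]
    have e7 := mul_le_mul_of_nonneg_left hgW hY
    have e8 := mul_le_mul_of_nonneg_right e6 hW
    have e9 : ((2 - 2 / α) / 40 * Y) * Real.sqrt t ≤ 32 * (Real.sqrt t * W) * Real.sqrt t := by
      calc _ = Y * ((2 - 2 / α) / 40 * Real.sqrt t) := by ring
        _ ≤ Y * (g * W) := e7
        _ = Y * g * W := by ring
        _ ≤ 32 * t * W := e8
        _ = _ := by linear_combination (-32 * W) * hst2
    exact le_of_mul_le_mul_right e9 hst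
  rcases le_total 0 X with hX0 | hX0
  · obtain ⟨c₀, c₁, hc, h0, h1, hd, hg⟩ := h.exists_functional_right ht ht1
    rw [abs_of_nonneg hX0]
    exact key c₀ c₁ _ X hc h0 h1 hd hX0 (by rw [hx, hy]; ring) hg
  · obtain ⟨c₀, c₁, hc, h0, h1, hd, hg⟩ := h.exists_functional_left ht ht1
    rw [abs_of_nonpos hX0]
    exact key c₀ c₁ _ (-X) hc h0 h1 hd (neg_nonneg.2 hX0) (by rw [hx, hy]; ring) hg

end OnArc

/-- The normal cone at a boundary point is a single ray. Every direction strictly below the tangent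
line enters the body, so a supporting vector `u` is nonpositive on it; testing the part of `u`
orthogonal to `(u₀, u₁)`, pushed inwards by `η`, forces that part to vanish as `η → 0`. -/
theorem IsOutwardUnitNormal.coords {α ν u₀ u₁ : ℝ} {p u : EuclideanSpace ℝ (Fin 2)}
    (h : OnArc α (p 0) (p 1)) (hν : 0 < ν) (hu : u₀ ^ 2 + u₁ ^ 2 = 1)
    (hx : p 0 ^ (α - 1) = ν * u₀) (hy : p 1 ^ (α - 1) = ν * u₁)
    (hn : IsOutwardUnitNormal (lpBall α) p u) : u 0 = u₀ ∧ u 1 = u₁ := by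
  obtain ⟨-, hnorm, hle⟩ := hn
  have hnorm2 : u 0 ^ 2 + u 1 ^ 2 = 1 := by rw [← norm_sq_fin_two, hnorm, one_pow]
  have key : ∀ w₀ w₁ : ℝ, u₀ * w₀ + u₁ * w₁ < 0 → u 0 * w₀ + u 1 * w₁ ≤ 0 := by
    intro w₀ w₁ hw
    obtain ⟨t, ht, hmem⟩ := h.exists_pos_step (w₀ := w₀) (w₁ := w₁)
      (by rw [hx, hy]; nlinarith only [hw, hν])
    have h1 := hle (!₂[p 0 + t * w₀, p 1 + t * w₁]) (by simpa [mem_lpBall] using hmem)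
    rw [inner_fin_two] at h1
    simp only [PiLp.sub_apply, Matrix.cons_val_zero, Matrix.cons_val_one,
      add_sub_cancel_left] at h1
    have h2 : t * (u 0 * w₀ + u 1 * w₁) ≤ 0 := by linarith
    exact nonpos_of_mul_nonpos_right h2 ht
  set d := u₀ * u 0 + u₁ * u 1 with hd
  have hd0 : 0 ≤ d := by
    have := key (-u₀) (-u₁) (by nlinarith)
    linarith
  have hd1 : 1 ≤ d ^ 2 := by
    refine le_of_forall_pos_le_add fun η hη => ?_
    have h1 := key (u 0 - d * u₀ - η * u₀) (u 1 - d * u₁ - η * u₁) (by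
      have : u₀ * (u 0 - d * u₀ - η * u₀) + u₁ * (u 1 - d * u₁ - η * u₁) = -η := by
        linear_combination (-d - η) * hu
      linarith)
    have h2 : u 0 * (u 0 - d * u₀ - η * u₀) + u 1 * (u 1 - d * u₁ - η * u₁)
        = 1 - d ^ 2 - η * d := by
      linear_combination hnorm2 + (d + η) * hd
    have h3 : d ≤ 1 := by nlinarith [sq_nonneg (u₀ - u 0), sq_nonneg (u₁ - u 1)]
    nlinarith
  have hd2 : 1 ≤ d := by nlinarith
  have h4 : (u 0 - u₀) ^ 2 + (u 1 - u₁) ^ 2 ≤ 0 := by nlinarith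
  constructor <;> nlinarith [sq_nonneg (u 0 - u₀), sq_nonneg (u 1 - u₁)]

/-- Connectedness: a ball that meets the interior and misses the frontier lies in the interior. -/
theorem ball_subset_of_dist_le_frontier {D : Set (EuclideanSpace ℝ (Fin 2))} (hD : IsClosed D)
    {x : EuclideanSpace ℝ (Fin 2)} {δ : ℝ} (hδ : 0 < δ) (hx : x ∈ D \ frontier D)
    (hq : ∀ q ∈ frontier D, δ ≤ dist x q) : Metric.ball x δ ⊆ D := by
  have hint : x ∈ interior D := by
    by_contra hc
    exact hx.2 (by rw [hD.frontier_eq]; exact ⟨hx.1, hc⟩)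
  refine Set.Subset.trans ?_ (interior_subset (s := D))
  have hconn : IsPreconnected (Metric.ball x δ) := (convex_ball x δ).isPreconnected
  refine hconn.subset_left_of_subset_union isOpen_interior hD.isOpen_compl ?_ ?_
    ⟨x, Metric.mem_ball_self hδ, hint⟩
  · exact Set.disjoint_left.2 fun z hz hz' => hz' (interior_subset hz)
  · intro z hz
    by_cases hzi : z ∈ interior D
    · exact Or.inl hzi
    · refine Or.inr fun hzD => ?_
      have := hq z (by rw [hD.frontier_eq]; exact ⟨hzD, hzi⟩)
      rw [Metric.mem_ball, dist_comm] at hz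
      linarith

/-- A point whose nearest boundary point is `p` lies on the normal through `p`. -/
theorem coords_of_nearest {α ν u₀ u₁ δ : ℝ} {p x : EuclideanSpace ℝ (Fin 2)}
    (h : OnArc α (p 0) (p 1)) (hν : 0 < ν) (hu : u₀ ^ 2 + u₁ ^ 2 = 1)
    (hx : p 0 ^ (α - 1) = ν * u₀) (hy : p 1 ^ (α - 1) = ν * u₁) (hδ : 0 < δ)
    (hδx : δ = dist x p) (hball : Metric.ball x δ ⊆ lpBall α) :
    x 0 = p 0 - δ * u₀ ∧ x 1 = p 1 - δ * u₁ := by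
  have hα₁ := h.one_lt
  have hself := h.pairing_self
  rw [hx, hy] at hself
  -- Moving `x` outwards along the normal by less than `δ` stays in the body, hence below the
  -- supporting line at `p`. In the limit the normal component of `p - x` is at least its length
  -- `δ`, the equality case of Cauchy–Schwarz.
  have h1 : ∀ s : ℝ, s < δ → u₀ * x 0 + u₁ * x 1 + s ≤ u₀ * p 0 + u₁ * p 1 := by
    intro s hs
    rcases le_or_gt s 0 with hs0 | hs0
    · have hm : x ∈ lpBall α := hball (Metric.mem_ball_self hδ)
      have := (abs_le.1 (abs_dual_pairing_le_one hα₁ h.nonneg h.nonneg_right h.eq_one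
        (abs_of_nonneg (Real.rpow_nonneg h.nonneg _))
        (abs_of_nonneg (Real.rpow_nonneg h.nonneg_right _)) hm)).2
      rw [hx, hy] at this
      have h2 : ν * (u₀ * x 0 + u₁ * x 1) ≤ ν * (u₀ * p 0 + u₁ * p 1) := by linarith
      have := le_of_mul_le_mul_left h2 hν
      linarith
    · have hm : (!₂[x 0 + s * u₀, x 1 + s * u₁] : EuclideanSpace ℝ (Fin 2)) ∈ lpBall α := by
        refine hball ?_
        rw [Metric.mem_ball, dist_eq_norm]
        refine lt_of_le_of_lt (b := s) ?_ hs
        refine abs_le_of_sq_le_sq' ?_ hs0.le |>.2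
        rw [norm_sq_fin_two]
        simp only [PiLp.sub_apply, Matrix.cons_val_zero, Matrix.cons_val_one, add_sub_cancel_left]
        nlinarith
      have := (abs_le.1 (abs_dual_pairing_le_one hα₁ h.nonneg h.nonneg_right h.eq_one
        (abs_of_nonneg (Real.rpow_nonneg h.nonneg _))
        (abs_of_nonneg (Real.rpow_nonneg h.nonneg_right _)) hm)).2
      rw [hx, hy] at this
      simp only [Matrix.cons_val_zero, Matrix.cons_val_one] at this
      have h2 : ν * (u₀ * x 0 + u₁ * x 1 + s) ≤ ν * (u₀ * p 0 + u₁ * p 1) := by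
        linear_combination this - ν * s * hu - hself
      exact le_of_mul_le_mul_left h2 hν
  have h2 : u₀ * x 0 + u₁ * x 1 + δ ≤ u₀ * p 0 + u₁ * p 1 := by
    have : δ ≤ u₀ * p 0 + u₁ * p 1 - (u₀ * x 0 + u₁ * x 1) :=
      le_of_forall_lt_imp_le_of_dense fun s hs => by linarith [h1 s hs]
    linarith
  have h3 : (x 0 - p 0) ^ 2 + (x 1 - p 1) ^ 2 = δ ^ 2 := by
    rw [hδx, dist_eq_norm, norm_sq_fin_two]
    simp
  have h4 : (x 0 - p 0 + δ * u₀) ^ 2 + (x 1 - p 1 + δ * u₁) ^ 2 ≤ 0 := by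
    have e : (x 0 - p 0 + δ * u₀) ^ 2 + (x 1 - p 1 + δ * u₁) ^ 2
        = 2 * δ * (δ + (u₀ * x 0 + u₁ * x 1) - (u₀ * p 0 + u₁ * p 1)) := by
      linear_combination h3 + δ ^ 2 * hu
    rw [e]
    exact mul_nonpos_of_nonneg_of_nonpos (by linarith) (by linarith)
  constructor
  · nlinarith only [h4, sq_nonneg (x 0 - p 0 + δ * u₀), sq_nonneg (x 1 - p 1 + δ * u₁)]
  · nlinarith only [h4, sq_nonneg (x 0 - p 0 + δ * u₀), sq_nonneg (x 1 - p 1 + δ * u₁)]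

theorem sq_rpow_weight {α M : ℝ} (hM : 0 ≤ M) :
    (M ^ (1 / α - 1 / 2)) ^ 2 = M ^ (2 / α - 1) := by
  rw [← Real.rpow_natCast, ← Real.rpow_mul hM]
  congr 1
  push_cast
  ring

/-- As `v` is a unit vector, `s` is recovered from the point of `D` by an inner product, so the
section lies in a continuous image of `D`; its supremum is attained once it is nonempty. -/
theorem isCompact_sectionSet {D : Set (EuclideanSpace ℝ (Fin 2))} (hD : IsCompact D)
    (p u : EuclideanSpace ℝ (Fin 2)) {v : EuclideanSpace ℝ (Fin 2)} (hv : ‖v‖ = 1) (i : ℕ)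
    (t : ℝ) : IsCompact (sectionSet D p u v i t) := by
  have hclosed : IsClosed (sectionSet D p u v i t) :=
    hD.isClosed.preimage (by fun_prop : Continuous fun s : ℝ =>
      p - t • u + ((-1 : ℝ) ^ i * s) • v)
  have himg : IsCompact ((fun z => (-1 : ℝ) ^ i * inner ℝ v (z - (p - t • u))) '' D) :=
    hD.image (by fun_prop)
  refine himg.of_isClosed_subset hclosed fun s hs => ⟨_, hs, ?_⟩
  have h1 : ((-1 : ℝ) ^ i) * (-1 : ℝ) ^ i = 1 := by
    rw [← mul_pow]; norm_num
  simp only [add_sub_cancel_left, inner_smul_right, real_inner_self_eq_norm_sq, hv]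
  linear_combination s * h1

/-- Coordinates of a unit vector orthogonal to a given unit vector in the plane. -/
theorem exists_sign_of_orthogonal {u v : EuclideanSpace ℝ (Fin 2)} (hu : ‖u‖ = 1) (hv : ‖v‖ = 1)
    (huv : inner ℝ u v = 0) : ∃ τ : ℝ, τ ^ 2 = 1 ∧ v 0 = τ * u 1 ∧ v 1 = -(τ * u 0) := by
  have h1 : u 0 ^ 2 + u 1 ^ 2 = 1 := by rw [← norm_sq_fin_two, hu, one_pow]
  have h2 : v 0 ^ 2 + v 1 ^ 2 = 1 := by rw [← norm_sq_fin_two, hv, one_pow]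
  rw [inner_fin_two] at huv
  refine ⟨v 0 * u 1 - v 1 * u 0, ?_, ?_, ?_⟩
  · linear_combination (v 0 ^ 2 + v 1 ^ 2) * h1 + h2 - (u 0 * v 0 + u 1 * v 1) * huv
  · linear_combination u 0 * huv - v 0 * h1
  · linear_combination u 1 * huv - v 1 * h1

theorem rpow_sub_one_le_of_le {α t c : ℝ} (hα₁ : 1 < α) (hc : 0 ≤ c) (ht : 0 < t)
    (htc : t ≤ c ^ (1 / (α - 1))) : t ^ (α - 1) ≤ c := by
  have := Real.rpow_le_rpow ht.le htc (by linarith : 0 ≤ α - 1)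
  rwa [← Real.rpow_mul hc, one_div_mul_cancel (by linarith), Real.rpow_one] at this

theorem rpow_inv_sub_one_le {α c : ℝ} (hα₁ : 1 < α) (hα₂ : α < 2) (hc : 0 < c) (hc1 : c ≤ 1) :
    c ^ (1 / (α - 1)) ≤ c := by
  have := Real.rpow_le_rpow_of_exponent_ge hc hc1
    (by rw [le_div_iff₀ (by linarith)]; linarith : 1 ≤ 1 / (α - 1))
  rwa [Real.rpow_one] at this

/-- Existence and size of the section half-lengths. -/
theorem halfLength_bounds {α : ℝ} {p u v : EuclideanSpace ℝ (Fin 2)} (h : OnArc α (p 0) (p 1))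
    (hn : IsOutwardUnitNormal (lpBall α) p u) (hv : ‖v‖ = 1) (huv : inner ℝ u v = 0) (i : ℕ) :
    (∀ t : ℝ, 0 < t → t < 1 →
      IsGreatest (sectionSet (lpBall α) p u v i t) (halfLength (lpBall α) p u v i t)) ∧
    (∀ t : ℝ, 0 < t → t ≤ (1 / 256) ^ (1 / (α - 1)) →
      1 / 128 * (Real.sqrt t * (max t (p 0 ^ α)) ^ (1 / α - 1 / 2))
        ≤ halfLength (lpBall α) p u v i t ∧
      (2 - 2 / α) / 40 * halfLength (lpBall α) p u v i t
        ≤ 32 * (Real.sqrt t * (max t (p 0 ^ α)) ^ (1 / α - 1 / 2))) := by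
  have hα₁ := h.one_lt
  have hα₂ := h.lt_two
  have hα : 0 < α := by linarith
  obtain ⟨ν, u₀, u₁, hν, hν2, hu, hx, hy⟩ := h.exists_normal
  have hν0 : 0 < ν := by linarith
  obtain ⟨hu0, hu1⟩ := hn.coords h hν0 hu hx hy
  obtain ⟨τ, hτ, hv0, hv1⟩ := exists_sign_of_orthogonal hn.2.1 hv huv
  rw [hu1] at hv0
  rw [hu0] at hv1
  -- All sign choices, of `v` and of `i`, collapse into one sign.
  set κ : ℝ := (-1) ^ i * τ with hκ
  have hκ2 : κ ^ 2 = 1 := by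
    rw [hκ, mul_pow, hτ, ← pow_mul, mul_comm i 2, pow_mul]
    norm_num
  have hmem : ∀ t s : ℝ, s ∈ sectionSet (lpBall α) p u v i t ↔
      |p 0 - t * u₀ + κ * s * u₁| ^ α + |p 1 - t * u₁ - κ * s * u₀| ^ α ≤ 1 := by
    intro t s
    have e : s ∈ sectionSet (lpBall α) p u v i t ↔
      p - t • u + ((-1 : ℝ) ^ i * s) • v ∈ lpBall α := Iff.rfl
    rw [e, mem_lpBall]
    simp only [PiLp.add_apply, PiLp.sub_apply, PiLp.smul_apply, smul_eq_mul, hu0, hu1, hv0, hv1]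
    rw [show (-1 : ℝ) ^ i * s * (τ * u₁) = κ * s * u₁ by rw [hκ]; ring,
      show p 1 - t * u₁ + (-1 : ℝ) ^ i * s * -(τ * u₀) = p 1 - t * u₁ - κ * s * u₀ by
        rw [hκ]; ring]
  have hgreat : ∀ t : ℝ, 0 < t → t < 1 →
      IsGreatest (sectionSet (lpBall α) p u v i t) (halfLength (lpBall α) p u v i t) := by
    intro t ht ht1
    refine (isCompact_sectionSet (isCompact_lpBall hα) p u hv i t).isGreatest_sSup ?_
    -- The point `(1 - tν) p` lies on the chord at depth `t`, because `⟨p, u⟩ = 1/ν`; it is in `B_α`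
    -- since `tν < 2`.
    refine ⟨κ * -(t * ν * (u₁ * p 0 - u₀ * p 1)), (hmem _ _).2 ?_⟩
    have hself := h.pairing_self
    rw [hx, hy] at hself
    have e1 : p 0 - t * u₀ + κ * (κ * -(t * ν * (u₁ * p 0 - u₀ * p 1))) * u₁
        = (1 - t * ν) * p 0 := by
      linear_combination (-(t * ν * (u₁ * p 0 - u₀ * p 1)) * u₁) * hκ2
        - t * ν * p 0 * hu + t * u₀ * hself
    have e2 : p 1 - t * u₁ - κ * (κ * -(t * ν * (u₁ * p 0 - u₀ * p 1))) * u₀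
        = (1 - t * ν) * p 1 := by
      linear_combination ((t * ν * (u₁ * p 0 - u₀ * p 1)) * u₀) * hκ2
        - t * ν * p 1 * hu + t * u₁ * hself
    rw [e1, e2, abs_mul, abs_mul, Real.mul_rpow (abs_nonneg _) (abs_nonneg _),
      Real.mul_rpow (abs_nonneg _) (abs_nonneg _), ← mul_add, abs_of_nonneg h.nonneg,
      abs_of_nonneg h.nonneg_right, h.eq_one, mul_one]
    refine Real.rpow_le_one (abs_nonneg _) ?_ hα.le
    rw [abs_le]
    constructor <;> nlinarith
  refine ⟨hgreat, fun t ht htc => ?_⟩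
  have ht256 := htc.trans (rpow_inv_sub_one_le hα₁ hα₂ (by norm_num) (by norm_num))
  have hG := hgreat t ht (by linarith)
  have hM : 0 ≤ max t (p 0 ^ α) := ht.le.trans (le_max_left _ _)
  constructor
  · refine hG.2 ((hmem _ _).2 ?_)
    -- The endpoint saturates the condition of the neighbourhood lemma, as `16384 = 128²`.
    have := h.abs_rpow_add_abs_rpow_le_one (T := t) (δ := t)
      (X := κ * (1 / 128 * (Real.sqrt t * (max t (p 0 ^ α)) ^ (1 / α - 1 / 2))))
      hν hu hx hy ht (by linarith) ht256
      (rpow_sub_one_le_of_le hα₁ (by norm_num) ht htc) (by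
        rw [mul_pow κ, hκ2, mul_pow, mul_pow, Real.sq_sqrt ht.le, sq_rpow_weight hM]
        refine le_of_eq ?_
        ring)
    convert this using 3
    · ring_nf
    · ring_nf
  · have h1 := h.abs_le_of_section hν0 hν2 hu hx hy ht (by linarith) ((hmem _ _).1 hG.1)
    have h2 : halfLength (lpBall α) p u v i t ≤ |κ * halfLength (lpBall α) p u v i t| := by
      rw [abs_mul, (abs_eq zero_le_one).2 (mul_self_eq_one_iff.1 (pow_two κ ▸ hκ2)), one_mul]
      exact le_abs_self _
    have hk : 0 ≤ (2 - 2 / α) / 40 := by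
      have : 2 / α ≤ 2 := by rw [div_le_iff₀ hα]; linarith
      linarith
    exact (mul_le_mul_of_nonneg_left h2 hk).trans h1

/-! ### Two-sided bounds for the Christoffel function of `B_α`. -/

/-- Upper bound for the Christoffel function of `B_α`. -/
theorem christoffel_lpBall_le {α ν u₀ u₁ σ δ : ℝ} {p x : EuclideanSpace ℝ (Fin 2)}
    (h : OnArc α (p 0) (p 1)) (hν2 : ν ≤ 2) (hu : u₀ ^ 2 + u₁ ^ 2 = 1)
    (hx : p 0 ^ (α - 1) = ν * u₀) (hy : p 1 ^ (α - 1) = ν * u₁) (hxB : x ∈ lpBall α)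
    (hx0 : x 0 = p 0 - δ * u₀) (hx1 : x 1 = p 1 - δ * u₁) (hσ : 0 < σ) {n : ℕ} (hn : 1 ≤ n)
    (hσδ : σ * ((n : ℝ) ^ 2)⁻¹ ≤ δ) (hδ1 : δ ≤ 1) :
    (2 - 2 / α) / 40 * christoffel n (lpBall α) x
      ≤ (16 * Real.pi * (6 + 4 / Real.sqrt σ)) ^ 2 *
        (((n : ℝ) ^ 2)⁻¹ * Real.sqrt δ * (max δ (p 0 ^ α)) ^ (1 / α - 1 / 2)) := by
  have hα₁ := h.one_lt
  have hα₂ := h.lt_two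
  have hα : 0 < α := by linarith
  have hn0 : (0 : ℝ) < n := by exact_mod_cast hn
  have hδ : 0 < δ := lt_of_lt_of_le (by positivity) hσδ
  have hπ := Real.pi_pos
  have hsδ := Real.sqrt_pos.2 hδ
  have hsδ2 := Real.mul_self_sqrt hδ.le
  have hsσ := Real.sqrt_pos.2 hσ
  have hinv : (n : ℝ)⁻¹ ≤ Real.sqrt δ / Real.sqrt σ := by
    rw [le_div_iff₀ hsσ]
    have := Real.sqrt_le_sqrt hσδ
    rw [Real.sqrt_mul hσ.le, ← inv_pow, Real.sqrt_sq (by positivity)] at this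
    linarith
  obtain ⟨c₀, c₁, hc, h0, h1, hd, hg⟩ := h.exists_functional_right hδ hδ1
  have hW : 0 ≤ (max δ (p 0 ^ α)) ^ (1 / α - 1 / 2) :=
    Real.rpow_nonneg (hδ.le.trans (le_max_left _ _)) _
  set W := (max δ (p 0 ^ α)) ^ (1 / α - 1 / 2)
  have hu0 : |u₀| ≤ 1 := abs_le_one_iff_mul_self_le_one.2 (by nlinarith only [hu, sq_nonneg u₁])
  have hu1 : |u₁| ≤ 1 := abs_le_one_iff_mul_self_le_one.2 (by nlinarith only [hu, sq_nonneg u₀])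
  have hmul : ∀ a b : ℝ, |a| ≤ 1 → |b| ≤ 1 → a * b ≤ 1 := by
    intro a b ha hb
    refine (le_abs_self _).trans ?_
    rw [abs_mul]
    exact mul_le_one₀ ha (abs_nonneg b) hb
  -- The parallelogram is cut out by the supporting functional at `p` and the one at the
  -- neighbouring boundary point. At `x` their defects are `δν ≤ 2δ` and at most `14δ + 2δ`; twice
  -- either is below `36 δ`, whose root is `6√δ`.
  have key := det_mul_christoffel_le (isCompact_lpBall hα) (interior_lpBall_nonempty hα)
    (!₂[p 0 ^ (α - 1), p 1 ^ (α - 1)]) (!₂[c₀, c₁])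
    (fun z hz => by
      simpa using abs_dual_pairing_le_one hα₁ h.nonneg h.nonneg_right h.eq_one
        (abs_of_nonneg (Real.rpow_nonneg h.nonneg _))
        (abs_of_nonneg (Real.rpow_nonneg h.nonneg_right _)) hz)
    (fun z hz => by simpa using hc _ _ hz) hxB (n := n) (m := n / 2) (by omega)
  simp only [Matrix.cons_val_zero, Matrix.cons_val_one] at key
  have hself := h.pairing_self
  have hd1 : 2 * (1 - (p 0 ^ (α - 1) * x 0 + p 1 ^ (α - 1) * x 1)) ≤ 36 * δ := by
    have : 1 - (p 0 ^ (α - 1) * x 0 + p 1 ^ (α - 1) * x 1) = δ * ν := by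
      rw [hx0, hx1]
      rw [hx, hy] at hself ⊢
      linear_combination -hself + δ * ν * hu
    rw [this]
    nlinarith only [hδ, hν2]
  have hd2 : 2 * (1 - (c₀ * x 0 + c₁ * x 1)) ≤ 36 * δ := by
    rw [hx0, hx1]
    nlinarith only [hd, hδ, mul_le_mul_of_nonneg_left (hmul c₀ u₀ h0 hu0) hδ.le,
      mul_le_mul_of_nonneg_left (hmul c₁ u₁ h1 hu1) hδ.le]
  have hm : 1 / (((n / 2 : ℕ) : ℝ) + 1) ≤ 2 * (n : ℝ)⁻¹ := by
    have h2 : (n : ℝ) ≤ 2 * (((n / 2 : ℕ) : ℝ) + 1) := by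
      exact_mod_cast (by omega : n ≤ 2 * (n / 2 + 1))
    rw [← div_eq_mul_inv, div_le_div_iff₀ (by positivity) hn0]
    linarith
  have hfac : ∀ d : ℝ, d ≤ 36 * δ →
      8 * Real.pi / (((n / 2 : ℕ) : ℝ) + 1) * (Real.sqrt d + 2 / (((n / 2 : ℕ) : ℝ) + 1))
        ≤ 16 * Real.pi * (6 + 4 / Real.sqrt σ) * ((n : ℝ)⁻¹ * Real.sqrt δ) := by
    intro d hdd
    have e1 : Real.sqrt d ≤ 6 * Real.sqrt δ := by
      refine (Real.sqrt_le_sqrt hdd).trans (le_of_eq ?_)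
      rw [Real.sqrt_mul (by norm_num), show (36 : ℝ) = 6 ^ 2 by norm_num,
        Real.sqrt_sq (by norm_num)]
    have e2 : 2 / (((n / 2 : ℕ) : ℝ) + 1) ≤ 4 * (Real.sqrt δ / Real.sqrt σ) := by
      calc 2 / (((n / 2 : ℕ) : ℝ) + 1) = 2 * (1 / (((n / 2 : ℕ) : ℝ) + 1)) := by ring
        _ ≤ 2 * (2 * (n : ℝ)⁻¹) := by gcongr
        _ ≤ 2 * (2 * (Real.sqrt δ / Real.sqrt σ)) := by gcongr
        _ = _ := by ring
    calc 8 * Real.pi / (((n / 2 : ℕ) : ℝ) + 1) * (Real.sqrt d + 2 / (((n / 2 : ℕ) : ℝ) + 1))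
        = 8 * Real.pi * (1 / (((n / 2 : ℕ) : ℝ) + 1))
          * (Real.sqrt d + 2 / (((n / 2 : ℕ) : ℝ) + 1)) := by ring
      _ ≤ 8 * Real.pi * (2 * (n : ℝ)⁻¹)
          * (6 * Real.sqrt δ + 4 * (Real.sqrt δ / Real.sqrt σ)) := by gcongr
      _ = _ := by ring
  set C := 16 * Real.pi * (6 + 4 / Real.sqrt σ) with hC
  have hC0 : 0 ≤ C := by positivity
  have hprod := mul_le_mul (hfac _ hd1) (hfac _ hd2) (by positivity)
    (by positivity : 0 ≤ C * ((n : ℝ)⁻¹ * Real.sqrt δ))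
  have hkey := key.trans hprod
  set l := christoffel n (lpBall α) x with hl
  have hl0 : 0 ≤ l := christoffel_nonneg _ _ _
  have hdet : (c₀ * p 1 ^ (α - 1) - c₁ * p 0 ^ (α - 1))
      ≤ |p 0 ^ (α - 1) * c₁ - p 1 ^ (α - 1) * c₀| := by
    rw [abs_sub_comm]
    refine le_trans (le_of_eq ?_) (le_abs_self _)
    ring
  -- `λ_n · det` is `O(n⁻² δ)` and `det · W` is at least of order `√δ`; one factor `√δ` cancels.
  have hfin : ((2 - 2 / α) / 40 * l) * Real.sqrt δ
      ≤ C ^ 2 * (((n : ℝ) ^ 2)⁻¹ * Real.sqrt δ * W) * Real.sqrt δ := by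
    calc ((2 - 2 / α) / 40 * l) * Real.sqrt δ = (2 - 2 / α) / 40 * Real.sqrt δ * l := by ring
      _ ≤ (c₀ * p 1 ^ (α - 1) - c₁ * p 0 ^ (α - 1)) * W * l := by gcongr
      _ ≤ |p 0 ^ (α - 1) * c₁ - p 1 ^ (α - 1) * c₀| * W * l := by gcongr
      _ = |p 0 ^ (α - 1) * c₁ - p 1 ^ (α - 1) * c₀| * l * W := by ring
      _ ≤ C * ((n : ℝ)⁻¹ * Real.sqrt δ) * (C * ((n : ℝ)⁻¹ * Real.sqrt δ)) * W := by gcongr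
      _ = _ := by rw [← inv_pow]; ring
  exact le_of_mul_le_mul_right hfin hsδ

theorem four_mul_add_three_sq_le {n : ℕ} (hn : 1 ≤ n) :
    (4 * (n : ℝ) + 3) ^ 2 ≤ 49 * (n : ℝ) ^ 2 := by
  have : (1 : ℝ) ≤ n := by exact_mod_cast hn
  nlinarith

/-- Lower bound for the Christoffel function in the centre of a disc. -/
theorem le_christoffel_of_ball {D : Set (EuclideanSpace ℝ (Fin 2))} (hD : IsCompact D)
    (hi : (interior D).Nonempty) {x : EuclideanSpace ℝ (Fin 2)} {r δ : ℝ} (hr : 0 < r)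
    (hrδ : r < δ) (hball : Metric.ball x δ ⊆ D) {n : ℕ} (hn : 1 ≤ n) :
    r ^ 2 / 98 * ((n : ℝ) ^ 2)⁻¹ ≤ christoffel n D x := by
  have hn1 : (1 : ℝ) ≤ n := by exact_mod_cast hn
  have key := inv_le_christoffel hD hi x (n := n) (C := 98 * (n : ℝ) ^ 2 / r ^ 2)
    fun f hf => by
      have h := pval_sq_mul_le_of_ellipse hD hf (q := x) (a := !₂[r, 0]) (b := !₂[0, r])
        (fun s t hst => hball ?_) 0
      · have hP : 0 ≤ polyInner D f f := integral_nonneg fun z => mul_self_nonneg _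
        simp only [Real.cos_zero, Real.sin_zero, zero_smul, add_zero, one_pow, one_mul,
          Matrix.cons_val_zero, Matrix.cons_val_one, mul_zero, sub_zero, abs_one,
          abs_mul_self] at h
        have h2 : 1 + 2 / ((n : ℝ) + 1) ≤ 2 := by
          have : 2 / ((n : ℝ) + 1) ≤ 1 := by rw [div_le_one (by linarith)]; linarith
          linarith
        have h3 := four_mul_add_three_sq_le hn
        rw [div_mul_eq_mul_div, le_div_iff₀ (by positivity)]
        calc pval f x ^ 2 * r ^ 2 = pval f x ^ 2 * (r * r) := by ring
          _ ≤ (4 * (n : ℝ) + 3) ^ 2 * (1 + 2 / (n + 1)) * polyInner D f f := h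
          _ ≤ (49 * (n : ℝ) ^ 2) * 2 * polyInner D f f := by gcongr
          _ = _ := by ring
      · rw [Metric.mem_ball, dist_eq_norm]
        refine lt_of_le_of_lt (b := r) ?_ hrδ
        refine abs_le_of_sq_le_sq' ?_ hr.le |>.2
        rw [norm_sq_fin_two]
        simp
        nlinarith
  refine le_trans (le_of_eq ?_) key
  rw [inv_div]
  ring

/-- Lower bound for the Christoffel function of `B_α` near the boundary. -/
theorem le_christoffel_lpBall {α ν u₀ u₁ σ δ κ : ℝ} {p x : EuclideanSpace ℝ (Fin 2)}
    (h : OnArc α (p 0) (p 1)) (hν : 1 / 2 ≤ ν) (hu : u₀ ^ 2 + u₁ ^ 2 = 1)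
    (hx : p 0 ^ (α - 1) = ν * u₀) (hy : p 1 ^ (α - 1) = ν * u₁)
    (hx0 : x 0 = p 0 - δ * u₀) (hx1 : x 1 = p 1 - δ * u₁) (hσ : 0 < σ) {n : ℕ} (hn : 1 ≤ n)
    (hσδ : σ * ((n : ℝ) ^ 2)⁻¹ ≤ δ) (hκ : 0 < κ)
    (hκα : 4 * κ ≤ (1 / 256) ^ (1 / (α - 1))) (hδκ : δ ≤ 2 * κ) :
    Real.sqrt (κ / 2) / (12544 * (1 / Real.sqrt κ + 2 / Real.sqrt σ)) *
        (((n : ℝ) ^ 2)⁻¹ * Real.sqrt δ * (max δ (p 0 ^ α)) ^ (1 / α - 1 / 2))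
      ≤ christoffel n (lpBall α) x := by
  have hα₁ := h.one_lt
  have hα₂ := h.lt_two
  have hα : 0 < α := by linarith
  have hn0 : (0 : ℝ) < n := by exact_mod_cast hn
  have hδ : 0 < δ := lt_of_lt_of_le (by positivity) hσδ
  have hsδ := Real.sqrt_pos.2 hδ
  have hsδ2 := Real.mul_self_sqrt hδ.le
  have hsσ := Real.sqrt_pos.2 hσ
  have hsκ := Real.sqrt_pos.2 hκ
  have hinv : (n : ℝ)⁻¹ ≤ Real.sqrt δ / Real.sqrt σ := by
    rw [le_div_iff₀ hsσ]
    have := Real.sqrt_le_sqrt hσδ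
    rw [Real.sqrt_mul hσ.le, ← inv_pow, Real.sqrt_sq (by positivity)] at this
    linarith
  have hM : 0 < max δ (p 0 ^ α) := lt_max_of_lt_left hδ
  have hW : 0 < (max δ (p 0 ^ α)) ^ (1 / α - 1 / 2) := Real.rpow_pos_of_pos hM _
  have hW2 := sq_rpow_weight (α := α) hM.le
  have hκ256 := hκα.trans (rpow_inv_sub_one_le hα₁ hα₂ (by norm_num) (by norm_num))
  set W := (max δ (p 0 ^ α)) ^ (1 / α - 1 / 2)
  -- Tangential semi-axis of the inscribed ellipse, whose normal semi-axis is the fixed number `κ`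
  -- and whose tip lies at depth `δ/2` below `p`.
  set β := 1 / 128 * Real.sqrt (κ / 2) * W with hβ
  have hβ0 : 0 < β := by positivity
  have hβ2 : β ^ 2 = 1 / 16384 * (κ / 2) * (max δ (p 0 ^ α)) ^ (2 / α - 1) := by
    rw [hβ, mul_pow, mul_pow, hW2, Real.sq_sqrt (by positivity)]
    ring
  have hM2 : 0 ≤ (max δ (p 0 ^ α)) ^ (2 / α - 1) := Real.rpow_nonneg hM.le _
  -- Relative height of `x`: it sits `δ/2` below the tip, so `cos²(arcsin ρ)` lies between `δ/(2κ)`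
  -- and `δ/κ`.
  set ρ := 1 - δ / (2 * κ) with hρ
  have hδκ' : δ / (2 * κ) ≤ 1 := by rw [div_le_one (by positivity)]; exact hδκ
  have hδκ0 : 0 ≤ δ / (2 * κ) := by positivity
  have hsin : Real.sin (Real.arcsin ρ) = ρ := Real.sin_arcsin (by linarith) (by linarith)
  have hcos : Real.cos (Real.arcsin ρ) ^ 2 = 1 - ρ ^ 2 := by
    have := Real.sin_sq_add_cos_sq (Real.arcsin ρ)
    rw [hsin] at this
    linarith
  have hcos_lo : δ / (2 * κ) ≤ Real.cos (Real.arcsin ρ) ^ 2 := by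
    rw [hcos, hρ]
    nlinarith only [hδκ', hδκ0]
  have hcos_hi : |Real.cos (Real.arcsin ρ)| ≤ Real.sqrt δ * (1 / Real.sqrt κ) := by
    have e : Real.sqrt δ * (1 / Real.sqrt κ) = Real.sqrt (δ / κ) := by
      rw [Real.sqrt_div hδ.le]; ring
    rw [e]
    refine Real.abs_le_sqrt ?_
    rw [hcos, hρ]
    have : δ / κ = 2 * (δ / (2 * κ)) := by field_simp
    rw [this]
    nlinarith only [hδκ0]
  have hE : ∀ r s : ℝ, r ^ 2 + s ^ 2 ≤ 1 →
      (!₂[p 0 - (κ + δ / 2) * u₀, p 1 - (κ + δ / 2) * u₁] : EuclideanSpace ℝ (Fin 2))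
        + r • (!₂[β * u₁, -(β * u₀)] : EuclideanSpace ℝ (Fin 2))
        + s • (!₂[κ * u₀, κ * u₁] : EuclideanSpace ℝ (Fin 2)) ∈ lpBall α := by
    intro r s hrs
    have hs1 : s ≤ 1 := by nlinarith only [hrs, sq_nonneg r, sq_nonneg (s - 1)]
    have hs2 : -1 ≤ s := by nlinarith only [hrs, sq_nonneg r, sq_nonneg (s + 1)]
    have hT : κ + δ / 2 - κ * s ≤ 4 * κ := by nlinarith only [hs2, hδκ, hκ]
    have hκs := mul_le_mul_of_nonneg_left hs1 hκ.le
    have := h.abs_rpow_add_abs_rpow_le_one (T := κ + δ / 2 - κ * s) (δ := δ) (X := β * r)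
      hν hu hx hy hδ (by linarith) (by linarith)
      (rpow_sub_one_le_of_le hα₁ (by norm_num) (by linarith) (hT.trans hκα)) (by
        rw [mul_pow, hβ2]
        -- From `r² ≤ 1 - s² ≤ 2(1 - s)`: the width of the ellipse at each height fits the parabolic
        -- neighbourhood.
        have e : κ / 2 * r ^ 2 ≤ κ + δ / 2 - κ * s := by
          nlinarith only [hrs, hs1, hs2, hκ, hδ, sq_nonneg (s - 1),
            mul_le_mul_of_nonneg_left hrs hκ.le, mul_nonneg hκ.le (sq_nonneg (s - 1))]
        nlinarith only [mul_le_mul_of_nonneg_right e hM2])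
    rw [mem_lpBall]
    simp only [PiLp.add_apply, PiLp.smul_apply, smul_eq_mul, Matrix.cons_val_zero,
      Matrix.cons_val_one]
    convert this using 3
    · ring_nf
    · ring_nf
  have hpt : (!₂[p 0 - (κ + δ / 2) * u₀, p 1 - (κ + δ / 2) * u₁] : EuclideanSpace ℝ (Fin 2))
      + Real.sin (Real.arcsin ρ) • (!₂[κ * u₀, κ * u₁] : EuclideanSpace ℝ (Fin 2)) = x := by
    have e : ρ * κ = κ - δ / 2 := by rw [hρ]; field_simp
    ext j
    fin_cases j
    · simp only [hsin, PiLp.add_apply, PiLp.smul_apply, smul_eq_mul, Fin.zero_eta,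
        Matrix.cons_val_zero, hx0]
      linear_combination u₀ * e
    · simp only [hsin, PiLp.add_apply, PiLp.smul_apply, smul_eq_mul, Fin.mk_one,
        Matrix.cons_val_one, Matrix.cons_val_fin_one, hx1]
      linear_combination u₁ * e
  set L := 1 / Real.sqrt κ + 2 / Real.sqrt σ with hL
  have hL0 : 0 < L := by positivity
  have key := inv_le_christoffel (isCompact_lpBall hα) (interior_lpBall_nonempty hα) x (n := n)
    (C := 98 * L * (n : ℝ) ^ 2 / (Real.sqrt δ * β)) fun f hf => by
      have hm := pval_sq_mul_le_of_ellipse (isCompact_lpBall hα) hf hE (Real.arcsin ρ)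
      rw [hpt] at hm
      simp only [Matrix.cons_val_zero, Matrix.cons_val_one] at hm
      have hdet : β * u₁ * (κ * u₁) - -(β * u₀) * (κ * u₀) = β * κ := by
        linear_combination β * κ * hu
      rw [hdet, abs_of_pos (by positivity)] at hm
      have hP : 0 ≤ polyInner (lpBall α) f f := integral_nonneg fun z => mul_self_nonneg _
      have hsum : |Real.cos (Real.arcsin ρ)| + 2 / ((n : ℝ) + 1) ≤ Real.sqrt δ * L := by
        have e1 : 2 / ((n : ℝ) + 1) ≤ 2 * (Real.sqrt δ / Real.sqrt σ) := by
          calc 2 / ((n : ℝ) + 1) ≤ 2 / (n : ℝ) := by gcongr; linarith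
            _ = 2 * (n : ℝ)⁻¹ := by ring
            _ ≤ _ := by gcongr
        calc _ ≤ Real.sqrt δ * (1 / Real.sqrt κ) + 2 * (Real.sqrt δ / Real.sqrt σ) :=
              add_le_add hcos_hi e1
          _ = _ := by rw [hL]; ring
      have h3 := four_mul_add_three_sq_le hn
      have h4 : δ / (2 * κ) * pval f x ^ 2 * (β * κ)
          ≤ 49 * (n : ℝ) ^ 2 * (Real.sqrt δ * L) * polyInner (lpBall α) f f := by
        calc _ ≤ Real.cos (Real.arcsin ρ) ^ 2 * pval f x ^ 2 * (β * κ) := by gcongr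
          _ ≤ _ := hm
          _ ≤ _ := by gcongr
      have h5 : δ / (2 * κ) * pval f x ^ 2 * (β * κ)
          = (pval f x ^ 2 * (Real.sqrt δ * β)) * Real.sqrt δ / 2 := by
        have e : δ / (2 * κ) * κ = δ / 2 := by field_simp
        linear_combination pval f x ^ 2 * β * e - pval f x ^ 2 * β / 2 * hsδ2
      rw [h5] at h4
      rw [div_mul_eq_mul_div, le_div_iff₀ (by positivity)]
      refine le_of_mul_le_mul_right ?_ hsδ
      linarith
  refine le_trans (le_of_eq ?_) key
  rw [inv_div, hβ]
  field_simp
  norm_num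

/-- Two-sided bounds for the Christoffel function of `B_α`. -/
theorem exists_christoffel_lpBall_bounds {α σ : ℝ} (hα₁ : 1 < α) (hα₂ : α < 2) (hσ : 0 < σ) :
    ∃ c : ℝ, 0 < c ∧ ∀ (n : ℕ) (p x : EuclideanSpace ℝ (Fin 2)) (δ : ℝ), 1 ≤ n →
      OnArc α (p 0) (p 1) → x ∈ lpBall α \ frontier (lpBall α) → δ = dist x p →
      (∀ q ∈ frontier (lpBall α), dist x p ≤ dist x q) → σ * ((n : ℝ) ^ 2)⁻¹ ≤ δ → δ ≤ 1 →
      c⁻¹ * (((n : ℝ) ^ 2)⁻¹ * Real.sqrt δ * (max δ (p 0 ^ α)) ^ (1 / α - 1 / 2))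
          ≤ christoffel n (lpBall α) x ∧
      christoffel n (lpBall α) x
          ≤ c * (((n : ℝ) ^ 2)⁻¹ * Real.sqrt δ * (max δ (p 0 ^ α)) ^ (1 / α - 1 / 2)) := by
  have hα : 0 < α := by linarith
  have hk : 0 < (2 - 2 / α) / 40 := by
    have : 2 / α < 2 := by rw [div_lt_iff₀ hα]; linarith
    linarith
  have hsσ := Real.sqrt_pos.2 hσ
  have ha0 : (0 : ℝ) < (1 / 256) ^ (1 / (α - 1)) := Real.rpow_pos_of_pos (by norm_num) _
  -- For `δ ≤ 2κ` the ellipse reaches depth at most `3κ`, within the range of the neighbourhood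
  -- lemma.
  set κ : ℝ := (1 / 256) ^ (1 / (α - 1)) / 4 with hκ
  have hκ0 : 0 < κ := by positivity
  have hsκ := Real.sqrt_pos.2 hκ0
  set k := (2 - 2 / α) / 40
  set A := (16 * Real.pi * (6 + 4 / Real.sqrt σ)) ^ 2 / k with hA
  set b₁ := Real.sqrt (κ / 2) / (12544 * (1 / Real.sqrt κ + 2 / Real.sqrt σ)) with hb₁
  set b₂ := κ ^ 2 / 98 with hb₂
  have hA0 : 0 < A := by have := Real.pi_pos; positivity
  have hb₁0 : 0 < b₁ := by positivity
  have hb₂0 : 0 < b₂ := by positivity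
  have hc0 : 0 < A + b₁⁻¹ + b₂⁻¹ := by positivity
  have hc1 : (A + b₁⁻¹ + b₂⁻¹)⁻¹ ≤ b₁ := by
    rw [inv_le_comm₀ hc0 hb₁0]
    have := inv_pos.2 hb₂0
    linarith
  have hc2 : (A + b₁⁻¹ + b₂⁻¹)⁻¹ ≤ b₂ := by
    rw [inv_le_comm₀ hc0 hb₂0]
    have := inv_pos.2 hb₁0
    linarith
  refine ⟨A + b₁⁻¹ + b₂⁻¹, hc0, fun n p x δ hn h hxB hδx hq hσδ hδ1 => ?_⟩
  have hn0 : (0 : ℝ) < n := by exact_mod_cast hn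
  have hδ : 0 < δ := lt_of_lt_of_le (by positivity) hσδ
  obtain ⟨ν, u₀, u₁, hν, hν2, hu, hx, hy⟩ := h.exists_normal
  have hball := ball_subset_of_dist_le_frontier (isClosed_lpBall hα) hδ hxB
    (fun q hqf => hδx ▸ hq q hqf)
  obtain ⟨hx0, hx1⟩ := coords_of_nearest h (by linarith) hu hx hy hδ hδx hball
  have hM : 0 ≤ max δ (p 0 ^ α) := hδ.le.trans (le_max_left _ _)
  have hW0 : 0 ≤ (max δ (p 0 ^ α)) ^ (1 / α - 1 / 2) := Real.rpow_nonneg hM _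
  have hW1 : (max δ (p 0 ^ α)) ^ (1 / α - 1 / 2) ≤ 1 := by
    refine Real.rpow_le_one hM (max_le hδ1 (by linarith [h.rpow_le_half])) ?_
    rw [sub_nonneg]
    exact one_div_le_one_div_of_le hα hα₂.le
  have hup := christoffel_lpBall_le h hν2 hu hx hy hxB.1 hx0 hx1 hσ hn hσδ hδ1
  set Q := ((n : ℝ) ^ 2)⁻¹ * Real.sqrt δ * (max δ (p 0 ^ α)) ^ (1 / α - 1 / 2) with hQ
  have hQ0 : 0 ≤ Q := by positivity
  constructor
  · rcases le_or_gt δ (2 * κ) with hδκ | hδκ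
    · refine (mul_le_mul_of_nonneg_right hc1 hQ0).trans ?_
      exact le_christoffel_lpBall h hν hu hx hy hx0 hx1 hσ hn hσδ hκ0 (by rw [hκ]; linarith) hδκ
    -- Away from the boundary a disc of radius `κ` suffices, since `√δ W ≤ 1`.
    · refine (mul_le_mul_of_nonneg_right hc2 hQ0).trans ?_
      refine le_trans ?_ (le_christoffel_of_ball (isCompact_lpBall hα)
        (interior_lpBall_nonempty hα) hκ0 (by linarith) hball hn)
      refine mul_le_mul_of_nonneg_left ?_ hb₂0.le
      have hs1 : Real.sqrt δ ≤ 1 := Real.sqrt_le_one.2 hδ1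
      calc Q ≤ ((n : ℝ) ^ 2)⁻¹ * 1 * 1 := by rw [hQ]; gcongr
        _ = _ := by ring
  · have h1 : christoffel n (lpBall α) x ≤ A * Q := by
      rw [hA, div_mul_eq_mul_div, le_div_iff₀ hk, mul_comm]
      exact hup
    refine h1.trans (mul_le_mul_of_nonneg_right ?_ hQ0)
    have := inv_pos.2 hb₁0
    have := inv_pos.2 hb₂0
    linarith

end Christoffel

theorem theorem2 (α : ℝ) (hα₁ : 1 < α) (hα₂ : α < 2) :
    (∃ c₀ c : ℝ, 0 < c₀ ∧ c₀ < 1 ∧ 0 < c ∧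
      ∀ p u v : EuclideanSpace ℝ (Fin 2),
        p ∈ frontier (Christoffel.lpBall α) → 0 ≤ p 0 → p 0 ≤ p 1 →
        Christoffel.IsOutwardUnitNormal (Christoffel.lpBall α) p u →
        ‖v‖ = 1 → inner ℝ u v = 0 →
        ∀ i : ℕ, i = 1 ∨ i = 2 →
          -- the maxima that define the half-lengths are attained
          (∀ t : ℝ, 0 < t → t < 1 →
            IsGreatest (Christoffel.sectionSet (Christoffel.lpBall α) p u v i t)
              (Christoffel.halfLength (Christoffel.lpBall α) p u v i t)) ∧
          (∀ t : ℝ, 0 < t → t ≤ c₀ →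
            c⁻¹ * (t ^ (1 / 2 : ℝ) * (max t (p 0 ^ α)) ^ (1 / α - 1 / 2))
                ≤ Christoffel.halfLength (Christoffel.lpBall α) p u v i t ∧
            Christoffel.halfLength (Christoffel.lpBall α) p u v i t
                ≤ c * (t ^ (1 / 2 : ℝ) * (max t (p 0 ^ α)) ^ (1 / α - 1 / 2)))) ∧
    (∀ σ : ℝ, 0 < σ → ∃ c : ℝ, 0 < c ∧
      ∀ (n : ℕ) (p x : EuclideanSpace ℝ (Fin 2)) (δ : ℝ),
        1 ≤ n →
        p ∈ frontier (Christoffel.lpBall α) → 0 ≤ p 0 → p 0 ≤ p 1 →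
        x ∈ Christoffel.lpBall α \ frontier (Christoffel.lpBall α) →
        δ = dist x p → (∀ q ∈ frontier (Christoffel.lpBall α), dist x p ≤ dist x q) →
        σ * ((n : ℝ) ^ 2)⁻¹ ≤ δ → δ ≤ 1 →
        c⁻¹ * (((n : ℝ) ^ 2)⁻¹ * δ ^ (1 / 2 : ℝ) * (max δ (p 0 ^ α)) ^ (1 / α - 1 / 2))
            ≤ Christoffel.christoffel n (Christoffel.lpBall α) x ∧
        Christoffel.christoffel n (Christoffel.lpBall α) x
            ≤ c * (((n : ℝ) ^ 2)⁻¹ * δ ^ (1 / 2 : ℝ) * (max δ (p 0 ^ α)) ^ (1 / α - 1 / 2))) := by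
  have hα : 0 < α := by linarith
  simp only [← Real.sqrt_eq_rpow]
  constructor
  · have hk : 0 < (2 - 2 / α) / 40 := by
      have : 2 / α < 2 := by rw [div_lt_iff₀ hα]; linarith
      linarith
    have hc : 0 < 128 + 32 / ((2 - 2 / α) / 40) := by positivity
    refine ⟨(1 / 256) ^ (1 / (α - 1)), 128 + 32 / ((2 - 2 / α) / 40),
      Real.rpow_pos_of_pos (by norm_num) _, ?_, hc, ?_⟩
    · exact (Christoffel.rpow_inv_sub_one_le hα₁ hα₂ (by norm_num) (by norm_num)).trans_lt
        (by norm_num)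
    · intro p u v hp h0 h1 hn hv huv i _
      have harc := Christoffel.onArc_of_mem_frontier hα₁ hα₂ hp h0 h1
      obtain ⟨hgreat, hbound⟩ := Christoffel.halfLength_bounds harc hn hv huv i
      refine ⟨hgreat, fun t ht htc => ?_⟩
      obtain ⟨hlo, hhi⟩ := hbound t ht htc
      have hQ : 0 ≤ √t * max t (p 0 ^ α) ^ (1 / α - 1 / 2) :=
        mul_nonneg (Real.sqrt_nonneg t) (Real.rpow_nonneg (ht.le.trans (le_max_left _ _)) _)
      constructor
      · refine le_trans (mul_le_mul_of_nonneg_right ?_ hQ) hlo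
        rw [inv_le_comm₀ hc (by norm_num)]
        have : 0 < 32 / ((2 - 2 / α) / 40) := by positivity
        linarith
      · rw [add_mul, div_mul_eq_mul_div]
        have := (le_div_iff₀' hk).2 hhi
        linarith
  · intro σ hσ
    obtain ⟨c, hc, hbound⟩ := Christoffel.exists_christoffel_lpBall_bounds hα₁ hα₂ hσ
    exact ⟨c, hc, fun n p x δ hn hp h0 h1 hx hδ hq hσδ hδ1 => hbound n p x δ hn
      (Christoffel.onArc_of_mem_frontier hα₁ hα₂ hp h0 h1) hx hδ hq hσδ hδ1⟩
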